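/- **Theorem 1.** Let $m\ge 1$, $T>0$, let $\nu_1\ge\nu_2\ge\dots\ge\nu_m>0$ be real numbers with $\nu_q\notin\mathbb N$ for all $q$, and put $\omega=\operatorname{diag}\{\nu_1^2-\tfrac14,\dots,\nu_m^2-\tfrac14\}$ and $\beta=\min\{1,2\nu_1\}$. Let $Q$ be a complex $m\times m$ matrix function on $(0,T)$ such that $x^{1-2\nu_1}Q(x)$ is integrable on $(0,T)$. Consider the equation $$-y''+\Bigl(\frac{\omega}{x^2}+Q(x)\Bigr)y=\rho^2y,\qquad x\in(0,T),\tag{1}$$ for vector functions $y$ with values in $\mathbb C^m$; solutions have a locally absolutely continuous derivative on $(0,T)$ and satisfy (1) almost everywhere. For $\rho^*>0$ let $$\Omega_0=\{\rho:\ 0<\arg\rho<\pi/2,\ |\rho|>\rho^*\},\qquad \Omega_{-1}=\{\rho:\ -\pi/2<\arg\rho<0,\ |\rho|>\rho^*\}.$$ Then for all sufficiently large $\rho^*$ and each $k_0\in\{0,-1\}$ there exist $m\times m$ matrix functions $Y_1(x,\rho)$, $Y_2(x,\rho)$, $x\in(0,T]$, $\rho\in\overline{\Omega_{k_0}}$,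 continuously differentiable in $x\in(0,T]$ (one-sidedly at $T$), such that for each $\rho\in\overline{\Omega_{k_0}}$ the $2m$ columns of $Y_1(\cdot,\rho)$ and $Y_2(\cdot,\rho)$ form a fundamental system of solutions of (1) (they are solutions, are linearly independent, and span the space of all solutions), and: ($i_1$) For each fixed $x\in(0,T)$ and $n=0,1$, the functions $\rho\mapsto\partial_x^{n}Y_k(x,\rho)$, $k=1,2$, are analytic in $\Omega_{k_0}$ and continuous on $\overline{\Omega_{k_0}}$. ($i_2$) For $x\in(0,T]$, $\rho\in\overline{\Omega_{k_0}}$, $|\rho x|\ge1$ and $n=0,1$, $$\partial_x^{n}Y_1(x,\rho)=(i\rho)^{n}e^{i\rho x}\bigl(I+R_{1,n}(x,\rho)\bigr),\qquad \partial_x^{n}Y_2(x,\rho)=(-i\rho)^{n}e^{-i\rho x}\bigl(I+R_{2,n}(x,\rho)\bigr),$$ where $R_{k,n}(x,\rho)=O(\rho^{-\beta})$ as $|\rho|\to\infty$, locally uniformly in $x\in(0,T]$: for every $\delta>0$ there is a $C_\delta$ with $\|R_{k,n}(x,\rho)\|\le C_\delta|\rho|^{-\beta}$ for all such $x,\rho$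 with $x\ge\delta$. Moreover, there is a constant $C$ such that $\|R_{k,n}(x,\rho)\|\le C\bigl(|\rho|^{-\beta}+|\rho x|^{-1}\bigr)$ for all $x\in(0,T]$, $\rho\in\overline{\Omega_{k_0}}$ with $|\rho x|\ge1$. Here $\|A\|=\max_{j,k}|a_{jk}|$. -/

import Mathlib

noncomputable section

/-- `sector k R` is the open sector `k π/2 < arg ρ < (k+1) π/2`, `|ρ| > R`. -/
def sector (k : ℤ) (R : ℝ) : Set ℂ :=
  {ρ : ℂ | ρ.arg ∈ Set.Ioo (k * (Real.pi / 2)) ((k + 1) * (Real.pi / 2)) ∧ R < ‖ρ‖}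

/-- The matrix `ω = diag(ω_q)`, `ω_q = ν_q² - 1/4`. -/
def omegaMatrix {m : ℕ} (ν : Fin m → ℝ) : Matrix (Fin m) (Fin m) ℂ :=
  Matrix.diagonal fun q => ((ν q ^ 2 - 1 / 4 : ℝ) : ℂ)

/-- `y` is a (Carathéodory) solution of `-y'' + (ω / x² + Q(x)) y = lam y` on `(0, T)`: it is
differentiable there, `y'` is locally absolutely continuous, the equation holds almost everywhere. -/
structure IsSolution {m : ℕ} (T : ℝ) (ν : Fin m → ℝ) (Q : ℝ → Matrix (Fin m) (Fin m) ℂ)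
    (lam : ℂ) (y : ℝ → Fin m → ℂ) : Prop where
  differentiableAt : ∀ x ∈ Set.Ioo 0 T, DifferentiableAt ℝ y x
  absolutelyContinuous : ∀ a b : ℝ, 0 < a → a ≤ b → b < T →
    AbsolutelyContinuousOnInterval (deriv y) a b
  equation : ∀ᵐ x : ℝ, x ∈ Set.Ioo 0 T →
    -deriv (deriv y) x + (((x : ℂ) ^ 2)⁻¹ • omegaMatrix ν + Q x).mulVec (y x) = lam • y x

/-- The family `y` is a fundamental system of solutions on `(0, T)`: its members are solutions,
are linearly independent as functions on `(0, T)`, and span all solutions on `(0, T)`. -/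
structure IsFundamentalSystem {m : ℕ} {ι : Type} [Fintype ι] (T : ℝ) (ν : Fin m → ℝ)
    (Q : ℝ → Matrix (Fin m) (Fin m) ℂ) (lam : ℂ) (y : ι → ℝ → Fin m → ℂ) : Prop where
  isSolution : ∀ s, IsSolution T ν Q lam (y s)
  linearIndependent : LinearIndependent ℂ fun s => fun x : Set.Ioo 0 T => y s x
  spans : ∀ z : ℝ → Fin m → ℂ, IsSolution T ν Q lam z →
    ∃ c : ι → ℂ, ∀ x ∈ Set.Ioo 0 T, z x = ∑ s, c s • y s x

/-- The columns of two matrix functions, as one family of `2m` vector functions. -/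
def columns {m : ℕ} (Y₁ Y₂ : ℝ → Matrix (Fin m) (Fin m) ℂ) : Fin m ⊕ Fin m → ℝ → Fin m → ℂ :=
  Sum.elim (fun j x i => Y₁ x i j) (fun j x i => Y₂ x i j)

/-- The entrywise `n`-th derivative in `x ∈ (0, T]` (one-sided at `T`) of `Y(x, ρ)`. -/
def xDeriv {m : ℕ} (T : ℝ) (n : ℕ) (Y : ℝ → ℂ → Matrix (Fin m) (Fin m) ℂ) (x : ℝ) (ρ : ℂ) :
    Matrix (Fin m) (Fin m) ℂ :=
  Matrix.of fun i j => iteratedDerivWithin n (fun t => Y t ρ i j) (Set.Ioc 0 T) x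

/-- The matrix `R` in `Y^{(n)}(x, ρ) = (σ i ρ)^n exp(σ i ρ x) (I + R)`, for `σ = ±1`. -/
def remainder {m : ℕ} (T : ℝ) (σ : ℂ) (n : ℕ) (Y : ℝ → ℂ → Matrix (Fin m) (Fin m) ℂ)
    (x : ℝ) (ρ : ℂ) : Matrix (Fin m) (Fin m) ℂ :=
  ((σ * Complex.I * ρ) ^ n * Complex.exp (σ * Complex.I * ρ * x))⁻¹ • xDeriv T n Y x ρ - 1

/-- Regularity of `Y(x, ρ)` for `ρ` in the closure of `Ω`: `C¹` in `x` on `(0, T]`; for fixed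
`x ∈ (0, T)`, `Y` and `Y'` are analytic in `Ω` and continuous on its closure. -/
structure IsBirkhoffRegular {m : ℕ} (T : ℝ) (Ω : Set ℂ) (Y : ℝ → ℂ → Matrix (Fin m) (Fin m) ℂ) :
    Prop where
  contDiffOn : ∀ ρ ∈ closure Ω, ∀ i j, ContDiffOn ℝ 1 (fun x => Y x ρ i j) (Set.Ioc 0 T)
  analytic : ∀ x ∈ Set.Ioo 0 T, ∀ n ≤ 1, ∀ i j, AnalyticOnNhd ℂ (fun ρ => xDeriv T n Y x ρ i j) Ω
  continuousOn : ∀ x ∈ Set.Ioo 0 T, ∀ n ≤ 1, ∀ i j,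
    ContinuousOn (fun ρ => xDeriv T n Y x ρ i j) (closure Ω)

/-- `Y^{(n)}(x, ρ) = (σ i ρ)^n exp(σ i ρ x) (I + O(ρ^{-β}))`, `n = 0, 1`, in the region
`x ∈ (0, T]`, `ρ ∈ closure Ω`, `|ρ x| ≥ 1`. The `O` is for `|ρ| → ∞`, locally uniformly in
`x ∈ (0, T]`; on the whole region the remainder is `O(|ρ|^{-β} + |ρ x|^{-1})`. -/
structure HasBirkhoffAsymptotics {m : ℕ} (T β : ℝ) (Ω : Set ℂ) (σ : ℂ)
    (Y : ℝ → ℂ → Matrix (Fin m) (Fin m) ℂ) : Prop where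
  locally_uniform : ∀ δ > 0, ∃ C : ℝ, ∀ x ∈ Set.Icc δ T, ∀ ρ ∈ closure Ω, 1 ≤ ‖ρ * x‖ →
    ∀ n ≤ 1, ∀ i j, ‖remainder T σ n Y x ρ i j‖ ≤ C * ‖ρ‖ ^ (-β)
  uniform : ∃ C : ℝ, ∀ x ∈ Set.Ioc 0 T, ∀ ρ ∈ closure Ω, 1 ≤ ‖ρ * x‖ →
    ∀ n ≤ 1, ∀ i j, ‖remainder T σ n Y x ρ i j‖ ≤ C * (‖ρ‖ ^ (-β) + ‖ρ * x‖⁻¹)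

end

/-! Put κ = siρ with s = -1 for k₀ = 0 and s = 1 for k₀ = -1. Each sector becomes part of a quadrant
Re κ > 0, s Im κ > 0, and the equation becomes y'' = (κ² + ω/x² + Q) y. One quadrant is needed at a
time, because the solution growing like e^{κx} is constructed with a contour that depends on s.

For Q = 0 the components decouple, and u(κx) is a solution whenever u'' = (1 + (ν² - 1/4)/z²) u.
With a = ν - 1/2 this has the solution e^{-z} ∫₀^∞ e^{-cs} s^a (1 + cs/(2z))^a ds up to a constant,
a multiple of √z K_ν(z) when c = 1. Its value with c = 1 gives e(z) ~ e^{-z}. Its value at -z with c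
= 1 - si gives g(z) ~ e^z (`exists_bessel_solution`, `exists_isBesselPair`). Both are O(|z|^{1/2-ν})
near 0, and their Wronskian is 2.

The potential is added by variation of constants: y = y₀ + ∫_b^x (φ(x)ψ(t) - ψ(x)φ(t)) Q(t) y(t) dt,
with φ = g/(2κ), ψ = e, where b = 0 for growing columns and b = T for decaying ones. Relative to the
weight e^{±Re κ x} min(1, |κ|x)^{1/2-ν₁} the kernel is at most a constant times |κ|^{-1} min(1,
|κ|t)^{1-2ν₁} ‖Q(t)‖, hence at most a constant times |κ|^{-β} t^{1-2ν₁} ‖Q(t)‖ (`min_rpow_le`). This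
is where the integrability hypothesis and β enter. For large |κ| the operator is a contraction
(`IsPerturbation.isVolterraContraction`), and successive approximation gives a solution holomorphic
in κ (`IsVolterraContraction.exists_solution`). The integral term contributes the error |κ|^{-β} and
the Bessel asymptotics contribute |κx|^{-1} (`IsPerturbation.exists_column`).

At x = T/2 and for large |ρ| the 2m columns and their derivatives are close to a system of pure
exponentials, so the initial data are independent (`eq_zero_of_near_exponential`). Uniqueness for
the initial value problem then yields a fundamental system (`isFundamentalSystem_of_injective`). -/

section

open MeasureTheory Set Filter Topology

noncomputable section

/-! ### A Laplace type integral -/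

/-- An open cone, with vertex removed, on which `1 + w s` stays away from `(-∞, 0]` for `s ≥ 0`. -/
def wideCone : Set ℂ := {w | -(4 / 5) * ‖w‖ < w.re}

lemma isOpen_wideCone : IsOpen wideCone :=
  isOpen_lt (continuous_const.mul continuous_norm) Complex.continuous_re

lemma wideCone_ne_zero {w : ℂ} (hw : w ∈ wideCone) : w ≠ 0 := by
  rintro rfl
  simp [wideCone] at hw

/-- With r = ‖w‖s, the square of the right side is at least 1 - (8/5)r + r², which exceeds (1 +
r)²/16 by at least (15/16)(r - 1)² + (3/20)r. -/
lemma le_norm_one_add_mul {w : ℂ} (hw : w ∈ wideCone) {s : ℝ} (hs : 0 ≤ s) :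
    (1 + ‖w‖ * s) / 4 ≤ ‖1 + w * s‖ := by
  have hw' : -(4 / 5) * ‖w‖ < w.re := hw
  have h1 : ‖1 + w * s‖ ^ 2 = 1 + 2 * s * w.re + (‖w‖ * s) ^ 2 := by
    rw [mul_pow, ← Complex.normSq_eq_norm_sq, ← Complex.normSq_eq_norm_sq, Complex.normSq_apply,
      Complex.normSq_apply]
    simp
    ring
  have h2 : -(4 / 5) * ‖w‖ * s ≤ w.re * s := mul_le_mul_of_nonneg_right hw'.le hs
  refine abs_le_of_sq_le_sq' ?_ (norm_nonneg _) |>.2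
  rw [h1]
  nlinarith [sq_nonneg (‖w‖ * s - 1), mul_nonneg (norm_nonneg w) hs]

/-- A real member of the cone is nonnegative, and a nonreal one keeps 1 + ws off the real axis for s
> 0. The principal power is therefore holomorphic along the whole ray. -/
lemma one_add_mul_mem_slitPlane {w : ℂ} (hw : w ∈ wideCone) {s : ℝ} (hs : 0 ≤ s) :
    1 + w * s ∈ Complex.slitPlane := by
  have hw' : -(4 / 5) * ‖w‖ < w.re := hw
  rw [Complex.mem_slitPlane_iff]
  by_cases h : w.im = 0
  · left
    have : ‖w‖ = |w.re| := by
      rw [Complex.norm_def, Complex.normSq_apply, h, mul_zero, add_zero, Real.sqrt_mul_self_eq_abs]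
    have hpos : 0 ≤ w.re := by
      by_contra hneg
      push Not at hneg
      rw [this, abs_of_neg hneg] at hw'
      linarith
    simp
    positivity
  · rcases hs.eq_or_lt with rfl | hs
    · left; simp
    · right; simp [h, hs.ne']

/-- The triangle inequality suffices for q ≥ 0; for q ≤ 0 the lower bound `le_norm_one_add_mul`
costs the factor 4^|q|. -/
lemma norm_cpow_one_add_mul_le {w : ℂ} (hw : w ∈ wideCone) {s : ℝ} (hs : 0 ≤ s) (q : ℝ) :
    ‖(1 + w * s) ^ (q : ℂ)‖ ≤ 4 ^ |q| * (1 + ‖w‖ * s) ^ q := by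
  rw [Complex.norm_cpow_real]
  have h0 : 0 ≤ ‖w‖ * s := by positivity
  rcases le_total 0 q with hq | hq
  · have h1 : ‖1 + w * s‖ ≤ 1 + ‖w‖ * s := by
      refine (norm_add_le _ _).trans ?_
      simp [abs_of_nonneg hs]
    calc ‖1 + w * s‖ ^ q ≤ (1 + ‖w‖ * s) ^ q := Real.rpow_le_rpow (norm_nonneg _) h1 hq
      _ ≤ 4 ^ |q| * (1 + ‖w‖ * s) ^ q :=
        le_mul_of_one_le_left (by positivity) (Real.one_le_rpow (by norm_num) (abs_nonneg q))
  · calc ‖1 + w * s‖ ^ q ≤ ((1 + ‖w‖ * s) / 4) ^ q :=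
        Real.rpow_le_rpow_of_nonpos (by positivity) (le_norm_one_add_mul hw hs) hq
      _ = 4 ^ |q| * (1 + ‖w‖ * s) ^ q := by
        rw [Real.div_rpow (by positivity) (by norm_num), abs_of_nonpos hq,
          Real.rpow_neg (by norm_num)]
        field_simp

/-- The integrand of `laplaceIntegral`. -/
def laplaceIntegrand (c : ℂ) (p q : ℝ) (w : ℂ) (s : ℝ) : ℂ :=
  Complex.exp (-c * s) * ((s ^ p : ℝ) : ℂ) * (1 + w * s) ^ (q : ℂ)

/-- The integral `∫₀^∞ e^{-cs} s^p (1 + ws)^q ds`. -/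
def laplaceIntegral (c : ℂ) (p q : ℝ) (w : ℂ) : ℂ :=
  ∫ s in Ioi (0 : ℝ), laplaceIntegrand c p q w s

/-- The real majorant of `laplaceIntegrand`. -/
def laplaceMajorant (r p q s : ℝ) : ℝ := Real.exp (-r * s) * s ^ p * (1 + s) ^ q

lemma integrableOn_exp_mul_rpow {r p : ℝ} (hr : 0 < r) (hp : -1 < p) :
    IntegrableOn (fun s : ℝ => Real.exp (-r * s) * s ^ p) (Ioi 0) := by
  have := integrableOn_rpow_mul_exp_neg_mul_rpow (p := 1) (s := p) hp zero_lt_one hr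
  refine this.congr_fun (fun s _ => ?_) measurableSet_Ioi
  simp [mul_comm]

lemma integrableOn_laplaceMajorant {r p q : ℝ} (hr : 0 < r) (hp : -1 < p) (hq : 0 ≤ q) :
    IntegrableOn (laplaceMajorant r p q) (Ioi 0) := by
  have h1 := (integrableOn_exp_mul_rpow hr hp).const_mul (2 ^ q)
  have h2 := (integrableOn_exp_mul_rpow (p := p + q) hr (by linarith)).const_mul (2 ^ q)
  refine (h1.add h2).mono' ?_ ?_
  · refine ContinuousOn.aestronglyMeasurable ?_ measurableSet_Ioi
    unfold laplaceMajorant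
    refine ((by fun_prop : ContinuousOn _ _).mul ?_).mul ?_
    · exact fun s hs => (Real.continuousAt_rpow_const _ _ (Or.inl (ne_of_gt hs))).continuousWithinAt
    · refine ContinuousOn.rpow_const (by fun_prop) fun s hs => Or.inl ?_
      have : (0 : ℝ) < s := hs
      positivity
  · refine (ae_restrict_iff' measurableSet_Ioi).2 (Eventually.of_forall fun s hs => ?_)
    have hs' : (0 : ℝ) < s := hs
    have h3 : (1 + s) ^ q ≤ 2 ^ q * (1 + s ^ q) := by
      rcases le_total s 1 with h | h
      · calc (1 + s) ^ q ≤ 2 ^ q := Real.rpow_le_rpow (by positivity) (by linarith) hq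
          _ ≤ 2 ^ q * (1 + s ^ q) := le_mul_of_one_le_right (by positivity)
            (by linarith [Real.rpow_nonneg hs'.le q])
      · calc (1 + s) ^ q ≤ (2 * s) ^ q := Real.rpow_le_rpow (by positivity) (by linarith) hq
          _ = 2 ^ q * s ^ q := Real.mul_rpow (by norm_num) hs'.le
          _ ≤ 2 ^ q * (1 + s ^ q) := by gcongr; linarith
    rw [laplaceMajorant, Real.norm_of_nonneg (by positivity)]
    calc Real.exp (-r * s) * s ^ p * (1 + s) ^ q
        ≤ Real.exp (-r * s) * s ^ p * (2 ^ q * (1 + s ^ q)) := by gcongr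
      _ = _ := by
        simp only [Pi.add_apply]
        rw [Real.rpow_add hs']
        ring

lemma norm_exp_mul_rpow (c : ℂ) (p : ℝ) {s : ℝ} (hs : 0 < s) :
    ‖Complex.exp (-c * s) * ((s ^ p : ℝ) : ℂ)‖ = Real.exp (-c.re * s) * s ^ p := by
  rw [norm_mul, Complex.norm_exp, Complex.norm_real, Real.norm_of_nonneg (by positivity)]
  simp

lemma one_add_mul_rpow_le {v W s : ℝ} (hv : 0 ≤ v) (hW : v ≤ W) (hs : 0 ≤ s) (q : ℝ) :
    (1 + v * s) ^ q ≤ (1 + W) ^ |q| * (1 + s) ^ |q| := by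
  have h1 : (1 : ℝ) ≤ 1 + v * s := by nlinarith
  have hW0 : 0 ≤ W := hv.trans hW
  calc (1 + v * s) ^ q ≤ (1 + v * s) ^ |q| := Real.rpow_le_rpow_of_exponent_le h1 (le_abs_self q)
    _ ≤ ((1 + W) * (1 + s)) ^ |q| := by
      refine Real.rpow_le_rpow (by linarith) ?_ (abs_nonneg q)
      nlinarith [mul_le_mul_of_nonneg_right hW hs]
    _ = _ := Real.mul_rpow (by positivity) (by positivity)

lemma norm_laplaceIntegrand_le {c w : ℂ} (hw : w ∈ wideCone) {W : ℝ} (hW : ‖w‖ ≤ W) (p q : ℝ)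
    {s : ℝ} (hs : 0 < s) :
    ‖laplaceIntegrand c p q w s‖ ≤ 4 ^ |q| * (1 + W) ^ |q| * laplaceMajorant c.re p |q| s := by
  rw [laplaceIntegrand, norm_mul, norm_exp_mul_rpow c p hs, laplaceMajorant]
  have h1 := norm_cpow_one_add_mul_le hw hs.le q
  have h2 := one_add_mul_rpow_le (norm_nonneg w) hW hs.le q
  have h3 : ‖(1 + w * s) ^ (q : ℂ)‖ ≤ 4 ^ |q| * ((1 + W) ^ |q| * (1 + s) ^ |q|) :=
    h1.trans (by gcongr)
  calc _ ≤ Real.exp (-c.re * s) * s ^ p * (4 ^ |q| * ((1 + W) ^ |q| * (1 + s) ^ |q|)) := by gcongr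
    _ = _ := by ring

lemma continuousOn_laplaceIntegrand (c : ℂ) (p q : ℝ) {w : ℂ} (hw : w ∈ wideCone) :
    ContinuousOn (laplaceIntegrand c p q w) (Ioi 0) := by
  unfold laplaceIntegrand
  refine ((by fun_prop : ContinuousOn _ _).mul ?_).mul ?_
  · refine Complex.continuous_ofReal.comp_continuousOn ?_
    exact fun s hs => (Real.continuousAt_rpow_const _ _ (Or.inl (ne_of_gt hs))).continuousWithinAt
  · refine ContinuousOn.cpow (by fun_prop) (by fun_prop) fun s hs => ?_
    exact one_add_mul_mem_slitPlane hw (le_of_lt hs)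

lemma integrableOn_laplaceIntegrand {c : ℂ} (hc : 0 < c.re) {p : ℝ} (hp : -1 < p) (q : ℝ) {w : ℂ}
    (hw : w ∈ wideCone) : IntegrableOn (laplaceIntegrand c p q w) (Ioi 0) := by
  refine ((integrableOn_laplaceMajorant hc hp (abs_nonneg q)).const_mul
    (4 ^ |q| * (1 + ‖w‖) ^ |q|)).mono'
    ((continuousOn_laplaceIntegrand c p q hw).aestronglyMeasurable measurableSet_Ioi) ?_
  exact (ae_restrict_iff' measurableSet_Ioi).2
    (Eventually.of_forall fun s hs => norm_laplaceIntegrand_le hw le_rfl p q hs)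

/-- Differentiation under the integral stays inside the same two-parameter family, so the Bessel
equation reduces to linear relations between its members. -/
lemma hasDerivAt_laplaceIntegral {c : ℂ} (hc : 0 < c.re) {p : ℝ} (hp : -1 < p) (q : ℝ) {w : ℂ}
    (hw : w ∈ wideCone) :
    HasDerivAt (laplaceIntegral c p q) (q * laplaceIntegral c (p + 1) (q - 1) w) w := by
  -- The unit ball gives ‖v‖ ≤ ‖w‖ + 1, hence one majorant for all nearby v.
  have hnhds : wideCone ∩ Metric.ball w 1 ∈ 𝓝 w :=
    inter_mem (isOpen_wideCone.mem_nhds hw) (Metric.ball_mem_nhds w one_pos)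
  have key := hasDerivAt_integral_of_dominated_loc_of_deriv_le
    (μ := volume.restrict (Ioi (0 : ℝ))) (F := laplaceIntegrand c p q)
    (F' := fun v s => q * laplaceIntegrand c (p + 1) (q - 1) v s)
    (bound := fun s => |q| * (4 ^ |q - 1| * (1 + (‖w‖ + 1)) ^ |q - 1| *
      laplaceMajorant c.re (p + 1) |q - 1| s))
    hnhds ?_ (integrableOn_laplaceIntegrand hc hp q hw) ?_ ?_ ?_ ?_
  · have h := key.2
    rwa [integral_const_mul] at h
  · filter_upwards [isOpen_wideCone.mem_nhds hw] with v hv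
    exact (continuousOn_laplaceIntegrand c p q hv).aestronglyMeasurable measurableSet_Ioi
  · exact ((continuousOn_laplaceIntegrand c (p + 1) (q - 1) hw).aestronglyMeasurable
      measurableSet_Ioi).const_mul _
  · refine (ae_restrict_iff' measurableSet_Ioi).2 (Eventually.of_forall fun s hs v hv => ?_)
    rw [norm_mul, Complex.norm_real, Real.norm_eq_abs]
    refine mul_le_mul_of_nonneg_left (norm_laplaceIntegrand_le hv.1 ?_ _ _ hs) (abs_nonneg q)
    have := hv.2
    rw [Metric.mem_ball, dist_eq_norm] at this
    linarith [norm_le_norm_add_norm_sub' v w]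
  · exact ((integrableOn_laplaceMajorant hc (by linarith) (abs_nonneg _)).const_mul _).const_mul _
  · refine (ae_restrict_iff' measurableSet_Ioi).2 (Eventually.of_forall fun s hs v hv => ?_)
    have hs' : (0 : ℝ) < s := hs
    have h1 : HasDerivAt (fun v : ℂ => 1 + v * s) (s : ℂ) v := by
      simpa using! ((hasDerivAt_id v).mul_const (s : ℂ)).const_add 1
    have h2 := (h1.cpow_const (c := (q : ℂ)) (one_add_mul_mem_slitPlane hv.1 hs'.le)).const_mul
      (Complex.exp (-c * s) * ((s ^ p : ℝ) : ℂ))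
    refine h2.congr_deriv ?_
    simp only [laplaceIntegrand]
    rw [Real.rpow_add_one hs'.ne']
    push_cast
    ring

/-- Split one factor 1 + ws off the power. -/
lemma laplaceIntegral_contiguous {c : ℂ} (hc : 0 < c.re) {p : ℝ} (hp : -1 < p) (q : ℝ) {w : ℂ}
    (hw : w ∈ wideCone) : laplaceIntegral c p q w =
      laplaceIntegral c p (q - 1) w + w * laplaceIntegral c (p + 1) (q - 1) w := by
  unfold laplaceIntegral
  rw [← integral_const_mul, ← integral_add (integrableOn_laplaceIntegrand hc hp _ hw)
    ((integrableOn_laplaceIntegrand hc (by linarith) _ hw).const_mul w)]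
  refine setIntegral_congr_fun measurableSet_Ioi fun s hs => ?_
  have hs' : (0 : ℝ) < s := hs
  have h0 : (1 + w * s) ≠ 0 := Complex.slitPlane_ne_zero (one_add_mul_mem_slitPlane hw hs'.le)
  have h1 : (1 + w * s) ^ (q : ℂ) = (1 + w * s) ^ ((q - 1 : ℝ) : ℂ) * (1 + w * s) := by
    nth_rewrite 3 [← Complex.cpow_one (1 + w * s)]
    rw [← Complex.cpow_add _ _ h0]
    push_cast
    ring_nf
  simp only [laplaceIntegrand]
  rw [Real.rpow_add_one hs'.ne', h1]
  push_cast
  ring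

lemma tendsto_laplaceMajorant_atTop {r : ℝ} (hr : 0 < r) (p : ℝ) {q : ℝ} (hq : 0 ≤ q) :
    Tendsto (laplaceMajorant r p q) atTop (𝓝 0) := by
  have h := (tendsto_rpow_mul_exp_neg_mul_atTop_nhds_zero (p + q) r hr).const_mul (2 ^ q)
  rw [mul_zero] at h
  refine squeeze_zero' ?_ ?_ h
  · filter_upwards [eventually_gt_atTop 0] with s hs
    unfold laplaceMajorant
    positivity
  · filter_upwards [eventually_ge_atTop 1] with s hs
    have hs' : 0 < s := by linarith
    have : (1 + s) ^ q ≤ 2 ^ q * s ^ q := by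
      rw [← Real.mul_rpow (by norm_num) hs'.le]
      exact Real.rpow_le_rpow (by positivity) (by linarith) hq
    calc laplaceMajorant r p q s ≤ Real.exp (-r * s) * s ^ p * (2 ^ q * s ^ q) := by
          unfold laplaceMajorant; gcongr
      _ = _ := by rw [Real.rpow_add hs']; ring

/-- The integrand vanishes at 0 because p > 0 and at infinity by exponential decay, so its
derivative integrates to zero. -/
lemma laplaceIntegral_by_parts {c : ℂ} (hc : 0 < c.re) {p : ℝ} (hp : 0 < p) (q : ℝ) {w : ℂ}
    (hw : w ∈ wideCone) : c * laplaceIntegral c p q w =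
      p * laplaceIntegral c (p - 1) q w + q * w * laplaceIntegral c p (q - 1) w := by
  have i1 := (integrableOn_laplaceIntegrand hc (by linarith : -1 < p - 1) q hw).const_mul (p : ℂ)
  have i2 := (integrableOn_laplaceIntegrand hc (by linarith : -1 < p) (q - 1) hw).const_mul
    (q * w : ℂ)
  have i3 := (integrableOn_laplaceIntegrand hc (by linarith : -1 < p) q hw).const_mul c
  have key := integral_Ioi_of_hasDerivAt_of_tendsto (a := (0 : ℝ)) (m := (0 : ℂ))
    (f := laplaceIntegrand c p q w)
    (f' := fun s => (p * laplaceIntegrand c (p - 1) q w s + q * w * laplaceIntegrand c p (q - 1) w s)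
      - c * laplaceIntegrand c p q w s) ?_ ?_ ((i1.add i2).sub i3) ?_
  · rw [integral_sub (by exact i1.add i2) i3, integral_add i1 i2, integral_const_mul,
      integral_const_mul, integral_const_mul] at key
    have h0 : laplaceIntegrand c p q w 0 = 0 := by
      simp [laplaceIntegrand, Real.zero_rpow hp.ne']
    rw [h0, sub_zero, sub_eq_zero] at key
    exact key.symm
  · refine ContinuousAt.continuousWithinAt ?_
    unfold laplaceIntegrand
    refine ((by fun_prop : ContinuousAt _ _).mul ?_).mul ?_
    · exact Complex.continuous_ofReal.continuousAt.comp
        (Real.continuousAt_rpow_const _ _ (Or.inr hp.le))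
    · refine ContinuousAt.cpow (by fun_prop) (by fun_prop) ?_
      exact one_add_mul_mem_slitPlane hw le_rfl
  · intro s hs
    have hs' : (0 : ℝ) < s := hs
    have e1 : HasDerivAt (fun s : ℝ => Complex.exp (-c * s)) (Complex.exp (-c * s) * -c) s := by
      have := ((hasDerivAt_id (s : ℂ)).const_mul (-c)).cexp.comp_ofReal
      simpa using! this
    have e2 : HasDerivAt (fun s : ℝ => ((s ^ p : ℝ) : ℂ)) ((p * s ^ (p - 1) : ℝ) : ℂ) s :=
      (Real.hasDerivAt_rpow_const (Or.inl hs'.ne')).ofReal_comp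
    have e3 : HasDerivAt (fun s : ℝ => (1 + w * s) ^ (q : ℂ))
        (q * (1 + w * s) ^ ((q : ℂ) - 1) * w) s := by
      have h1 : HasDerivAt (fun v : ℂ => 1 + w * v) w (s : ℂ) := by
        simpa using! ((hasDerivAt_id (s : ℂ)).const_mul w).const_add 1
      exact (h1.cpow_const (c := (q : ℂ)) (one_add_mul_mem_slitPlane hw hs'.le)).comp_ofReal
    refine ((e1.mul e2).mul e3).congr_deriv ?_
    simp only [laplaceIntegrand, Pi.mul_apply]
    push_cast
    ring
  · have h := (tendsto_laplaceMajorant_atTop hc p (abs_nonneg q)).const_mul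
      (4 ^ |q| * (1 + ‖w‖) ^ |q|)
    rw [mul_zero] at h
    refine squeeze_zero_norm' ?_ h
    filter_upwards [eventually_gt_atTop 0] with s hs
    exact norm_laplaceIntegrand_le hw le_rfl p q hs

lemma norm_laplaceIntegral_le {c : ℂ} (hc : 0 < c.re) {p : ℝ} (hp : -1 < p) (q W : ℝ) :
    ∃ C, 0 ≤ C ∧ ∀ w ∈ wideCone, ‖w‖ ≤ W → ‖laplaceIntegral c p q w‖ ≤ C := by
  -- The absolute value makes the constant nonnegative for every W; for W < 0 the bound itself is
  -- vacuous.
  refine ⟨|4 ^ |q| * (1 + W) ^ |q| * ∫ s in Ioi (0 : ℝ), laplaceMajorant c.re p |q| s|,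
    abs_nonneg _, fun w hw hwW => ?_⟩
  refine le_trans ?_ (le_abs_self _)
  rw [← integral_const_mul]
  refine norm_integral_le_of_norm_le
    ((integrableOn_laplaceMajorant hc hp (abs_nonneg q)).const_mul _) ?_
  exact (ae_restrict_iff' measurableSet_Ioi).2
    (Eventually.of_forall fun s hs => norm_laplaceIntegrand_le hw hwW p q hs)

/-! ### Solutions of the modified Bessel equation with prescribed asymptotics -/

lemma one_mem_wideCone : (1 : ℂ) ∈ wideCone := by
  simp only [wideCone, mem_ofPred_eq, norm_one, Complex.one_re]
  norm_num

lemma mul_mem_wideCone {w : ℂ} (hw : w ∈ wideCone) {r : ℝ} (hr : 0 < r) :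
    (r : ℂ) * w ∈ wideCone := by
  have hw' : -(4 / 5) * ‖w‖ < w.re := hw
  simp only [wideCone, mem_ofPred_eq, norm_mul, Complex.norm_real, Real.norm_of_nonneg hr.le,
    Complex.re_ofReal_mul]
  nlinarith

lemma laplaceIntegral_zero_exponent (c : ℂ) (p : ℝ) (w : ℂ) :
    laplaceIntegral c p 0 w = ∫ s in Ioi (0 : ℝ), Complex.exp (-c * s) * ((s ^ p : ℝ) : ℂ) := by
  simp [laplaceIntegral, laplaceIntegrand]

/-- For q = 0 the last argument has no influence, and 1 is a placeholder. The derivative in the rate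
serves to evaluate the normalising integral for complex c. -/
lemma hasDerivAt_laplaceIntegral_rate {c : ℂ} (hc : 0 < c.re) {p : ℝ} (hp : -1 < p) :
    HasDerivAt (fun d => laplaceIntegral d p 0 1) (-laplaceIntegral c (p + 1) 0 1) c := by
  simp only [laplaceIntegral_zero_exponent]
  have hmeas : ∀ (d : ℂ) (p : ℝ), AEStronglyMeasurable
      (fun s : ℝ => Complex.exp (-d * s) * ((s ^ p : ℝ) : ℂ)) (volume.restrict (Ioi 0)) := by
    intro d p
    have := (continuousOn_laplaceIntegrand d p 0 one_mem_wideCone).aestronglyMeasurable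
      (μ := volume) measurableSet_Ioi
    refine this.congr (Eventually.of_forall fun s => ?_)
    simp [laplaceIntegrand]
  have hnhds : {d : ℂ | c.re / 2 < d.re} ∈ 𝓝 c :=
    (isOpen_lt continuous_const Complex.continuous_re).mem_nhds (by simp; linarith)
  have key := hasDerivAt_integral_of_dominated_loc_of_deriv_le
    (μ := volume.restrict (Ioi (0 : ℝ)))
    (F := fun (d : ℂ) (s : ℝ) => Complex.exp (-d * s) * ((s ^ p : ℝ) : ℂ))
    (F' := fun (d : ℂ) (s : ℝ) => -(Complex.exp (-d * s) * ((s ^ (p + 1) : ℝ) : ℂ)))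
    (bound := fun s => Real.exp (-(c.re / 2) * s) * s ^ (p + 1))
    hnhds (Eventually.of_forall fun d => hmeas d p) ?_ (hmeas c (p + 1)).neg ?_
    (integrableOn_exp_mul_rpow (by linarith) (by linarith)) ?_
  · have h := key.2
    rwa [integral_neg] at h
  · have := integrableOn_laplaceIntegrand hc hp 0 one_mem_wideCone
    refine Integrable.congr this (Eventually.of_forall fun s => ?_)
    simp [laplaceIntegrand]
  · refine (ae_restrict_iff' measurableSet_Ioi).2 (Eventually.of_forall fun s hs d hd => ?_)
    have hs' : (0 : ℝ) < s := hs
    have hd' : c.re / 2 < d.re := hd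
    rw [norm_neg, norm_exp_mul_rpow d (p + 1) hs']
    gcongr
  · refine (ae_restrict_iff' measurableSet_Ioi).2 (Eventually.of_forall fun s hs d hd => ?_)
    have hs' : (0 : ℝ) < s := hs
    have h1 : HasDerivAt (fun d : ℂ => Complex.exp (-d * s)) (Complex.exp (-d * s) * (-s)) d := by
      simpa using! ((hasDerivAt_id d).neg.mul_const (s : ℂ)).cexp
    refine (h1.mul_const ((s ^ p : ℝ) : ℂ)).congr_deriv ?_
    rw [Real.rpow_add_one hs'.ne']
    push_cast
    ring

/-- The integral is Γ(p+1) c^{-(p+1)}: its product with c^{p+1} has derivative zero on the right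
half-plane by `laplaceIntegral_by_parts`, and equals Γ(p+1) at c = 1. -/
lemma laplaceIntegral_zero_exponent_ne_zero {c : ℂ} (hc : 0 < c.re) {p : ℝ} (hp : -1 < p) (w : ℂ) :
    laplaceIntegral c p 0 w ≠ 0 := by
  have hw : laplaceIntegral c p 0 w = laplaceIntegral c p 0 1 := by
    simp only [laplaceIntegral_zero_exponent]
  rw [hw]
  set S : Set ℂ := {d : ℂ | 0 < d.re}
  have hS : IsOpen S := isOpen_lt continuous_const Complex.continuous_re
  have hconv : Convex ℝ S := convex_halfSpace_re_gt 0
  have hder : ∀ d ∈ S, HasDerivAt (fun d => laplaceIntegral d p 0 1 * d ^ ((p + 1 : ℝ) : ℂ)) 0 d := by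
    intro d hd
    have hd' : 0 < d.re := hd
    have hd0 : d ≠ 0 := by rintro rfl; simp at hd'
    have h1 := hasDerivAt_laplaceIntegral_rate hd' hp
    have h2 : HasDerivAt (fun d : ℂ => d ^ ((p + 1 : ℝ) : ℂ)) _ d :=
      (hasDerivAt_id d).cpow_const (c := ((p + 1 : ℝ) : ℂ)) (Or.inl hd')
    refine (h1.mul h2).congr_deriv ?_
    have h3 := laplaceIntegral_by_parts hd' (by linarith : 0 < p + 1) 0 one_mem_wideCone
    simp only [Complex.ofReal_zero, zero_mul, add_zero, add_sub_cancel_right] at h3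
    have h4 : d ^ ((p + 1 : ℝ) : ℂ) = d ^ (((p + 1 : ℝ) : ℂ) - 1) * d := by
      nth_rewrite 3 [← Complex.cpow_one d]
      rw [← Complex.cpow_add _ _ hd0]
      ring_nf
    rw [h4]
    simp only [id]
    linear_combination (-(d ^ (((p + 1 : ℝ) : ℂ) - 1))) * h3
  have hconst := hconv.is_const_of_fderivWithin_eq_zero (𝕜 := ℂ)
    (f := fun d => laplaceIntegral d p 0 1 * d ^ ((p + 1 : ℝ) : ℂ))
    (fun d hd => (hder d hd).differentiableAt.differentiableWithinAt)
    (fun d hd => by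
      rw [fderivWithin_of_isOpen hS hd, (hder d hd).hasFDerivAt.fderiv]
      ext
      simp)
    (show c ∈ S from hc) (show (1 : ℂ) ∈ S by simp [S])
  intro h0
  simp only [h0, zero_mul, Complex.one_cpow, mul_one] at hconst
  rw [laplaceIntegral_zero_exponent] at hconst
  have hG : (∫ s in Ioi (0 : ℝ), Complex.exp (-1 * s) * ((s ^ p : ℝ) : ℂ)) =
      ((Real.Gamma (p + 1) : ℝ) : ℂ) := by
    rw [Real.Gamma_eq_integral (by linarith), ← integral_complex_ofReal]
    refine setIntegral_congr_fun measurableSet_Ioi fun s hs => ?_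
    simp
  rw [hG] at hconst
  exact (Real.Gamma_pos_of_pos (by linarith : 0 < p + 1)).ne' (by exact_mod_cast hconst.symm)

lemma norm_cpow_one_add_mul_sub_one_le {w : ℂ} (hw : w ∈ wideCone) {W : ℝ} (hW : ‖w‖ ≤ W) (q : ℝ)
    {s : ℝ} (hs : 0 ≤ s) : ‖(1 + w * s) ^ (q : ℂ) - 1‖ ≤
      |q| * (4 ^ |q - 1| * ((1 + W) ^ |q - 1| * (1 + s) ^ |q - 1|)) * ‖w‖ * s := by
  have hder : ∀ x ∈ Icc (0 : ℝ) s, HasDerivWithinAt (fun x : ℝ => (1 + w * x) ^ (q : ℂ))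
      (q * (1 + w * x) ^ ((q : ℂ) - 1) * w) (Icc 0 s) x := by
    intro x hx
    have h1 : HasDerivAt (fun v : ℂ => 1 + w * v) w (x : ℂ) := by
      simpa using! ((hasDerivAt_id (x : ℂ)).const_mul w).const_add 1
    exact (h1.cpow_const (c := (q : ℂ))
      (one_add_mul_mem_slitPlane hw hx.1)).comp_ofReal.hasDerivWithinAt
  have key := norm_image_sub_le_of_norm_deriv_le_segment' hder
    (C := |q| * (4 ^ |q - 1| * ((1 + W) ^ |q - 1| * (1 + s) ^ |q - 1|)) * ‖w‖) ?_ s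
    (right_mem_Icc.2 hs)
  · simpa using! key
  · intro x hx
    have h1 := norm_cpow_one_add_mul_le hw hx.1 (q - 1)
    have h2 := one_add_mul_rpow_le (norm_nonneg w) hW hx.1 (q - 1)
    have hW0 : 0 ≤ W := (norm_nonneg w).trans hW
    have h3 : (1 + x) ^ |q - 1| ≤ (1 + s) ^ |q - 1| :=
      Real.rpow_le_rpow (by linarith [hx.1]) (by linarith [hx.2]) (abs_nonneg _)
    rw [norm_mul, norm_mul, Complex.norm_real, Real.norm_eq_abs]
    push_cast at h1
    gcongr
    refine h1.trans ?_
    gcongr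
    refine h2.trans ?_
    gcongr

/-- Since w will be c/(2z), this linear bound is the O(1/z) in the asymptotics of the Bessel
solutions. -/
lemma norm_laplaceIntegral_sub_le {c : ℂ} (hc : 0 < c.re) {p : ℝ} (hp : -1 < p) (q W : ℝ) :
    ∃ C, 0 ≤ C ∧ ∀ w ∈ wideCone, ‖w‖ ≤ W →
      ‖laplaceIntegral c p q w - laplaceIntegral c p 0 w‖ ≤ C * ‖w‖ := by
  refine ⟨|∫ s in Ioi (0 : ℝ), |q| * 4 ^ |q - 1| * (1 + W) ^ |q - 1| *
    laplaceMajorant c.re (p + 1) |q - 1| s|, abs_nonneg _, fun w hw hwW => ?_⟩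
  refine le_trans ?_ (mul_le_mul_of_nonneg_right (le_abs_self _) (norm_nonneg w))
  rw [mul_comm, ← integral_const_mul]
  unfold laplaceIntegral
  rw [← integral_sub (integrableOn_laplaceIntegrand hc hp q hw)
    (integrableOn_laplaceIntegrand hc hp 0 hw)]
  refine norm_integral_le_of_norm_le
    (((integrableOn_laplaceMajorant hc (by linarith) (abs_nonneg _)).const_mul _).const_mul _) ?_
  refine (ae_restrict_iff' measurableSet_Ioi).2 (Eventually.of_forall fun s hs => ?_)
  have hs' : (0 : ℝ) < s := hs
  have h1 : laplaceIntegrand c p q w s - laplaceIntegrand c p 0 w s =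
      Complex.exp (-c * s) * ((s ^ p : ℝ) : ℂ) * ((1 + w * s) ^ (q : ℂ) - 1) := by
    simp only [laplaceIntegrand, Complex.ofReal_zero, Complex.cpow_zero]
    ring
  rw [h1, norm_mul, norm_exp_mul_rpow c p hs', laplaceMajorant, Real.rpow_add_one hs'.ne']
  calc _ ≤ Real.exp (-c.re * s) * s ^ p *
        (|q| * (4 ^ |q - 1| * ((1 + W) ^ |q - 1| * (1 + s) ^ |q - 1|)) * ‖w‖ * s) := by
        gcongr
        exact norm_cpow_one_add_mul_sub_one_le hw hwW q hs'.le
    _ = _ := by ring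

/-- Behaviour of the integral as `‖w‖ → ∞`. -/
lemma norm_laplaceIntegral_le_rpow {c : ℂ} (hc : 0 < c.re) {a : ℝ} (ha : -(1 / 2) < a) {w₀ : ℝ}
    (hw₀ : 0 < w₀) : ∃ C, 0 ≤ C ∧ ∀ w ∈ wideCone, w₀ ≤ ‖w‖ →
      ‖laplaceIntegral c a a w‖ ≤ C * ‖w‖ ^ a := by
  -- For a ≥ 0 the summand 1 in 1 + ‖w‖s is absorbed by means of ‖w‖ ≥ w₀. For a ≤ 0 it is dropped,
  -- which leaves s^{2a}, integrable at 0 because a > -1/2.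
  rcases le_total 0 a with h | h
  · refine ⟨|∫ s in Ioi (0 : ℝ), 4 ^ |a| * (1 / w₀ + 1) ^ a * laplaceMajorant c.re a a s|,
      abs_nonneg _, fun w hw hww => ?_⟩
    have hwpos : 0 < ‖w‖ := hw₀.trans_le hww
    refine le_trans ?_ (mul_le_mul_of_nonneg_right (le_abs_self _) (by positivity))
    rw [mul_comm, ← integral_const_mul]
    refine norm_integral_le_of_norm_le
      (((integrableOn_laplaceMajorant hc (by linarith) h).const_mul _).const_mul _) ?_
    refine (ae_restrict_iff' measurableSet_Ioi).2 (Eventually.of_forall fun s hs => ?_)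
    have hs' : (0 : ℝ) < s := hs
    rw [laplaceIntegrand, norm_mul, norm_exp_mul_rpow c a hs', laplaceMajorant]
    have h2 : (1 + ‖w‖ * s) ^ a ≤ ‖w‖ ^ a * ((1 / w₀ + 1) ^ a * (1 + s) ^ a) := by
      rw [← Real.mul_rpow (by positivity) (by positivity),
        ← Real.mul_rpow (by positivity) (by positivity)]
      refine Real.rpow_le_rpow (by positivity) ?_ h
      have h3 : 1 ≤ ‖w‖ * (1 / w₀) := by
        rw [mul_one_div, one_le_div hw₀]; exact hww
      have h4 : 0 ≤ ‖w‖ * (1 / w₀) * s := by positivity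
      nlinarith
    calc _ ≤ Real.exp (-c.re * s) * s ^ a *
          (4 ^ |a| * (‖w‖ ^ a * ((1 / w₀ + 1) ^ a * (1 + s) ^ a))) := by
          gcongr
          refine (norm_cpow_one_add_mul_le hw hs'.le a).trans ?_
          gcongr
      _ = _ := by ring
  · refine ⟨|∫ s in Ioi (0 : ℝ), 4 ^ |a| * (Real.exp (-c.re * s) * s ^ (a + a))|,
      abs_nonneg _, fun w hw hww => ?_⟩
    have hwpos : 0 < ‖w‖ := hw₀.trans_le hww
    refine le_trans ?_ (mul_le_mul_of_nonneg_right (le_abs_self _) (by positivity))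
    rw [mul_comm, ← integral_const_mul]
    refine norm_integral_le_of_norm_le
      (((integrableOn_exp_mul_rpow hc (by linarith)).const_mul _).const_mul _) ?_
    refine (ae_restrict_iff' measurableSet_Ioi).2 (Eventually.of_forall fun s hs => ?_)
    have hs' : (0 : ℝ) < s := hs
    rw [laplaceIntegrand, norm_mul, norm_exp_mul_rpow c a hs', Real.rpow_add hs']
    have h2 : (1 + ‖w‖ * s) ^ a ≤ ‖w‖ ^ a * s ^ a := by
      rw [← Real.mul_rpow (by positivity) (by positivity)]
      exact Real.rpow_le_rpow_of_nonpos (by positivity) (by linarith) h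
    calc _ ≤ Real.exp (-c.re * s) * s ^ a * (4 ^ |a| * (‖w‖ ^ a * s ^ a)) := by
          gcongr
          refine (norm_cpow_one_add_mul_le hw hs'.le a).trans ?_
          gcongr
      _ = _ := by ring

/-- The solution `e^{-z}(1 + O(1/z))` of `u'' = (1 + (ν² - 1/4) / z²) u`, as a function on the
set of all `z` with `c / z` in `wideCone`. -/
theorem exists_bessel_solution {ν : ℝ} (hν : 0 < ν) {c : ℂ} (hc : 0 < c.re) :
    ∃ H H' : ℂ → ℂ, ∃ C : ℝ, 0 ≤ C ∧ ∀ z : ℂ, c / z ∈ wideCone →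
      HasDerivAt H (H' z) z ∧
      HasDerivAt H' ((1 + ((ν ^ 2 - 1 / 4 : ℝ) : ℂ) / z ^ 2) * H z) z ∧
      ‖Complex.exp z * H z‖ ≤ C * min 1 ‖z‖ ^ (1 / 2 - ν) ∧
      (1 ≤ ‖z‖ → ‖Complex.exp z * H z - 1‖ ≤ C / ‖z‖ ∧ ‖Complex.exp z * H' z + 1‖ ≤ C / ‖z‖) := by
  -- Here a is the exponent in the integral representation of K_ν, and c is the direction of its
  -- contour.
  obtain ⟨a, rfl⟩ : ∃ a, ν = a + 1 / 2 := ⟨ν - 1 / 2, by ring⟩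
  have ha : -(1 / 2) < a := by linarith
  have ha1 : -1 < a := by linarith
  set N := laplaceIntegral c a 0 1 with hN
  have hN0 : N ≠ 0 := laplaceIntegral_zero_exponent_ne_zero hc ha1 1
  have hNw : ∀ w, laplaceIntegral c a 0 w = N := fun w => by
    simp only [hN, laplaceIntegral_zero_exponent]
  have hc0 : c ≠ 0 := by rintro rfl; simp at hc
  have hcn : 0 < ‖c‖ := norm_pos_iff.2 hc0
  obtain ⟨C₁, hC₁, hb₁⟩ := norm_laplaceIntegral_le_rpow hc ha (half_pos hcn)
  obtain ⟨C₂, hC₂, hb₂⟩ := norm_laplaceIntegral_sub_le hc ha1 a (‖c‖ / 2)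
  obtain ⟨C₃, hC₃, hb₃⟩ := norm_laplaceIntegral_le hc (by linarith : -1 < a + 1) (a - 1) (‖c‖ / 2)
  obtain ⟨C₄, hC₄, hb₄⟩ := norm_laplaceIntegral_le hc ha1 a (‖c‖ / 2)
  set f : ℂ → ℂ := fun z => laplaceIntegral c a a (c / (2 * z)) with hf
  set f₁ : ℂ → ℂ := fun z => laplaceIntegral c (a + 1) (a - 1) (c / (2 * z)) with hf₁
  -- The four summands serve the bound near 0, the bound away from 0, the error of f, and the f₁
  -- term of the derivative; one constant covers them all.
  set K := C₁ * (‖c‖ / 2) ^ a + C₄ + C₂ * ‖c‖ + |a| * ‖c‖ * C₃ with hK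
  have hK0 : 0 ≤ K := by positivity
  refine ⟨fun z => Complex.exp (-z) * f z / N,
    fun z => Complex.exp (-z) * (-f z - c / (2 * z ^ 2) * a * f₁ z) / N, K / ‖N‖,
    by positivity, fun z hz => ?_⟩
  have hz0 : z ≠ 0 := by
    rintro rfl
    exact wideCone_ne_zero hz (by simp)
  have hzn : 0 < ‖z‖ := norm_pos_iff.2 hz0
  have hw : c / (2 * z) ∈ wideCone := by
    have := mul_mem_wideCone hz (r := 1 / 2) (by norm_num)
    convert this using 1
    push_cast
    field_simp
  have hwn : ‖c / (2 * z)‖ = ‖c‖ / 2 / ‖z‖ := by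
    rw [norm_div, norm_mul, Complex.norm_ofNat]
    field_simp
  have hdw : HasDerivAt (fun z : ℂ => c / (2 * z)) (-(c / (2 * z ^ 2))) z := by
    have h := (((hasDerivAt_id z).const_mul 2).inv (by simpa using hz0)).const_mul c
    refine h.congr_deriv ?_
    simp only [id]
    field_simp
  have hdf : HasDerivAt f (a * f₁ z * -(c / (2 * z ^ 2))) z :=
    HasDerivAt.comp (h₂ := laplaceIntegral c a a) z (hasDerivAt_laplaceIntegral hc ha1 a hw) hdw
  have hdf₁ : HasDerivAt f₁ ((a - 1 : ℝ) *
      laplaceIntegral c (a + 1 + 1) (a - 1 - 1) (c / (2 * z)) * -(c / (2 * z ^ 2))) z :=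
    HasDerivAt.comp (h₂ := laplaceIntegral c (a + 1) (a - 1)) z
      (hasDerivAt_laplaceIntegral hc (by linarith) (a - 1) hw) hdw
  have hdexp : HasDerivAt (fun z : ℂ => Complex.exp (-z)) (-Complex.exp (-z)) z := by
    simpa using! (hasDerivAt_id z).neg.cexp
  have hdc : HasDerivAt (fun z : ℂ => c / (2 * z ^ 2)) (-(c / z ^ 3)) z := by
    have h := (((hasDerivAt_pow 2 z).const_mul 2).inv (by simpa using hz0)).const_mul c
    refine h.congr_deriv ?_
    field_simp
    ring
  have hexp : Complex.exp z * Complex.exp (-z) = 1 := by rw [← Complex.exp_add]; simp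
  refine ⟨?_, ?_, ?_, ?_⟩
  · refine ((hdexp.mul hdf).div_const N).congr_deriv ?_
    ring
  · have hdg : HasDerivAt (fun z => -f z - c / (2 * z ^ 2) * a * f₁ z) _ z :=
      hdf.neg.sub ((hdc.mul_const (a : ℂ)).mul hdf₁)
    refine ((hdexp.mul hdg).div_const N).congr_deriv ?_
    have r1 := laplaceIntegral_by_parts hc (by linarith : 0 < a + 1) (a - 1) hw
    have r2 := laplaceIntegral_contiguous hc ha1 a hw
    have r3 := laplaceIntegral_contiguous hc (by linarith : -1 < a + 1) (a - 1) hw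
    rw [add_sub_cancel_right] at r1
    simp only [hf, hf₁]
    set A := laplaceIntegral c a a (c / (2 * z))
    set B := laplaceIntegral c (a + 1) (a - 1) (c / (2 * z))
    set D := laplaceIntegral c a (a - 1) (c / (2 * z))
    set E := laplaceIntegral c (a + 1) (a - 1 - 1) (c / (2 * z))
    set G := laplaceIntegral c (a + 1 + 1) (a - 1 - 1) (c / (2 * z))
    -- This is z² times f'' - 2f' = a(a+1) z⁻² f, the equation that f must satisfy for e^{-z} f to
    -- solve the Bessel equation.
    have main : a * (2 * (c / (2 * z)) * B + (a - 1) * (c / (2 * z)) ^ 2 * G + c * B) =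
        a * (a + 1) * A := by
      push_cast at r1
      linear_combination (a : ℂ) * r1 - a * (a + 1) * r2 - a * (a - 1) * (c / (2 * z)) * r3
    have main' : a * (a + 1) / z ^ 2 * A =
        a * (2 * (c / (2 * z)) * B + (a - 1) * (c / (2 * z)) ^ 2 * G + c * B) / z ^ 2 := by
      rw [main]; ring
    have e1 : ((((a + 1 / 2) ^ 2 - 1 / 4 : ℝ) : ℂ)) = a * (a + 1) := by push_cast; ring
    rw [e1]
    have e2 : (1 + a * (a + 1) / z ^ 2) * (Complex.exp (-z) * A / N) =
        Complex.exp (-z) / N * (A + a * (a + 1) / z ^ 2 * A) := by ring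
    rw [e2, main']
    push_cast
    field_simp
    ring
  · have e : Complex.exp z * (Complex.exp (-z) * f z / N) = f z / N := by
      linear_combination f z / N * hexp
    rw [e, norm_div, div_mul_eq_mul_div]
    gcongr
    have e2 : (1 / 2 - (a + 1 / 2) : ℝ) = -a := by ring
    rw [e2]
    -- The circle ‖z‖ = 1 corresponds to ‖c/(2z)‖ = ‖c‖/2, the value separating the estimates for
    -- bounded and for large w.
    rcases le_total 1 ‖z‖ with h | h
    · rw [min_eq_left h, Real.one_rpow, mul_one]
      have : ‖f z‖ ≤ C₄ := hb₄ _ hw (by rw [hwn]; exact div_le_self (by positivity) h)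
      have : 0 ≤ C₁ * (‖c‖ / 2) ^ a + C₂ * ‖c‖ + |a| * ‖c‖ * C₃ := by positivity
      linarith
    · rw [min_eq_right h]
      have h1 : ‖f z‖ ≤ C₁ * ‖c / (2 * z)‖ ^ a :=
        hb₁ _ hw (by rw [hwn]; exact le_div_self (by positivity) hzn h)
      rw [hwn, Real.div_rpow (by positivity) hzn.le] at h1
      rw [Real.rpow_neg hzn.le, ← div_eq_mul_inv]
      refine h1.trans ?_
      rw [← mul_div_assoc]
      gcongr
      have : 0 ≤ C₄ + C₂ * ‖c‖ + |a| * ‖c‖ * C₃ := by positivity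
      linarith
  · intro h
    have hwle : ‖c / (2 * z)‖ ≤ ‖c‖ / 2 := by rw [hwn]; exact div_le_self (by positivity) h
    have h1 : ‖f z - N‖ ≤ C₂ * ‖c‖ / ‖z‖ := by
      have := hb₂ _ hw hwle
      rw [hNw, hwn] at this
      refine this.trans ?_
      rw [mul_div_assoc]
      gcongr
      linarith
    have h2 : ‖c / (2 * z ^ 2) * a * f₁ z‖ ≤ |a| * ‖c‖ * C₃ / ‖z‖ := by
      have h3 := hb₃ _ hw hwle
      rw [norm_mul, norm_mul, norm_div, norm_mul, norm_pow, Complex.norm_ofNat, Complex.norm_real,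
        Real.norm_eq_abs]
      calc ‖c‖ / (2 * ‖z‖ ^ 2) * |a| * ‖f₁ z‖ ≤ ‖c‖ / ‖z‖ * |a| * C₃ := by
            gcongr
            nlinarith
        _ = _ := by ring
    have hle : (C₂ * ‖c‖ + |a| * ‖c‖ * C₃) / ‖z‖ ≤ K / ‖z‖ := by
      gcongr
      have : 0 ≤ C₁ * (‖c‖ / 2) ^ a + C₄ := by positivity
      linarith
    have hle1 : C₂ * ‖c‖ / ‖z‖ ≤ K / ‖z‖ := by
      refine le_trans ?_ hle
      gcongr
      have : 0 ≤ |a| * ‖c‖ * C₃ := by positivity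
      linarith
    constructor
    · have e : Complex.exp z * (Complex.exp (-z) * f z / N) - 1 = (f z - N) / N := by
        field_simp
        linear_combination f z * hexp
      rw [e, norm_div, div_right_comm]
      gcongr
      exact h1.trans hle1
    · have e : Complex.exp z * (Complex.exp (-z) * (-f z - c / (2 * z ^ 2) * a * f₁ z) / N) + 1 =
          -((f z - N) + c / (2 * z ^ 2) * a * f₁ z) / N := by
        have : Complex.exp z * (Complex.exp (-z) * (-f z - c / (2 * z ^ 2) * a * f₁ z) / N) =
          (-f z - c / (2 * z ^ 2) * a * f₁ z) / N := by
          linear_combination (-f z - c / (2 * z ^ 2) * a * f₁ z) / N * hexp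
        rw [this, div_add_one hN0]
        ring
      rw [e, norm_div, norm_neg, div_right_comm]
      gcongr
      refine (norm_add_le _ _).trans ((add_le_add h1 h2).trans ?_)
      rw [← add_div]
      exact hle

/-! ### Integrals and limits depending on a complex parameter -/

/-- A separated bound L(κ)h(t) with L continuous is a local dominating function, since L < L(κ₀) + 1
near κ₀. -/
theorem continuousOn_integral_of_le_mul {α : Type*} [MeasurableSpace α] {μ : Measure α} {D : Set ℂ}
    {F : ℂ → α → ℂ} {L : ℂ → ℝ} {h : α → ℝ} (hF : ∀ κ ∈ D, AEStronglyMeasurable (F κ) μ)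
    (hcont : ∀ᵐ t ∂μ, ContinuousOn (fun κ => F κ t) D)
    (hbound : ∀ᵐ t ∂μ, 0 ≤ h t ∧ ∀ κ ∈ D, ‖F κ t‖ ≤ L κ * h t) (hL : ContinuousOn L D)
    (hh : Integrable h μ) : ContinuousOn (fun κ => ∫ t, F κ t ∂μ) D := by
  intro κ₀ hκ₀
  have hev : ∀ᶠ κ in 𝓝[D] κ₀, L κ < L κ₀ + 1 := (hL κ₀ hκ₀).eventually_lt_const (by linarith)
  refine continuousWithinAt_of_dominated (bound := fun t => (L κ₀ + 1) * h t) ?_ ?_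
    (hh.const_mul _) ?_
  · filter_upwards [self_mem_nhdsWithin] with κ hκ using hF κ hκ
  · filter_upwards [hev, self_mem_nhdsWithin] with κ hκ hκD
    filter_upwards [hbound] with t ht
    exact (ht.2 κ hκD).trans (mul_le_mul_of_nonneg_right hκ.le ht.1)
  · filter_upwards [hcont] with t ht using ht κ₀ hκ₀

/-- No bound on the derivative is assumed: Cauchy's estimate on circles of radius r/4 about points
of the ball of radius r/2 derives one from the bound on F in the ball of radius r. -/
theorem differentiableOn_integral_of_le_mul {α : Type*} [MeasurableSpace α] {μ : Measure α}
    {U : Set ℂ} (hU : IsOpen U) {F : ℂ → α → ℂ} {L : ℂ → ℝ} {h : α → ℝ}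
    (hF : ∀ κ ∈ U, AEStronglyMeasurable (F κ) μ)
    (hdiff : ∀ᵐ t ∂μ, DifferentiableOn ℂ (fun κ => F κ t) U)
    (hbound : ∀ᵐ t ∂μ, 0 ≤ h t ∧ ∀ κ ∈ U, ‖F κ t‖ ≤ L κ * h t) (hL : ContinuousOn L U)
    (hh : Integrable h μ) : DifferentiableOn ℂ (fun κ => ∫ t, F κ t ∂μ) U := by
  intro κ₀ hκ₀
  have hev : ∀ᶠ κ in 𝓝 κ₀, κ ∈ U ∧ L κ < L κ₀ + 1 :=
    (hU.eventually_mem hκ₀).and (((hL κ₀ hκ₀).continuousAt (hU.mem_nhds hκ₀)).eventually_lt_const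
      (by linarith))
  obtain ⟨r, hr, hball⟩ := Metric.eventually_nhds_iff_ball.1 hev
  have hbd : ∀ᵐ t ∂μ, ∀ κ ∈ Metric.ball κ₀ r, ‖F κ t‖ ≤ (L κ₀ + 1) * h t := by
    filter_upwards [hbound] with t ht κ hκ
    exact (ht.2 κ (hball κ hκ).1).trans (mul_le_mul_of_nonneg_right (hball κ hκ).2.le ht.1)
  have hderiv : ∀ᵐ t ∂μ, ∀ κ ∈ Metric.ball κ₀ (r / 2),
      HasDerivAt (fun κ => F κ t) (deriv (fun κ => F κ t) κ) κ := by
    filter_upwards [hdiff] with t ht κ hκ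
    have hκU : κ ∈ U := (hball κ (Metric.ball_subset_ball (by linarith) hκ)).1
    exact ((ht κ hκU).differentiableAt (hU.mem_nhds hκU)).hasDerivAt
  have hmem : κ₀ ∈ Metric.ball κ₀ (r / 2) := Metric.mem_ball_self (by linarith)
  have key := hasDerivAt_integral_of_dominated_loc_of_deriv_le (μ := μ) (F := F)
    (F' := fun κ t => deriv (fun κ => F κ t) κ) (bound := fun t => (L κ₀ + 1) * h t / (r / 4))
    (Metric.ball_mem_nhds κ₀ (by linarith : 0 < r / 2)) ?_ ?_ ?_ ?_
    ((hh.const_mul _).div_const _) hderiv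
  · exact key.2.differentiableAt.differentiableWithinAt
  · filter_upwards [hU.mem_nhds hκ₀] with κ hκ using hF κ hκ
  · refine (hh.const_mul (L κ₀ + 1)).mono' (hF κ₀ hκ₀) ?_
    filter_upwards [hbd] with t ht using ht κ₀ (Metric.mem_ball_self hr)
  -- The derivative at κ₀ is measurable in t as the limit of the difference quotients along this
  -- sequence.
  · set v : ℕ → ℂ := fun n => κ₀ + ((r / 2 * (1 / ((n : ℝ) + 1)) : ℝ) : ℂ) with hv
    have hpos : ∀ n : ℕ, 0 < r / 2 * (1 / ((n : ℝ) + 1)) := fun n => by positivity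
    have hvU : ∀ n, v n ∈ U := by
      intro n
      refine (hball (v n) ?_).1
      rw [Metric.mem_ball, dist_eq_norm, hv]
      simp only [add_sub_cancel_left, Complex.norm_real]
      rw [Real.norm_of_nonneg (hpos n).le]
      have : 1 / ((n : ℝ) + 1) ≤ 1 := by
        rw [div_le_one (by positivity)]
        linarith [n.cast_nonneg (α := ℝ)]
      nlinarith
    have hvlim : Tendsto v atTop (𝓝[≠] κ₀) := by
      refine tendsto_nhdsWithin_iff.2 ⟨?_, Eventually.of_forall fun n => ?_⟩
      · have h1 : Tendsto (fun n : ℕ => r / 2 * (1 / ((n : ℝ) + 1))) atTop (𝓝 0) := by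
          simpa using tendsto_one_div_add_atTop_nhds_zero_nat.const_mul (r / 2)
        have h2 := ((Complex.continuous_ofReal.tendsto 0).comp h1).const_add κ₀
        rw [Complex.ofReal_zero, add_zero] at h2
        exact h2
      · simp only [hv, mem_compl_iff, mem_singleton_iff, add_eq_left, Complex.ofReal_eq_zero]
        exact (hpos n).ne'
    refine aestronglyMeasurable_of_tendsto_ae (u := atTop)
      (f := fun n t => slope (fun κ => F κ t) κ₀ (v n)) (fun n => ?_) ?_
    · simp only [slope, vsub_eq_sub, smul_eq_mul]
      exact ((hF _ (hvU n)).sub (hF _ hκ₀)).const_smul ((v n - κ₀)⁻¹)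
    · filter_upwards [hderiv] with t ht
      exact (hasDerivAt_iff_tendsto_slope.1 (ht κ₀ hmem)).comp hvlim
  · filter_upwards [hbd, hdiff] with t ht htd κ hκ
    refine Complex.norm_deriv_le_of_forall_mem_sphere_norm_le (by linarith) ?_ ?_
    · refine DifferentiableOn.diffContOnCl ?_
      refine htd.mono fun κ' hκ' => (hball κ' ?_).1
      rw [closure_ball _ (by linarith : r / 4 ≠ 0)] at hκ'
      rw [Metric.mem_ball] at hκ ⊢
      rw [Metric.mem_closedBall] at hκ'
      linarith [dist_triangle κ' κ κ₀]
    · intro κ' hκ'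
      refine ht κ' ?_
      rw [Metric.mem_ball] at hκ ⊢
      rw [Metric.mem_sphere] at hκ'
      linarith [dist_triangle κ' κ κ₀]

lemma tendstoLocallyUniformlyOn_of_le_mul {D : Set ℂ} {s : ℕ → ℂ → ℂ} {y : ℂ → ℂ} {W : ℂ → ℝ}
    {a : ℕ → ℝ} (hW : ContinuousOn W D) (ha : Tendsto a atTop (𝓝 0)) (ha0 : ∀ n, 0 ≤ a n)
    (h : ∀ n, ∀ κ ∈ D, ‖y κ - s n κ‖ ≤ a n * W κ) : TendstoLocallyUniformlyOn s y atTop D := by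
  rw [Metric.tendstoLocallyUniformlyOn_iff]
  intro ε hε κ₀ hκ₀
  refine ⟨{κ | κ ∈ D ∧ W κ < W κ₀ + 1}, ?_, ?_⟩
  · filter_upwards [self_mem_nhdsWithin,
      (hW κ₀ hκ₀).eventually_lt_const (by linarith : W κ₀ < W κ₀ + 1)] with κ h1 h2 using ⟨h1, h2⟩
  · have h1 : Tendsto (fun n => a n * (W κ₀ + 1)) atTop (𝓝 0) := by
      simpa using ha.mul_const (W κ₀ + 1)
    filter_upwards [h1.eventually_lt_const hε] with n hn κ hκ
    rw [dist_eq_norm]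
    exact ((h n κ hκ.1).trans (mul_le_mul_of_nonneg_left hκ.2.le (ha0 n))).trans_lt hn

/-! ### Volterra equations with a parameter -/

/-- A function of `κ ∈ D` and `x > 0` that is measurable in `x`, continuous in `κ ∈ D` and
holomorphic in `κ ∈ U`. -/
structure IsHolomorphicFamily (D U : Set ℂ) (χ : ℂ → ℝ → ℂ) : Prop where
  aestronglyMeasurable : ∀ κ ∈ D, AEStronglyMeasurable (χ κ) (volume.restrict (Ioi 0))
  continuousOn : ∀ x, 0 < x → ContinuousOn (fun κ => χ κ x) D
  differentiableOn : ∀ x, 0 < x → DifferentiableOn ℂ (fun κ => χ κ x) U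

namespace IsHolomorphicFamily

variable {D U : Set ℂ} {χ χ' : ℂ → ℝ → ℂ}

lemma add (h : IsHolomorphicFamily D U χ) (h' : IsHolomorphicFamily D U χ') :
    IsHolomorphicFamily D U (fun κ x => χ κ x + χ' κ x) where
  aestronglyMeasurable κ hκ := (h.aestronglyMeasurable κ hκ).add (h'.aestronglyMeasurable κ hκ)
  continuousOn x hx := (h.continuousOn x hx).add (h'.continuousOn x hx)
  differentiableOn x hx := (h.differentiableOn x hx).add (h'.differentiableOn x hx)

lemma sub (h : IsHolomorphicFamily D U χ) (h' : IsHolomorphicFamily D U χ') :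
    IsHolomorphicFamily D U (fun κ x => χ κ x - χ' κ x) where
  aestronglyMeasurable κ hκ := (h.aestronglyMeasurable κ hκ).sub (h'.aestronglyMeasurable κ hκ)
  continuousOn x hx := (h.continuousOn x hx).sub (h'.continuousOn x hx)
  differentiableOn x hx := (h.differentiableOn x hx).sub (h'.differentiableOn x hx)

lemma mul (h : IsHolomorphicFamily D U χ) (h' : IsHolomorphicFamily D U χ') :
    IsHolomorphicFamily D U (fun κ x => χ κ x * χ' κ x) where
  aestronglyMeasurable κ hκ := (h.aestronglyMeasurable κ hκ).mul (h'.aestronglyMeasurable κ hκ)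
  continuousOn x hx := (h.continuousOn x hx).mul (h'.continuousOn x hx)
  differentiableOn x hx := (h.differentiableOn x hx).mul (h'.differentiableOn x hx)

end IsHolomorphicFamily

/-- The integral `∫_b^x χ_q(κ, t) (Q(t) u(κ, t))_q dt`. -/
def kernelIntegral {m : ℕ} (b : ℝ) (Q : ℝ → Matrix (Fin m) (Fin m) ℂ) (χ : Fin m → ℂ → ℝ → ℂ)
    (u : ℂ → ℝ → Fin m → ℂ) (κ : ℂ) (x : ℝ) (q : Fin m) : ℂ :=
  ∫ t in b..x, χ q κ t * (Q t).mulVec (u κ t) q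

/-- The Volterra operator with kernel `(φ(κ, x) ψ(κ, t) - ψ(κ, x) φ(κ, t)) Q(t)`. -/
def volterraOp {m : ℕ} (b : ℝ) (Q : ℝ → Matrix (Fin m) (Fin m) ℂ) (φ ψ : Fin m → ℂ → ℝ → ℂ)
    (u : ℂ → ℝ → Fin m → ℂ) (κ : ℂ) (x : ℝ) (q : Fin m) : ℂ :=
  φ q κ x * kernelIntegral b Q ψ u κ x q - ψ q κ x * kernelIntegral b Q φ u κ x q

/-- Hypotheses under which `volterraOp` is a contraction on functions bounded by the weight `w`. -/
structure IsVolterraContraction {m : ℕ} (D U : Set ℂ) (w : ℂ → ℝ → ℝ) (b : ℝ)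
    (Q : ℝ → Matrix (Fin m) (Fin m) ℂ) (φ ψ : Fin m → ℂ → ℝ → ℂ) (P : ℝ → ℝ) (θ L : ℂ → ℝ) :
    Prop where
  isOpen : IsOpen U
  subset : U ⊆ D
  base_nonneg : 0 ≤ b
  weight_nonneg : ∀ κ ∈ D, ∀ x, 0 < x → 0 ≤ w κ x
  continuousOn_weight : ∀ x, 0 < x → ContinuousOn (fun κ => w κ x) D
  aestronglyMeasurable : ∀ i j, AEStronglyMeasurable (fun t => Q t i j) (volume.restrict (Ioi 0))
  left : ∀ q, IsHolomorphicFamily D U (φ q)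
  right : ∀ q, IsHolomorphicFamily D U (ψ q)
  left_cont : ∀ q, ∀ κ ∈ D, ContinuousOn (φ q κ) (Ioi 0)
  right_cont : ∀ q, ∀ κ ∈ D, ContinuousOn (ψ q κ) (Ioi 0)
  majorant_nonneg : ∀ t, 0 < t → 0 ≤ P t
  integrableOn_majorant : IntegrableOn P (Ioi 0)
  continuousOn_bound : ContinuousOn L D
  bound_left : ∀ κ ∈ D, ∀ t, 0 < t → ∀ q, ‖φ q κ t‖ * (∑ l, ‖Q t q l‖) * w κ t ≤ L κ * P t
  bound_right : ∀ κ ∈ D, ∀ t, 0 < t → ∀ q, ‖ψ q κ t‖ * (∑ l, ‖Q t q l‖) * w κ t ≤ L κ * P t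
  bound_kernel : ∀ κ ∈ D, ∀ x, 0 < x → ∀ t ∈ uIoc b x, ∀ q,
    ‖φ q κ x * ψ q κ t - ψ q κ x * φ q κ t‖ * (∑ l, ‖Q t q l‖) * w κ t ≤ w κ x * (θ κ * P t)
  rate_nonneg : ∀ κ ∈ D, 0 ≤ θ κ
  rate_le : ∀ κ ∈ D, θ κ * ∫ t in Ioi 0, P t ≤ 1 / 2

/-- A family of functions bounded by a multiple of the weight `w`. -/
structure IsAdmissible {m : ℕ} (D U : Set ℂ) (w : ℂ → ℝ → ℝ) (M : ℝ) (u : ℂ → ℝ → Fin m → ℂ) :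
    Prop where
  family : ∀ l, IsHolomorphicFamily D U (fun κ x => u κ x l)
  bound : ∀ κ ∈ D, ∀ x, 0 < x → ∀ l, ‖u κ x l‖ ≤ M * w κ x

lemma norm_mulVec_le {m : ℕ} (A : Matrix (Fin m) (Fin m) ℂ) {v : Fin m → ℂ} {M : ℝ}
    (hv : ∀ l, ‖v l‖ ≤ M) (q : Fin m) : ‖A.mulVec v q‖ ≤ (∑ l, ‖A q l‖) * M := by
  simp only [Matrix.mulVec, dotProduct]
  refine (norm_sum_le _ _).trans ?_
  rw [Finset.sum_mul]
  refine Finset.sum_le_sum fun l _ => ?_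
  rw [norm_mul]
  exact mul_le_mul_of_nonneg_left (hv l) (norm_nonneg _)

lemma uIoc_subset_Ioi {b x : ℝ} (hb : 0 ≤ b) (hx : 0 < x) : uIoc b x ⊆ Ioi 0 := fun _ ht =>
  lt_of_le_of_lt (le_min hb hx.le) ht.1

namespace IsVolterraContraction

variable {m : ℕ} {D U : Set ℂ} {w : ℂ → ℝ → ℝ} {b : ℝ} {Q : ℝ → Matrix (Fin m) (Fin m) ℂ}
  {φ ψ χ : Fin m → ℂ → ℝ → ℂ} {P : ℝ → ℝ} {θ L : ℂ → ℝ} {M M' : ℝ} {u u' : ℂ → ℝ → Fin m → ℂ}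

lemma swap_bounds (h : IsVolterraContraction D U w b Q φ ψ P θ L) (hχ : χ = φ ∨ χ = ψ) :
    (∀ q, IsHolomorphicFamily D U (χ q)) ∧ ∀ κ ∈ D, ∀ t, 0 < t → ∀ q,
      ‖χ q κ t‖ * (∑ l, ‖Q t q l‖) * w κ t ≤ L κ * P t := by
  rcases hχ with rfl | rfl
  · exact ⟨h.left, h.bound_left⟩
  · exact ⟨h.right, h.bound_right⟩

lemma norm_kernel_le (h : IsVolterraContraction D U w b Q φ ψ P θ L) (hχ : χ = φ ∨ χ = ψ)
    (hM : 0 ≤ M) {κ : ℂ} (hκ : κ ∈ D) (hu : ∀ x, 0 < x → ∀ l, ‖u κ x l‖ ≤ M * w κ x)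
    {t : ℝ} (ht : 0 < t) (q : Fin m) :
    ‖χ q κ t * (Q t).mulVec (u κ t) q‖ ≤ M * L κ * P t := by
  rw [norm_mul]
  calc _ ≤ ‖χ q κ t‖ * ((∑ l, ‖Q t q l‖) * (M * w κ t)) := by
        gcongr
        exact norm_mulVec_le _ (hu t ht) q
    _ = M * (‖χ q κ t‖ * (∑ l, ‖Q t q l‖) * w κ t) := by ring
    _ ≤ M * (L κ * P t) := mul_le_mul_of_nonneg_left ((h.swap_bounds hχ).2 κ hκ t ht q) hM
    _ = _ := by ring

lemma aestronglyMeasurable_kernel (h : IsVolterraContraction D U w b Q φ ψ P θ L)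
    (hχ : χ = φ ∨ χ = ψ) (hu : IsAdmissible D U w M u) {κ : ℂ} (hκ : κ ∈ D) (q : Fin m) :
    AEStronglyMeasurable (fun t => χ q κ t * (Q t).mulVec (u κ t) q) (volume.restrict (Ioi 0)) := by
  refine (((h.swap_bounds hχ).1 q).aestronglyMeasurable κ hκ).mul ?_
  simp only [Matrix.mulVec, dotProduct]
  refine Finset.aestronglyMeasurable_fun_sum _ fun l _ => ?_
  exact (h.aestronglyMeasurable q l).mul ((hu.family l).aestronglyMeasurable κ hκ)

lemma integrableOn_kernel (h : IsVolterraContraction D U w b Q φ ψ P θ L)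
    (hχ : χ = φ ∨ χ = ψ) (hM : 0 ≤ M) (hu : IsAdmissible D U w M u) {κ : ℂ} (hκ : κ ∈ D)
    (q : Fin m) : IntegrableOn (fun t => χ q κ t * (Q t).mulVec (u κ t) q) (Ioi 0) := by
  refine (h.integrableOn_majorant.const_mul (M * L κ)).mono'
    (h.aestronglyMeasurable_kernel hχ hu hκ q) ?_
  refine (ae_restrict_iff' measurableSet_Ioi).2 (Eventually.of_forall fun t ht => ?_)
  exact h.norm_kernel_le hχ hM hκ (hu.bound κ hκ) ht q

lemma intervalIntegrable_kernel (h : IsVolterraContraction D U w b Q φ ψ P θ L)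
    (hχ : χ = φ ∨ χ = ψ) (hM : 0 ≤ M) (hu : IsAdmissible D U w M u) {κ : ℂ} (hκ : κ ∈ D)
    (q : Fin m) {y x : ℝ} (hy : 0 ≤ y) (hx : 0 < x) :
    IntervalIntegrable (fun t => χ q κ t * (Q t).mulVec (u κ t) q) volume y x :=
  intervalIntegrable_iff.2 ((h.integrableOn_kernel hχ hM hu hκ q).mono_set (uIoc_subset_Ioi hy hx))

lemma continuousOn_kernelIntegral (h : IsVolterraContraction D U w b Q φ ψ P θ L)
    (hχ : χ = φ ∨ χ = ψ) (hM : 0 ≤ M) (hu : IsAdmissible D U w M u) {κ : ℂ} (hκ : κ ∈ D)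
    (q : Fin m) : ContinuousOn (fun x => kernelIntegral b Q χ u κ x q) (Ioi 0) := by
  -- Extension by zero makes the integrand integrable on the line, so its primitive is continuous
  -- everywhere, also with base point b = 0.
  set f : ℝ → ℂ := (Ioi (0 : ℝ)).indicator fun t => χ q κ t * (Q t).mulVec (u κ t) q
  have hf : Integrable f :=
    (integrable_indicator_iff measurableSet_Ioi).2 (h.integrableOn_kernel hχ hM hu hκ q)
  have hc : Continuous fun x => ∫ t in b..x, f t :=
    intervalIntegral.continuous_primitive (fun _ _ => hf.intervalIntegrable) b
  refine hc.continuousOn.congr fun x hx => ?_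
  refine intervalIntegral.integral_congr_ae (Eventually.of_forall fun t ht => ?_)
  exact (indicator_of_mem (uIoc_subset_Ioi h.base_nonneg hx ht)
    fun t => χ q κ t * (Q t).mulVec (u κ t) q).symm

lemma isHolomorphicFamily_kernelIntegral (h : IsVolterraContraction D U w b Q φ ψ P θ L)
    (hχ : χ = φ ∨ χ = ψ) (hM : 0 ≤ M) (hu : IsAdmissible D U w M u) (q : Fin m) :
    IsHolomorphicFamily D U fun κ x => kernelIntegral b Q χ u κ x q := by
  have hbound : ∀ x, 0 < x → ∀ᵐ t ∂volume.restrict (uIoc b x), 0 ≤ P t ∧ ∀ κ ∈ D,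
      ‖χ q κ t * (Q t).mulVec (u κ t) q‖ ≤ M * L κ * P t := by
    intro x hx
    refine (ae_restrict_iff' measurableSet_uIoc).2 (Eventually.of_forall fun t ht => ?_)
    have ht' := uIoc_subset_Ioi h.base_nonneg hx ht
    exact ⟨h.majorant_nonneg t ht', fun κ hκ => h.norm_kernel_le hχ hM hκ (hu.bound κ hκ) ht' q⟩
  have hmeas : ∀ x, 0 < x → ∀ κ ∈ D, AEStronglyMeasurable
      (fun t => χ q κ t * (Q t).mulVec (u κ t) q) (volume.restrict (uIoc b x)) := fun x hx κ hκ =>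
    (h.aestronglyMeasurable_kernel hχ hu hκ q).mono_measure
      (Measure.restrict_mono (uIoc_subset_Ioi h.base_nonneg hx) le_rfl)
  have hP : ∀ x, 0 < x → Integrable P (volume.restrict (uIoc b x)) := fun x hx =>
    h.integrableOn_majorant.mono_set (uIoc_subset_Ioi h.base_nonneg hx)
  constructor
  · intro κ hκ
    exact (h.continuousOn_kernelIntegral hχ hM hu hκ q).aestronglyMeasurable measurableSet_Ioi
  · intro x hx
    simp only [kernelIntegral, intervalIntegral.intervalIntegral_eq_integral_uIoc]
    refine ContinuousOn.const_smul ?_ _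
    refine continuousOn_integral_of_le_mul (hmeas x hx) ?_ (hbound x hx)
      (h.continuousOn_bound.const_smul M) (hP x hx)
    refine (ae_restrict_iff' measurableSet_uIoc).2 (Eventually.of_forall fun t ht => ?_)
    have ht' := uIoc_subset_Ioi h.base_nonneg hx ht
    refine (((h.swap_bounds hχ).1 q).continuousOn t ht').mul ?_
    simp only [Matrix.mulVec, dotProduct]
    exact continuousOn_finsetSum _ fun l _ => continuousOn_const.mul ((hu.family l).continuousOn t ht')
  · intro x hx
    simp only [kernelIntegral, intervalIntegral.intervalIntegral_eq_integral_uIoc]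
    refine DifferentiableOn.const_smul ?_ (if b ≤ x then (1 : ℝ) else -1)
    refine differentiableOn_integral_of_le_mul h.isOpen (fun κ hκ => hmeas x hx κ (h.subset hκ)) ?_
      ((hbound x hx).mono fun t ht => ⟨ht.1, fun κ hκ => ht.2 κ (h.subset hκ)⟩)
      ((h.continuousOn_bound.const_smul M).mono h.subset) (hP x hx)
    refine (ae_restrict_iff' measurableSet_uIoc).2 (Eventually.of_forall fun t ht => ?_)
    have ht' := uIoc_subset_Ioi h.base_nonneg hx ht
    refine (((h.swap_bounds hχ).1 q).differentiableOn t ht').mul ?_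
    simp only [Matrix.mulVec, dotProduct]
    exact DifferentiableOn.fun_sum fun l _ =>
      (differentiableOn_const _).mul ((hu.family l).differentiableOn t ht')

/-- The coefficients are left free so that the estimate covers both the operator, with α₁ = φ(x) and
α₂ = ψ(x), and its x-derivative, with φ'(x) and ψ'(x). -/
lemma norm_combination_le (h : IsVolterraContraction D U w b Q φ ψ P θ L) (hM : 0 ≤ M)
    (hu : IsAdmissible D U w M u) {κ : ℂ} (hκ : κ ∈ D) {x : ℝ} (hx : 0 < x) (q : Fin m)
    {α₁ α₂ : ℂ} {W : ℝ} (hW : 0 ≤ W) (hker : ∀ t ∈ uIoc b x,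
      ‖α₁ * ψ q κ t - α₂ * φ q κ t‖ * (∑ l, ‖Q t q l‖) * w κ t ≤ W * P t) :
    ‖α₁ * kernelIntegral b Q ψ u κ x q - α₂ * kernelIntegral b Q φ u κ x q‖ ≤
      M * (W * ∫ t in Ioi 0, P t) := by
  have heq : α₁ * kernelIntegral b Q ψ u κ x q - α₂ * kernelIntegral b Q φ u κ x q =
      ∫ t in b..x, (α₁ * ψ q κ t - α₂ * φ q κ t) * (Q t).mulVec (u κ t) q := by
    simp only [kernelIntegral]
    rw [← intervalIntegral.integral_const_mul, ← intervalIntegral.integral_const_mul,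
      ← intervalIntegral.integral_sub
        ((h.intervalIntegrable_kernel (Or.inr rfl) hM hu hκ q h.base_nonneg hx).const_mul _)
        ((h.intervalIntegrable_kernel (Or.inl rfl) hM hu hκ q h.base_nonneg hx).const_mul _)]
    refine intervalIntegral.integral_congr fun t _ => ?_
    ring
  rw [heq]
  refine intervalIntegral.norm_integral_le_integral_norm_uIoc.trans ?_
  have hsub := uIoc_subset_Ioi h.base_nonneg hx
  calc _ ≤ ∫ t in uIoc b x, (M * W) * P t := by
        refine integral_mono_of_nonneg (Eventually.of_forall fun _ => norm_nonneg _)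
          ((h.integrableOn_majorant.mono_set hsub).const_mul _) ?_
        refine (ae_restrict_iff' measurableSet_uIoc).2 (Eventually.of_forall fun t ht => ?_)
        dsimp only
        rw [norm_mul]
        have ht0 : 0 < t := hsub ht
        calc _ ≤ ‖α₁ * ψ q κ t - α₂ * φ q κ t‖ * ((∑ l, ‖Q t q l‖) * (M * w κ t)) := by
              gcongr
              exact norm_mulVec_le _ (hu.bound κ hκ t ht0) q
          _ = M * (‖α₁ * ψ q κ t - α₂ * φ q κ t‖ * (∑ l, ‖Q t q l‖) * w κ t) := by ring
          _ ≤ M * (W * P t) := mul_le_mul_of_nonneg_left (hker t ht) hM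
          _ = _ := by ring
    _ ≤ ∫ t in Ioi 0, (M * W) * P t := by
        refine setIntegral_mono_set (h.integrableOn_majorant.const_mul _) ?_ hsub.eventuallyLE
        refine (ae_restrict_iff' measurableSet_Ioi).2 (Eventually.of_forall fun t ht => ?_)
        exact mul_nonneg (mul_nonneg hM hW) (h.majorant_nonneg t ht)
    _ = _ := by
        rw [integral_const_mul]
        ring

lemma norm_volterraOp_le (h : IsVolterraContraction D U w b Q φ ψ P θ L) (hM : 0 ≤ M)
    (hu : IsAdmissible D U w M u) {κ : ℂ} (hκ : κ ∈ D) {x : ℝ} (hx : 0 < x) (q : Fin m) :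
    ‖volterraOp b Q φ ψ u κ x q‖ ≤ M * (θ κ * ∫ t in Ioi 0, P t) * w κ x := by
  refine (h.norm_combination_le hM hu hκ hx q (W := w κ x * θ κ)
    (mul_nonneg (h.weight_nonneg κ hκ x hx) (h.rate_nonneg κ hκ)) fun t ht => ?_).trans
    (le_of_eq (by ring))
  exact (h.bound_kernel κ hκ x hx t ht q).trans (le_of_eq (by ring))

lemma isAdmissible_volterraOp (h : IsVolterraContraction D U w b Q φ ψ P θ L) (hM : 0 ≤ M)
    (hu : IsAdmissible D U w M u) : IsAdmissible D U w (M / 2) (volterraOp b Q φ ψ u) where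
  family q := ((h.left q).mul (h.isHolomorphicFamily_kernelIntegral (Or.inr rfl) hM hu q)).sub
    ((h.right q).mul (h.isHolomorphicFamily_kernelIntegral (Or.inl rfl) hM hu q))
  bound κ hκ x hx q := by
    refine (h.norm_volterraOp_le hM hu hκ hx q).trans ?_
    have h1 := h.rate_le κ hκ
    have h2 := h.weight_nonneg κ hκ x hx
    refine mul_le_mul_of_nonneg_right ?_ h2
    nlinarith

lemma volterraOp_sub (h : IsVolterraContraction D U w b Q φ ψ P θ L) (hM : 0 ≤ M)
    (hM' : 0 ≤ M') (hu : IsAdmissible D U w M u) (hu' : IsAdmissible D U w M' u')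
    {κ : ℂ} (hκ : κ ∈ D) {x : ℝ} (hx : 0 < x) (q : Fin m) :
    volterraOp b Q φ ψ (fun κ x l => u κ x l - u' κ x l) κ x q =
      volterraOp b Q φ ψ u κ x q - volterraOp b Q φ ψ u' κ x q := by
  have key : ∀ χ, (χ = φ ∨ χ = ψ) → kernelIntegral b Q χ (fun κ x l => u κ x l - u' κ x l) κ x q =
      kernelIntegral b Q χ u κ x q - kernelIntegral b Q χ u' κ x q := by
    intro χ hχ
    simp only [kernelIntegral]
    rw [← intervalIntegral.integral_sub
      (h.intervalIntegrable_kernel hχ hM hu hκ q h.base_nonneg hx)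
      (h.intervalIntegrable_kernel hχ hM' hu' hκ q h.base_nonneg hx)]
    refine intervalIntegral.integral_congr fun t _ => ?_
    have : (fun l => u κ t l - u' κ t l) = u κ t - u' κ t := rfl
    simp only [this, Matrix.mulVec_sub, Pi.sub_apply]
    ring
  simp only [volterraOp, key φ (Or.inl rfl), key ψ (Or.inr rfl)]
  ring

end IsVolterraContraction

lemma IsAdmissible.sub {m : ℕ} {D U : Set ℂ} {w : ℂ → ℝ → ℝ} {M M' : ℝ}
    {u u' : ℂ → ℝ → Fin m → ℂ} (hu : IsAdmissible D U w M u) (hu' : IsAdmissible D U w M' u') :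
    IsAdmissible D U w (M + M') (fun κ x l => u κ x l - u' κ x l) where
  family l := (hu.family l).sub (hu'.family l)
  bound κ hκ x hx l := by
    refine (norm_sub_le _ _).trans ?_
    linarith [hu.bound κ hκ x hx l, hu'.bound κ hκ x hx l]

/-- The successive approximations for `y = y₀ + K y`. -/
def volterraIterate {m : ℕ} (b : ℝ) (Q : ℝ → Matrix (Fin m) (Fin m) ℂ) (φ ψ : Fin m → ℂ → ℝ → ℂ)
    (y₀ : ℂ → ℝ → Fin m → ℂ) : ℕ → ℂ → ℝ → Fin m → ℂ
  | 0 => y₀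
  | n + 1 => fun κ x q => y₀ κ x q + volterraOp b Q φ ψ (volterraIterate b Q φ ψ y₀ n) κ x q

/-- Each application of the operator halves the weighted bound, so the successive approximations
converge geometrically, locally uniformly in κ for fixed x. Continuity and holomorphy pass to the
limit. -/
theorem IsVolterraContraction.exists_solution {m : ℕ} {D U : Set ℂ} {w : ℂ → ℝ → ℝ} {b : ℝ}
    {Q : ℝ → Matrix (Fin m) (Fin m) ℂ} {φ ψ : Fin m → ℂ → ℝ → ℂ} {P : ℝ → ℝ} {θ L : ℂ → ℝ} {M : ℝ}
    (h : IsVolterraContraction D U w b Q φ ψ P θ L) (hM : 0 ≤ M) {y₀ : ℂ → ℝ → Fin m → ℂ}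
    (hy₀ : IsAdmissible D U w M y₀) :
    ∃ y : ℂ → ℝ → Fin m → ℂ, IsAdmissible D U w (2 * M) y ∧ ∀ κ ∈ D, ∀ x, 0 < x → ∀ q,
      y κ x q = y₀ κ x q + volterraOp b Q φ ψ y κ x q := by
  set s := volterraIterate b Q φ ψ y₀ with hs
  have hs_succ : ∀ n κ x q, s (n + 1) κ x q = y₀ κ x q + volterraOp b Q φ ψ (s n) κ x q :=
    fun _ _ _ _ => rfl
  -- The constant 2M reproduces itself: M + (2M)/2 = 2M.
  have hadm : ∀ n, IsAdmissible D U w (2 * M) (s n) := by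
    intro n
    induction n with
    | zero =>
      refine ⟨hy₀.family, fun κ hκ x hx l => (hy₀.bound κ hκ x hx l).trans ?_⟩
      nlinarith [h.weight_nonneg κ hκ x hx]
    | succ n ih =>
      have h1 := h.isAdmissible_volterraOp (by linarith) ih
      refine ⟨fun l => (hy₀.family l).add (h1.family l), fun κ hκ x hx l => ?_⟩
      rw [hs_succ]
      refine (norm_add_le _ _).trans ?_
      linarith [hy₀.bound κ hκ x hx l, h1.bound κ hκ x hx l]
  have hdiff : ∀ n, IsAdmissible D U w (M / 2 * (1 / 2) ^ n)
      (fun κ x l => s (n + 1) κ x l - s n κ x l) := by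
    intro n
    induction n with
    | zero =>
      have h1 := h.isAdmissible_volterraOp hM hy₀
      refine ⟨fun l => ((hadm 1).sub (hadm 0)).family l, fun κ hκ x hx l => ?_⟩
      have h2 : s (0 + 1) κ x l - s 0 κ x l = volterraOp b Q φ ψ y₀ κ x l := by
        rw [hs_succ]
        simp [hs, volterraIterate]
      rw [h2]
      simpa using h1.bound κ hκ x hx l
    | succ n ih =>
      have h1 := h.isAdmissible_volterraOp (by positivity) ih
      refine ⟨fun l => ((hadm (n + 1 + 1)).sub (hadm (n + 1))).family l, fun κ hκ x hx l => ?_⟩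
      have h2 : s (n + 1 + 1) κ x l - s (n + 1) κ x l =
          volterraOp b Q φ ψ (fun κ x l => s (n + 1) κ x l - s n κ x l) κ x l := by
        rw [hs_succ (n + 1), hs_succ n,
          h.volterraOp_sub (by linarith) (by linarith) (hadm (n + 1)) (hadm n) hκ hx]
        ring
      rw [h2]
      refine (h1.bound κ hκ x hx l).trans (le_of_eq ?_)
      ring
  have hdist : ∀ κ ∈ D, ∀ x, 0 < x → ∀ l n,
      dist (s n κ x l) (s (n + 1) κ x l) ≤ (M / 2 * w κ x) * (1 / 2) ^ n := by
    intro κ hκ x hx l n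
    rw [dist_comm, dist_eq_norm]
    refine ((hdiff n).bound κ hκ x hx l).trans (le_of_eq ?_)
    ring
  have hlim : ∀ κ ∈ D, ∀ x, 0 < x → ∀ l, ∃ a, Tendsto (fun n => s n κ x l) atTop (𝓝 a) :=
    fun κ hκ x hx l => cauchySeq_tendsto_of_complete
      (cauchySeq_of_le_geometric (1 / 2) (M / 2 * w κ x) (by norm_num) (hdist κ hκ x hx l))
  -- Outside D × (0, ∞) any value will do, and a total function can be chosen.
  have hlim' : ∀ κ x l, ∃ a, κ ∈ D → 0 < x → Tendsto (fun n => s n κ x l) atTop (𝓝 a) := by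
    intro κ x l
    by_cases hκ : κ ∈ D ∧ 0 < x
    · obtain ⟨a, ha⟩ := hlim κ hκ.1 x hκ.2 l
      exact ⟨a, fun _ _ => ha⟩
    · exact ⟨0, fun h1 h2 => absurd ⟨h1, h2⟩ hκ⟩
  choose y hy using hlim'
  have herr : ∀ n, ∀ κ ∈ D, ∀ x, 0 < x → ∀ l, ‖y κ x l - s n κ x l‖ ≤ M * (1 / 2) ^ n * w κ x := by
    intro n κ hκ x hx l
    have := dist_le_of_le_geometric_of_tendsto (1 / 2) (M / 2 * w κ x) (by norm_num)
      (hdist κ hκ x hx l) (hy κ x l hκ hx) n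
    rw [dist_comm, dist_eq_norm] at this
    refine this.trans (le_of_eq ?_)
    ring
  have hgeom : Tendsto (fun n : ℕ => M * (1 / 2 : ℝ) ^ n) atTop (𝓝 0) := by
    simpa using (tendsto_pow_atTop_nhds_zero_of_lt_one (by norm_num : (0 : ℝ) ≤ 1 / 2)
      (by norm_num)).const_mul M
  have hunif : ∀ x, 0 < x → ∀ l,
      TendstoLocallyUniformlyOn (fun n κ => s n κ x l) (fun κ => y κ x l) atTop D := fun x hx l =>
    tendstoLocallyUniformlyOn_of_le_mul (h.continuousOn_weight x hx) hgeom
      (fun n => by positivity) fun n κ hκ => herr n κ hκ x hx l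
  have hyadm : IsAdmissible D U w (2 * M) y := by
    refine ⟨fun l => ⟨fun κ hκ => ?_, fun x hx => ?_, fun x hx => ?_⟩, fun κ hκ x hx l => ?_⟩
    · refine aestronglyMeasurable_of_tendsto_ae atTop
        (fun n => ((hadm n).family l).aestronglyMeasurable κ hκ) ?_
      exact (ae_restrict_iff' measurableSet_Ioi).2 (Eventually.of_forall fun x hx => hy κ x l hκ hx)
    · exact (hunif x hx l).continuousOn
        (Frequently.of_forall fun n => ((hadm n).family l).continuousOn x hx)
    · exact ((hunif x hx l).mono h.subset).differentiableOn
        (Eventually.of_forall fun n => ((hadm n).family l).differentiableOn x hx) h.isOpen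
    · exact le_of_tendsto (hy κ x l hκ hx).norm
        (Eventually.of_forall fun n => (hadm n).bound κ hκ x hx l)
  refine ⟨y, hyadm, fun κ hκ x hx q => ?_⟩
  have herr_adm : ∀ n, IsAdmissible D U w (M * (1 / 2) ^ n) (fun κ x l => y κ x l - s n κ x l) :=
    fun n => ⟨fun l => (hyadm.sub (hadm n)).family l, herr n⟩
  have h1 : Tendsto (fun n => y₀ κ x q + volterraOp b Q φ ψ (s n) κ x q) atTop (𝓝 (y κ x q)) :=
    (tendsto_add_atTop_iff_nat 1).2 (hy κ x q hκ hx)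
  have h2 : Tendsto (fun n => volterraOp b Q φ ψ (s n) κ x q) atTop
      (𝓝 (volterraOp b Q φ ψ y κ x q)) := by
    rw [tendsto_iff_norm_sub_tendsto_zero]
    have h3 : Tendsto (fun n : ℕ => M * (1 / 2 : ℝ) ^ n / 2 * w κ x) atTop (𝓝 0) := by
      simpa using (hgeom.div_const 2).mul_const (w κ x)
    refine squeeze_zero (fun _ => norm_nonneg _) (fun n => ?_) h3
    rw [norm_sub_rev, ← h.volterraOp_sub (by linarith) (by linarith) hyadm (hadm n) hκ hx]
    exact (h.isAdmissible_volterraOp (by positivity) (herr_adm n)).bound κ hκ x hx q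
  exact tendsto_nhds_unique h1 (h2.const_add _)

/-! ### Absolute continuity -/

/-- Domination of increments reduces absolute continuity of vector functions to their components,
and that of primitives to primitives of the norm. -/
lemma AbsolutelyContinuousOnInterval.of_dist_le_sum {X Y ι : Type*} [PseudoMetricSpace X]
    [PseudoMetricSpace Y] [Fintype ι] {f : ℝ → X} {g : ι → ℝ → Y} {a b : ℝ}
    (hg : ∀ i, AbsolutelyContinuousOnInterval (g i) a b)
    (h : ∀ x ∈ uIcc a b, ∀ y ∈ uIcc a b, dist (f x) (f y) ≤ ∑ i, dist (g i x) (g i y)) :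
    AbsolutelyContinuousOnInterval f a b := by
  have hsum := tendsto_finsetSum Finset.univ fun i _ => hg i
  rw [Finset.sum_const_zero] at hsum
  refine squeeze_zero' (Eventually.of_forall fun E => Finset.sum_nonneg fun i _ => dist_nonneg)
    ?_ hsum
  have hmem : AbsolutelyContinuousOnInterval.disjWithin a b ∈
      AbsolutelyContinuousOnInterval.totalLengthFilter ⊓
        𝓟 (AbsolutelyContinuousOnInterval.disjWithin a b) := mem_inf_of_right (mem_principal_self _)
  filter_upwards [hmem] with E hE
  rw [Finset.sum_comm]
  exact Finset.sum_le_sum fun i hi => h _ (hE.1 i hi).1 _ (hE.1 i hi).2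

lemma AbsolutelyContinuousOnInterval.of_eqOn {X : Type*} [PseudoMetricSpace X] {f g : ℝ → X}
    {a b : ℝ} (hg : AbsolutelyContinuousOnInterval g a b) (h : EqOn f g (uIcc a b)) :
    AbsolutelyContinuousOnInterval f a b :=
  .of_dist_le_sum (ι := Unit) (fun _ => hg) fun x hx y hy => by simp [h hx, h hy]

lemma AbsolutelyContinuousOnInterval.of_components {m : ℕ} {f : ℝ → Fin m → ℂ} {a b : ℝ}
    (hf : ∀ i, AbsolutelyContinuousOnInterval (fun x => f x i) a b) :
    AbsolutelyContinuousOnInterval f a b :=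
  .of_dist_le_sum hf fun x _ y _ => by
    refine (dist_pi_le_iff (Finset.sum_nonneg fun _ _ => dist_nonneg)).2 fun i => ?_
    exact Finset.single_le_sum (f := fun i => dist (f x i) (f y i)) (fun _ _ => dist_nonneg)
      (Finset.mem_univ i)

lemma intervalIntegrable_of_integrableOn_Ioi {E : Type*} [NormedAddCommGroup E] {h : ℝ → E}
    (hh : IntegrableOn h (Ioi 0)) {x y : ℝ} (hx : 0 ≤ x) (hy : 0 ≤ y) :
    IntervalIntegrable h volume x y :=
  intervalIntegrable_iff.2 (hh.mono_set fun _ ht => lt_of_le_of_lt (le_min hx hy) ht.1)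

lemma absolutelyContinuousOnInterval_primitive {E : Type*} [NormedAddCommGroup E] [NormedSpace ℝ E]
    {h : ℝ → E} {a b β : ℝ} (hab : IntervalIntegrable h volume a b)
    (hβ : IntervalIntegrable h volume β a) :
    AbsolutelyContinuousOnInterval (fun x => ∫ t in β..x, h t) a b := by
  have h1 := hab.norm.absolutelyContinuousOnInterval_intervalIntegral (c := a) left_mem_uIcc
  refine .of_dist_le_sum (ι := Unit) (fun _ => h1) fun x hx y hy => ?_
  have hax : ∀ x ∈ uIcc a b, IntervalIntegrable h volume a x := fun x hx =>
    hab.mono_set (uIcc_subset_uIcc_left hx)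
  simp only [Finset.univ_unique, Finset.sum_const, Finset.card_singleton, one_smul]
  rw [dist_eq_norm, dist_eq_norm,
    intervalIntegral.integral_interval_sub_left (hβ.trans (hax x hx)) (hβ.trans (hax y hy)),
    intervalIntegral.integral_interval_sub_left (hax x hx).norm (hax y hy).norm, Real.norm_eq_abs]
  exact intervalIntegral.norm_integral_le_abs_integral_norm

lemma ae_hasDerivAt_primitive {E : Type*} [NormedAddCommGroup E] [NormedSpace ℝ E]
    [CompleteSpace E] {h : ℝ → E} {b : ℝ}
    (hh : IntegrableOn h (Ioi 0)) (hb : 0 ≤ b) :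
    ∀ᵐ x : ℝ, 0 < x → HasDerivAt (fun x => ∫ t in b..x, h t) (h x) x := by
  have hf : Integrable ((Ioi (0 : ℝ)).indicator h) :=
    (integrable_indicator_iff measurableSet_Ioi).2 hh
  filter_upwards [LocallyIntegrable.ae_hasDerivAt_integral hf.locallyIntegrable] with x hx hx0
  have h1 := hx b
  rw [indicator_of_mem (show x ∈ Ioi 0 from hx0)] at h1
  refine h1.congr_of_eventuallyEq ?_
  filter_upwards [Ioi_mem_nhds hx0] with y hy
  refine intervalIntegral.integral_congr_ae (Eventually.of_forall fun t ht => ?_)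
  exact (indicator_of_mem (uIoc_subset_Ioi hb hy ht) h).symm

/-! ### Variation of constants -/

/-- For t between x and y the factor g(y) - g(t) is O(|y - x|), and the integral of ‖h‖ from x to y
tends to 0, so the whole is o(|y - x|). No continuity of h at x is needed. -/
lemma hasDerivAt_integral_sub_mul {g g' h : ℝ → ℂ} {x : ℝ} (hx : 0 < x)
    (hg : ∀ y, 0 < y → HasDerivAt g (g' y) y) (hg' : ContinuousAt g' x)
    (hh : IntegrableOn h (Ioi 0)) :
    HasDerivAt (fun y => ∫ t in x..y, (g y - g t) * h t) 0 x := by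
  have hev : ∀ᶠ y in 𝓝 x, ‖g' y‖ < ‖g' x‖ + 1 ∧ 0 < y :=
    (hg'.norm.eventually_lt_const (by linarith)).and (Ioi_mem_nhds hx)
  obtain ⟨r, hr, hball⟩ := Metric.eventually_nhds_iff_ball.1 hev
  set C := ‖g' x‖ + 1
  have hC : 0 ≤ C := by positivity
  have hlip : ∀ y ∈ Metric.ball x r, ∀ t ∈ Metric.ball x r, ‖g y - g t‖ ≤ C * ‖y - t‖ := by
    intro y hy t ht
    exact (convex_ball x r).norm_image_sub_le_of_norm_hasDerivWithin_le
      (fun z hz => (hg z (hball z hz).2).hasDerivWithinAt) (fun z hz => (hball z hz).1.le) ht hy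
  have hcont : Tendsto (fun y => C * |∫ t in x..y, ‖h t‖|) (𝓝 x) (𝓝 0) := by
    set f : ℝ → ℝ := (Ioi (0 : ℝ)).indicator fun t => ‖h t‖
    have hf : Integrable f := (integrable_indicator_iff measurableSet_Ioi).2 hh.norm
    have hc : Continuous fun y => C * |∫ t in x..y, f t| :=
      continuous_const.mul
        (intervalIntegral.continuous_primitive (fun _ _ => hf.intervalIntegrable) x).abs
    have h1 : Tendsto (fun y => C * |∫ t in x..y, f t|) (𝓝 x) (𝓝 0) := by
      simpa using hc.tendsto x
    refine h1.congr' ?_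
    filter_upwards [Ioi_mem_nhds hx] with y hy
    congr 2
    refine intervalIntegral.integral_congr_ae (Eventually.of_forall fun t ht => ?_)
    exact indicator_of_mem (uIoc_subset_Ioi hx.le hy ht) fun t => ‖h t‖
  have hbd : ∀ y ∈ Metric.ball x r,
      ‖∫ t in x..y, (g y - g t) * h t‖ ≤ (C * |∫ t in x..y, ‖h t‖|) * ‖y - x‖ := by
    intro y hy
    have hy0 := (hball y hy).2
    have hInt : IntervalIntegrable (fun t => C * ‖y - x‖ * ‖h t‖) volume x y :=
      (intervalIntegrable_of_integrableOn_Ioi hh.norm hx.le hy0.le).const_mul _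
    have h1 : ‖∫ t in x..y, (g y - g t) * h t‖ ≤ |∫ t in x..y, C * ‖y - x‖ * ‖h t‖| := by
      refine intervalIntegral.norm_integral_le_abs_of_norm_le ?_ hInt
      refine (ae_restrict_iff' measurableSet_uIoc).2 (Eventually.of_forall fun t ht => ?_)
      have htx : |y - t| ≤ |y - x| ∧ |t - x| ≤ |y - x| := by
        rcases le_total x y with hxy | hxy
        · rw [uIoc_of_le hxy] at ht
          rw [abs_of_nonneg (by linarith [ht.2]), abs_of_nonneg (by linarith),
            abs_of_nonneg (by linarith [ht.1])]
          exact ⟨by linarith [ht.1], by linarith [ht.2]⟩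
        · rw [uIoc_of_ge hxy] at ht
          rw [abs_of_nonpos (by linarith [ht.1]), abs_of_nonpos (by linarith),
            abs_of_nonpos (by linarith [ht.2])]
          exact ⟨by linarith [ht.2], by linarith [ht.1]⟩
      have htb : t ∈ Metric.ball x r := by
        rw [Metric.mem_ball, Real.dist_eq] at hy ⊢
        linarith [htx.2]
      rw [norm_mul]
      refine mul_le_mul_of_nonneg_right ((hlip y hy t htb).trans ?_) (norm_nonneg _)
      exact mul_le_mul_of_nonneg_left htx.1 hC
    refine h1.trans (le_of_eq ?_)
    rw [intervalIntegral.integral_const_mul, abs_mul, abs_of_nonneg (by positivity)]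
    ring
  rw [hasDerivAt_iff_isLittleO]
  simp only [intervalIntegral.integral_same, smul_zero, sub_zero]
  rw [Asymptotics.isLittleO_iff]
  intro c hc
  filter_upwards [Metric.ball_mem_nhds x hr, hcont.eventually_lt_const hc] with y hy hyc
  exact (hbd y hy).trans (mul_le_mul_of_nonneg_right hyc.le (norm_nonneg _))

/-- The product rule would only give this almost everywhere. Splitting the integrals at x leaves two
remainders of the form treated by `hasDerivAt_integral_sub_mul`, in which the terms ∫ φψf cancel;
hence the formula holds at every x. -/
theorem hasDerivAt_variation {φ ψ φ' ψ' f : ℝ → ℂ} {b x : ℝ} (hb : 0 ≤ b) (hx : 0 < x)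
    (hφ : ∀ y, 0 < y → HasDerivAt φ (φ' y) y) (hψ : ∀ y, 0 < y → HasDerivAt ψ (ψ' y) y)
    (hφ' : ContinuousAt φ' x) (hψ' : ContinuousAt ψ' x)
    (iφ : IntegrableOn (fun t => φ t * f t) (Ioi 0))
    (iψ : IntegrableOn (fun t => ψ t * f t) (Ioi 0)) :
    HasDerivAt (fun y => φ y * (∫ t in b..y, ψ t * f t) - ψ y * ∫ t in b..y, φ t * f t)
      (φ' x * (∫ t in b..x, ψ t * f t) - ψ' x * ∫ t in b..x, φ t * f t) x := by
  have h1 := hasDerivAt_integral_sub_mul hx hφ hφ' iψ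
  have h2 := hasDerivAt_integral_sub_mul hx hψ hψ' iφ
  have h3 := (((hφ x hx).mul_const (∫ t in b..x, ψ t * f t)).sub
    ((hψ x hx).mul_const (∫ t in b..x, φ t * f t))).add (h1.sub h2)
  rw [sub_zero, add_zero] at h3
  refine h3.congr_of_eventuallyEq ?_
  filter_upwards [Ioi_mem_nhds hx] with y hy
  have hy0 : (0 : ℝ) < y := hy
  have split : ∀ {h : ℝ → ℂ}, IntegrableOn h (Ioi 0) →
      ∫ t in b..y, h t = (∫ t in b..x, h t) + ∫ t in x..y, h t := fun hh =>
    (intervalIntegral.integral_add_adjacent_intervals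
      (intervalIntegrable_of_integrableOn_Ioi hh hb hx.le)
      (intervalIntegrable_of_integrableOn_Ioi hh hx.le hy0.le)).symm
  have jφ := intervalIntegrable_of_integrableOn_Ioi iφ hx.le hy0.le
  have jψ := intervalIntegrable_of_integrableOn_Ioi iψ hx.le hy0.le
  have cφ : ContinuousOn φ (uIcc x y) := fun t ht =>
    (hφ t (lt_of_lt_of_le (lt_min hx hy0) ht.1)).continuousAt.continuousWithinAt
  have cψ : ContinuousOn ψ (uIcc x y) := fun t ht =>
    (hψ t (lt_of_lt_of_le (lt_min hx hy0) ht.1)).continuousAt.continuousWithinAt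
  have e : ∫ t in x..y, (φ y - φ t) * (ψ t * f t) = φ y * (∫ t in x..y, ψ t * f t) -
      ∫ t in x..y, φ t * (ψ t * f t) := by
    rw [← intervalIntegral.integral_const_mul,
      ← intervalIntegral.integral_sub (jψ.const_mul _) (jψ.continuousOn_mul cφ)]
    exact intervalIntegral.integral_congr fun t _ => by ring
  have e' : ∫ t in x..y, (ψ y - ψ t) * (φ t * f t) = ψ y * (∫ t in x..y, φ t * f t) -
      ∫ t in x..y, φ t * (ψ t * f t) := by
    rw [← intervalIntegral.integral_const_mul,
      ← intervalIntegral.integral_sub (jφ.const_mul _) (jψ.continuousOn_mul cφ)]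
    exact intervalIntegral.integral_congr fun t _ => by ring
  simp only [Pi.add_apply, Pi.sub_apply]
  rw [e, e', split iφ, split iψ]
  ring

/-- At the second differentiation the primitives do contribute, and they produce the Wronskian times
f. -/
theorem ae_hasDerivAt_variation_deriv {φ ψ φ' ψ' φ'' ψ'' f : ℝ → ℂ} {b : ℝ} (hb : 0 ≤ b)
    (hφ' : ∀ y, 0 < y → HasDerivAt φ' (φ'' y) y) (hψ' : ∀ y, 0 < y → HasDerivAt ψ' (ψ'' y) y)
    (iφ : IntegrableOn (fun t => φ t * f t) (Ioi 0))
    (iψ : IntegrableOn (fun t => ψ t * f t) (Ioi 0)) :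
    ∀ᵐ x : ℝ, 0 < x → HasDerivAt
      (fun y => φ' y * (∫ t in b..y, ψ t * f t) - ψ' y * ∫ t in b..y, φ t * f t)
      (φ'' x * (∫ t in b..x, ψ t * f t) - ψ'' x * (∫ t in b..x, φ t * f t) +
        (φ' x * ψ x - ψ' x * φ x) * f x) x := by
  filter_upwards [ae_hasDerivAt_primitive iφ hb, ae_hasDerivAt_primitive iψ hb] with x h1 h2 hx
  refine (((hφ' x hx).mul (h2 hx)).sub ((hψ' x hx).mul (h1 hx))).congr_deriv ?_
  ring

lemma absolutelyContinuousOnInterval_of_hasDerivAt {f f' : ℝ → ℂ} {a b : ℝ}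
    (hf : ∀ x ∈ uIcc a b, HasDerivAt f (f' x) x) (hf' : ContinuousOn f' (uIcc a b)) :
    AbsolutelyContinuousOnInterval f a b := by
  obtain ⟨C, hC⟩ := isCompact_uIcc.exists_bound_of_continuousOn hf'
  have h : LipschitzOnWith (Real.toNNReal C) f (uIcc a b) := by
    refine (convex_uIcc a b).lipschitzOnWith_of_nnnorm_hasDerivWithin_le
      (fun x hx => (hf x hx).hasDerivWithinAt) fun x hx => ?_
    rw [← NNReal.coe_le_coe, coe_nnnorm]
    exact (hC x hx).trans (Real.le_coe_toNNReal C)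
  exact h.absolutelyContinuousOnInterval

theorem absolutelyContinuousOnInterval_variation_deriv {φ ψ φ' ψ' φ'' ψ'' f : ℝ → ℂ} {b : ℝ}
    (hb : 0 ≤ b) (hφ' : ∀ y, 0 < y → HasDerivAt φ' (φ'' y) y)
    (hψ' : ∀ y, 0 < y → HasDerivAt ψ' (ψ'' y) y)
    (hφ'' : ContinuousOn φ'' (Ioi 0)) (hψ'' : ContinuousOn ψ'' (Ioi 0))
    (iφ : IntegrableOn (fun t => φ t * f t) (Ioi 0))
    (iψ : IntegrableOn (fun t => ψ t * f t) (Ioi 0)) {c d : ℝ} (hc : 0 < c) (hd : 0 < d) :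
    AbsolutelyContinuousOnInterval
      (fun y => φ' y * (∫ t in b..y, ψ t * f t) - ψ' y * ∫ t in b..y, φ t * f t) c d := by
  have hsub : uIcc c d ⊆ Ioi 0 := fun t ht => lt_of_lt_of_le (lt_min hc hd) ht.1
  have h1 := absolutelyContinuousOnInterval_of_hasDerivAt (fun x hx => hφ' x (hsub hx))
    (hφ''.mono hsub)
  have h2 := absolutelyContinuousOnInterval_of_hasDerivAt (fun x hx => hψ' x (hsub hx))
    (hψ''.mono hsub)
  have h3 := absolutelyContinuousOnInterval_primitive
    (intervalIntegrable_of_integrableOn_Ioi iφ hc.le hd.le)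
    (intervalIntegrable_of_integrableOn_Ioi iφ hb hc.le)
  have h4 := absolutelyContinuousOnInterval_primitive
    (intervalIntegrable_of_integrableOn_Ioi iψ hc.le hd.le)
    (intervalIntegrable_of_integrableOn_Ioi iψ hb hc.le)
  exact (h1.smul h4).sub (h2.smul h3)

/-! ### Solutions -/

theorem isSolution_of_components {m : ℕ} {T : ℝ} {ν : Fin m → ℝ}
    {Q : ℝ → Matrix (Fin m) (Fin m) ℂ} {lam : ℂ} {y y' : ℝ → Fin m → ℂ}
    (hy : ∀ x, 0 < x → ∀ q, HasDerivAt (fun x => y x q) (y' x q) x)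
    (hac : ∀ a b, 0 < a → 0 < b → ∀ q, AbsolutelyContinuousOnInterval (fun x => y' x q) a b)
    (heq : ∀ q, ∀ᵐ x : ℝ, x ∈ Ioo 0 T → HasDerivAt (fun x => y' x q)
      ((((ν q ^ 2 - 1 / 4 : ℝ) : ℂ) / x ^ 2 - lam) * y x q + (Q x).mulVec (y x) q) x) :
    IsSolution T ν Q lam y := by
  have hy1 : ∀ x, 0 < x → HasDerivAt y (y' x) x := fun x hx => hasDerivAt_pi.2 (hy x hx)
  have hderiv : EqOn (deriv y) y' (Ioi 0) := fun x hx => (hy1 x hx).deriv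
  refine ⟨fun x hx => (hy1 x hx.1).differentiableAt, fun a b ha hab hb => ?_, ?_⟩
  · refine .of_eqOn (.of_components fun q => hac a b ha (ha.trans_le hab) q) ?_
    refine hderiv.mono fun t ht => lt_of_lt_of_le (lt_min ha (ha.trans_le hab)) ht.1
  · filter_upwards [ae_all_iff.2 heq] with x hx hxT
    have h1 : deriv (deriv y) x = fun q =>
        (((ν q ^ 2 - 1 / 4 : ℝ) : ℂ) / x ^ 2 - lam) * y x q + (Q x).mulVec (y x) q := by
      refine HasDerivAt.deriv (HasDerivAt.congr_of_eventuallyEq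
        (hasDerivAt_pi.2 fun q => hx q hxT) ?_)
      filter_upwards [Ioi_mem_nhds hxT.1] with t ht using hderiv ht
    rw [h1]
    ext q
    simp only [Pi.add_apply, Pi.neg_apply, Matrix.add_mulVec, Matrix.smul_mulVec, omegaMatrix,
      Pi.smul_apply, smul_eq_mul, Matrix.mulVec_diagonal]
    ring

/-! ### Uniqueness for the initial value problem -/

/-- A Carathéodory solution of `z'' = A z` on `(0, T)`, together with its derivative. -/
structure IsCaratheodorySolution {m : ℕ} (T : ℝ) (A : ℝ → Matrix (Fin m) (Fin m) ℂ)
    (z z' : ℝ → Fin m → ℂ) : Prop where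
  hasDerivAt : ∀ x ∈ Ioo 0 T, HasDerivAt z (z' x) x
  absolutelyContinuous : ∀ a b, 0 < a → a ≤ b → b < T → AbsolutelyContinuousOnInterval z' a b
  equation : ∀ᵐ x : ℝ, x ∈ Ioo 0 T → HasDerivAt z' ((A x).mulVec (z x)) x

namespace IsCaratheodorySolution

variable {m : ℕ} {T : ℝ} {A : ℝ → Matrix (Fin m) (Fin m) ℂ} {z z' w w' : ℝ → Fin m → ℂ}

lemma zero : IsCaratheodorySolution T A (fun _ => 0) (fun _ => 0) where
  hasDerivAt x _ := hasDerivAt_const x 0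
  absolutelyContinuous a b _ _ _ := by
    refine LipschitzOnWith.absolutelyContinuousOnInterval (K := 0) ?_
    exact LipschitzWith.const' 0 |>.lipschitzOnWith
  equation := Eventually.of_forall fun x _ => by
    rw [Matrix.mulVec_zero]
    exact hasDerivAt_const x 0

lemma add (hz : IsCaratheodorySolution T A z z') (hw : IsCaratheodorySolution T A w w') :
    IsCaratheodorySolution T A (fun x => z x + w x) (fun x => z' x + w' x) where
  hasDerivAt x hx := (hz.hasDerivAt x hx).add (hw.hasDerivAt x hx)
  absolutelyContinuous a b ha hab hb :=
    (hz.absolutelyContinuous a b ha hab hb).add (hw.absolutelyContinuous a b ha hab hb)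
  equation := by
    filter_upwards [hz.equation, hw.equation] with x h1 h2 hx
    rw [Matrix.mulVec_add]
    exact (h1 hx).add (h2 hx)

lemma const_smul (c : ℂ) (hz : IsCaratheodorySolution T A z z') :
    IsCaratheodorySolution T A (fun x => c • z x) (fun x => c • z' x) where
  hasDerivAt x hx := (hz.hasDerivAt x hx).const_smul c
  absolutelyContinuous a b ha hab hb := (hz.absolutelyContinuous a b ha hab hb).const_smul c
  equation := by
    filter_upwards [hz.equation] with x h1 hx
    rw [Matrix.mulVec_smul]
    exact (h1 hx).const_smul c

lemma sum {ι : Type*} (s : Finset ι) (c : ι → ℂ) {y y' : ι → ℝ → Fin m → ℂ}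
    (hy : ∀ i, IsCaratheodorySolution T A (y i) (y' i)) :
    IsCaratheodorySolution T A (fun x => ∑ i ∈ s, c i • y i x) (fun x => ∑ i ∈ s, c i • y' i x) := by
  classical
  induction s using Finset.induction_on with
  | empty => simpa using zero
  | insert i s hi ih =>
    simp only [Finset.sum_insert hi]
    exact ((hy i).const_smul (c i)).add ih

lemma continuousOn_deriv (hz : IsCaratheodorySolution T A z z') {a b : ℝ} (ha : a ∈ Ioo 0 T)
    (hb : b ∈ Ioo 0 T) : ContinuousOn z' (uIcc a b) := by
  have := hz.absolutelyContinuous (min a b) (max a b) (lt_min ha.1 hb.1) min_le_max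
    (max_lt ha.2 hb.2)
  have h := this.continuousOn
  rwa [uIcc_of_le min_le_max] at h

lemma continuousAt_deriv (hz : IsCaratheodorySolution T A z z') {x : ℝ} (hx : x ∈ Ioo 0 T) :
    ContinuousAt z' x := by
  have h := hz.continuousOn_deriv (a := x / 2) (b := (x + T) / 2)
    ⟨by linarith [hx.1], by linarith [hx.1, hx.2]⟩ ⟨by linarith [hx.1, hx.2], by linarith [hx.2]⟩
  refine h.continuousAt ?_
  rw [uIcc_of_le (by linarith [hx.1, hx.2])]
  exact Icc_mem_nhds (by linarith [hx.1]) (by linarith [hx.2])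

lemma uIcc_subset_Ioo {a b : ℝ} (ha : a ∈ Ioo 0 T) (hb : b ∈ Ioo 0 T) : uIcc a b ⊆ Ioo 0 T :=
  fun _ ht => ⟨lt_of_lt_of_le (lt_min ha.1 hb.1) ht.1, lt_of_le_of_lt ht.2 (max_lt ha.2 hb.2)⟩

lemma intervalIntegrable_mulVec (hz : IsCaratheodorySolution T A z z')
    (hA : ∀ i j a b, a ∈ Ioo 0 T → b ∈ Ioo 0 T →
      IntervalIntegrable (fun t => A t i j) volume a b)
    {a b : ℝ} (ha : a ∈ Ioo 0 T)
    (hb : b ∈ Ioo 0 T) : IntervalIntegrable (fun t => (A t).mulVec (z t)) volume a b := by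
  rw [intervalIntegrable_iff]
  refine Integrable.of_eval fun i => ?_
  simp only [Matrix.mulVec, dotProduct]
  refine integrable_finsetSum _ fun j _ => ?_
  refine intervalIntegrable_iff.1 ((hA i j a b ha hb).mul_continuousOn ?_)
  intro t ht
  exact ((continuous_apply j).continuousAt.comp
    (hz.hasDerivAt t (uIcc_subset_Ioo ha hb ht)).continuousAt).continuousWithinAt

/-- The difference of z' and the primitive of Az is absolutely continuous with derivative zero
almost everywhere, hence constant. -/
lemma deriv_sub_eq_integral (hz : IsCaratheodorySolution T A z z')
    (hA : ∀ i j a b, a ∈ Ioo 0 T → b ∈ Ioo 0 T →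
      IntervalIntegrable (fun t => A t i j) volume a b)
    {a b : ℝ} (ha : a ∈ Ioo 0 T)
    (hb : b ∈ Ioo 0 T) : z' b - z' a = ∫ t in a..b, (A t).mulVec (z t) := by
  have hInt := hz.intervalIntegrable_mulVec hA ha hb
  have hac : AbsolutelyContinuousOnInterval z' a b :=
    (hz.absolutelyContinuous (min a b) (max a b) (lt_min ha.1 hb.1) min_le_max
      (max_lt ha.2 hb.2)).mono (by rw [uIcc_of_le min_le_max]; exact subset_rfl)
  have h1 := hac.sub (absolutelyContinuousOnInterval_primitive hInt IntervalIntegrable.refl)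
  obtain ⟨C, hC⟩ := h1.const_of_ae_hasDerivAt_zero (by
    filter_upwards [hz.equation, hInt.ae_hasDerivAt_integral] with x hx1 hx2 hx
    have := (hx1 (uIcc_subset_Ioo ha hb hx)).sub (hx2 hx a left_mem_uIcc)
    rwa [sub_self] at this)
  have h2 := hC a left_mem_uIcc
  have h3 := hC b right_mem_uIcc
  simp only [Pi.sub_apply, intervalIntegral.integral_same, sub_zero] at h2 h3
  rw [h2, ← h3]
  abel

lemma sub_eq_integral (hz : IsCaratheodorySolution T A z z') {a b : ℝ} (ha : a ∈ Ioo 0 T)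
    (hb : b ∈ Ioo 0 T) : z b - z a = ∫ t in a..b, z' t :=
  (intervalIntegral.integral_eq_sub_of_hasDerivAt
    (fun t ht => hz.hasDerivAt t (uIcc_subset_Ioo ha hb ht))
    (hz.continuousOn_deriv ha hb).intervalIntegrable).symm

/-- On a ball where the integral of k from x₁ is less than 1/2 in modulus, the maximum S of ‖z‖ and
‖z'‖ satisfies S ≤ S/2 by the integrated equations. -/
lemma eventually_eq_zero (hz : IsCaratheodorySolution T A z z')
    (hA : ∀ i j a b, a ∈ Ioo 0 T → b ∈ Ioo 0 T →
      IntervalIntegrable (fun t => A t i j) volume a b)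
    {x₁ : ℝ} (hx₁ : x₁ ∈ Ioo 0 T)
    (h0 : z x₁ = 0) (h0' : z' x₁ = 0) : ∀ᶠ x in 𝓝 x₁, z x = 0 ∧ z' x = 0 := by
  -- The summand 1 lets the same k bound the first-order part, the derivative z' of z.
  set k : ℝ → ℝ := fun t => 1 + ∑ i, ∑ j, ‖A t i j‖
  have hk : ∀ a b, a ∈ Ioo 0 T → b ∈ Ioo 0 T → IntervalIntegrable k volume a b := by
    intro a b ha hb
    refine intervalIntegrable_const.add ?_
    rw [intervalIntegrable_iff]
    exact integrable_finsetSum _ fun i _ => integrable_finsetSum _ fun j _ =>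
      intervalIntegrable_iff.1 (hA i j a b ha hb).norm
  have hk1 : ∀ t, 1 ≤ k t := fun t => by
    simp only [k]
    linarith [Finset.sum_nonneg fun i (_ : i ∈ Finset.univ) =>
      Finset.sum_nonneg fun j (_ : j ∈ Finset.univ) => norm_nonneg (A t i j)]
  have hAk : ∀ t v, ‖(A t).mulVec v‖ ≤ k t * ‖v‖ := by
    intro t v
    refine (pi_norm_le_iff_of_nonneg (mul_nonneg (by linarith [hk1 t]) (norm_nonneg v))).2
      fun i => ?_
    refine (norm_mulVec_le (A t) (norm_le_pi_norm v) i).trans ?_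
    refine mul_le_mul_of_nonneg_right ?_ (norm_nonneg v)
    have := Finset.single_le_sum (f := fun i => ∑ j, ‖A t i j‖)
      (fun i _ => Finset.sum_nonneg fun j _ => norm_nonneg (A t i j)) (Finset.mem_univ i)
    simp only [k]
    linarith
  have hlim : Tendsto (fun x => |∫ t in x₁..x, k t|) (𝓝 x₁) (𝓝 0) := by
    have ha : x₁ / 2 ∈ Ioo 0 T := ⟨by linarith [hx₁.1], by linarith [hx₁.1, hx₁.2]⟩
    have hb : (x₁ + T) / 2 ∈ Ioo 0 T := ⟨by linarith [hx₁.1, hx₁.2], by linarith [hx₁.2]⟩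
    have h1 : ContinuousOn (fun x => ∫ t in x₁..x, k t) (uIcc (x₁ / 2) ((x₁ + T) / 2)) :=
      intervalIntegral.continuousOn_primitive_interval' (hk _ _ ha hb)
        (by rw [uIcc_of_le (by linarith [hx₁.1, hx₁.2])]
            exact ⟨by linarith [hx₁.1], by linarith [hx₁.2]⟩)
    have h2 : ContinuousAt (fun x => |∫ t in x₁..x, k t|) x₁ := by
      refine ContinuousAt.abs (h1.continuousAt ?_)
      rw [uIcc_of_le (by linarith [hx₁.1, hx₁.2])]
      exact Icc_mem_nhds (by linarith [hx₁.1]) (by linarith [hx₁.2])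
    simpa using h2.tendsto
  have hev : ∀ᶠ x in 𝓝 x₁, |∫ t in x₁..x, k t| < 1 / 2 ∧ x ∈ Ioo 0 T :=
    (hlim.eventually_lt_const (by norm_num)).and (Ioo_mem_nhds hx₁.1 hx₁.2)
  obtain ⟨r, hr, hball⟩ := Metric.nhds_basis_closedBall.eventually_iff.1 hev
  have hcont : ContinuousOn (fun x => max ‖z x‖ ‖z' x‖) (Metric.closedBall x₁ r) := by
    intro x hx
    have hx' := (hball hx).2
    exact ContinuousAt.continuousWithinAt ((hz.hasDerivAt x hx').continuousAt.norm.max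
      (hz.continuousAt_deriv hx').norm)
  obtain ⟨x', hx'mem, hmax⟩ := (isCompact_closedBall x₁ r).exists_isMaxOn
    ⟨x₁, Metric.mem_closedBall_self hr.le⟩ hcont
  set S := max ‖z x'‖ ‖z' x'‖ with hS
  have hS0 : 0 ≤ S := le_max_of_le_left (norm_nonneg _)
  have hx'T := (hball hx'mem).2
  have hle : ∀ t ∈ uIoc x₁ x', ‖z t‖ ≤ S ∧ ‖z' t‖ ≤ S := by
    intro t ht
    have htm : t ∈ Metric.closedBall x₁ r := by
      have := (convex_closedBall x₁ r).ordConnected.uIcc_subset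
        (Metric.mem_closedBall_self hr.le) hx'mem
      exact this (uIoc_subset_uIcc ht)
    exact ⟨(le_max_left _ _).trans (hmax htm), (le_max_right _ _).trans (hmax htm)⟩
  have hInt : IntervalIntegrable (fun t => k t * S) volume x₁ x' := (hk _ _ hx₁ hx'T).mul_const S
  have habs : |∫ t in x₁..x', k t * S| ≤ 1 / 2 * S := by
    rw [intervalIntegral.integral_mul_const, abs_mul, abs_of_nonneg hS0]
    exact mul_le_mul_of_nonneg_right (hball hx'mem).1.le hS0
  have e1 : ‖z x'‖ ≤ 1 / 2 * S := by
    have h1 := hz.sub_eq_integral hx₁ hx'T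
    rw [h0, sub_zero] at h1
    rw [h1]
    refine (intervalIntegral.norm_integral_le_abs_of_norm_le ?_ hInt).trans habs
    refine (ae_restrict_iff' measurableSet_uIoc).2 (Eventually.of_forall fun t ht => ?_)
    nlinarith [(hle t ht).2, hk1 t]
  have e2 : ‖z' x'‖ ≤ 1 / 2 * S := by
    have h1 := hz.deriv_sub_eq_integral hA hx₁ hx'T
    rw [h0', sub_zero] at h1
    rw [h1]
    refine (intervalIntegral.norm_integral_le_abs_of_norm_le ?_ hInt).trans habs
    refine (ae_restrict_iff' measurableSet_uIoc).2 (Eventually.of_forall fun t ht => ?_)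
    exact (hAk t (z t)).trans
      (mul_le_mul_of_nonneg_left (hle t ht).1 (by linarith [hk1 t]))
  have hS2 : S ≤ 1 / 2 * S := max_le e1 e2
  have hSz : S = 0 := by linarith
  filter_upwards [Metric.closedBall_mem_nhds x₁ hr] with x hx
  have h1 : max ‖z x‖ ‖z' x‖ ≤ 0 := hSz ▸ hmax hx
  exact ⟨norm_le_zero_iff.1 ((le_max_left _ _).trans h1),
    norm_le_zero_iff.1 ((le_max_right _ _).trans h1)⟩

/-- The points near which z and z' vanish form an open set that is closed in the connected interval,
by continuity and local uniqueness. -/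
theorem eq_zero (hz : IsCaratheodorySolution T A z z')
    (hA : ∀ i j a b, a ∈ Ioo 0 T → b ∈ Ioo 0 T →
      IntervalIntegrable (fun t => A t i j) volume a b)
    {x₀ : ℝ} (hx₀ : x₀ ∈ Ioo 0 T)
    (h0 : z x₀ = 0) (h0' : z' x₀ = 0) : ∀ x ∈ Ioo 0 T, z x = 0 := by
  set u : Set ℝ := {x | ∀ᶠ y in 𝓝 x, z y = 0 ∧ z' y = 0}
  have hu : IsOpen u := isOpen_setOfPred_eventually_nhds
  have hsub : Ioo 0 T ⊆ u := by
    refine isPreconnected_Ioo.subset_of_closure_inter_subset hu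
      ⟨x₀, hx₀, hz.eventually_eq_zero hA hx₀ h0 h0'⟩ ?_
    rintro x ⟨hx, hxT⟩
    have hfreq : ∃ᶠ y in 𝓝 x, z y = 0 ∧ z' y = 0 :=
      (mem_closure_iff_frequently.1 hx).mono fun y hy => hy.self_of_nhds
    have e1 : z x = 0 := by
      by_contra hne
      exact hfreq (((hz.hasDerivAt x hxT).continuousAt.eventually_ne hne).mono
        fun y hy h => hy h.1)
    have e2 : z' x = 0 := by
      by_contra hne
      exact hfreq (((hz.continuousAt_deriv hxT).eventually_ne hne).mono fun y hy h => hy h.2)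
    exact hz.eventually_eq_zero hA hxT e1 e2
  exact fun x hx => (hsub hx).self_of_nhds.1

end IsCaratheodorySolution

/-- The coefficient matrix of the equation written as `y'' = A y`. -/
def coefficientMatrix {m : ℕ} (ν : Fin m → ℝ) (Q : ℝ → Matrix (Fin m) (Fin m) ℂ) (lam : ℂ) (x : ℝ) :
    Matrix (Fin m) (Fin m) ℂ :=
  ((x : ℂ) ^ 2)⁻¹ • omegaMatrix ν + Q x - lam • 1

lemma IsSolution.isCaratheodorySolution {m : ℕ} {T : ℝ} {ν : Fin m → ℝ}
    {Q : ℝ → Matrix (Fin m) (Fin m) ℂ} {lam : ℂ} {y : ℝ → Fin m → ℂ}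
    (hy : IsSolution T ν Q lam y) :
    IsCaratheodorySolution T (coefficientMatrix ν Q lam) y (deriv y) where
  hasDerivAt x hx := (hy.differentiableAt x hx).hasDerivAt
  absolutelyContinuous := hy.absolutelyContinuous
  equation := by
    -- The pointwise equation speaks of `deriv (deriv y)`, which is 0 by default where `deriv y` is
    -- not differentiable. Absolute continuity on an exhaustion by compact intervals shows that such
    -- points form a null set. The shift by 2 keeps the endpoints in order.
    have h1 : ∀ n : ℕ, ∀ᵐ x : ℝ, x ∈ Icc (T / (n + 2)) (T - T / (n + 2)) → x ∈ Ioo 0 T →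
        DifferentiableAt ℝ (deriv y) x := by
      intro n
      by_cases hT : 0 < T
      · have hpos : 0 < T / (n + 2) := by positivity
        have hle : T / (n + 2) ≤ T / 2 := by gcongr; linarith [n.cast_nonneg (α := ℝ)]
        have hac := hy.absolutelyContinuous (T / (n + 2)) (T - T / (n + 2)) hpos (by linarith)
          (by linarith)
        filter_upwards [hac.boundedVariationOn.ae_differentiableAt_of_mem_uIcc] with x hx hx1 _
        exact hx (by rwa [uIcc_of_le (by linarith)])
      · exact Eventually.of_forall fun x _ hx => absurd (hx.1.trans hx.2) hT
    filter_upwards [hy.equation, ae_all_iff.2 h1] with x hx hx1 hxT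
    have hT : 0 < T := hxT.1.trans hxT.2
    have hlim : Tendsto (fun n : ℕ => T / ((n : ℝ) + 2)) atTop (𝓝 0) := by
      refine tendsto_const_nhds.div_atTop ?_
      exact tendsto_atTop_add_const_right _ _ tendsto_natCast_atTop_atTop
    obtain ⟨n, hn1, hn2⟩ := ((hlim.eventually_lt_const hxT.1).and
      (hlim.eventually_lt_const (sub_pos.2 hxT.2))).exists
    have hd := (hx1 n ⟨hn1.le, by linarith⟩ hxT).hasDerivAt
    refine hd.congr_deriv ?_
    have h2 := hx hxT
    rw [coefficientMatrix, Matrix.sub_mulVec, Matrix.smul_mulVec, Matrix.one_mulVec, ← h2]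
    abel

/-- The map from coefficients to initial data at x₀ acts between spaces of dimension 2m, so
injectivity gives surjectivity. A solution and the combination with the same initial data agree by
uniqueness. -/
theorem isFundamentalSystem_of_injective {m : ℕ} {T : ℝ} {ν : Fin m → ℝ}
    {Q : ℝ → Matrix (Fin m) (Fin m) ℂ} {lam : ℂ} {y : Fin m ⊕ Fin m → ℝ → Fin m → ℂ}
    (hQ : ∀ i j a b, a ∈ Ioo 0 T → b ∈ Ioo 0 T → IntervalIntegrable (fun t => Q t i j) volume a b)
    (hy : ∀ s, IsSolution T ν Q lam (y s)) {x₀ : ℝ} (hx₀ : x₀ ∈ Ioo 0 T)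
    (hinj : ∀ c : Fin m ⊕ Fin m → ℂ, ∑ s, c s • y s x₀ = 0 → ∑ s, c s • deriv (y s) x₀ = 0 → c = 0) :
    IsFundamentalSystem T ν Q lam y := by
  have hA : ∀ i j a b, a ∈ Ioo 0 T → b ∈ Ioo 0 T →
      IntervalIntegrable (fun t => coefficientMatrix ν Q lam t i j) volume a b := by
    intro i j a b ha hb
    have hsub := IsCaratheodorySolution.uIcc_subset_Ioo ha hb
    have h1 : IntervalIntegrable (fun t : ℝ => ((t : ℂ) ^ 2)⁻¹ * omegaMatrix ν i j) volume a b := by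
      refine ContinuousOn.intervalIntegrable (ContinuousOn.mul (ContinuousOn.inv₀ (by fun_prop) ?_)
        continuousOn_const)
      intro t ht
      have : t ≠ 0 := (hsub ht).1.ne'
      simpa using this
    exact (h1.add (hQ i j a b ha hb)).sub intervalIntegrable_const
  have hy' := fun s => (hy s).isCaratheodorySolution
  refine ⟨hy, ?_, fun z hz => ?_⟩
  · rw [Fintype.linearIndependent_iff]
    intro c hc s
    have hzero : ∀ x ∈ Ioo 0 T, ∑ s, c s • y s x = 0 := by
      intro x hx
      have := congrFun hc ⟨x, hx⟩
      simpa using this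
    have hd := (IsCaratheodorySolution.sum Finset.univ c hy').hasDerivAt x₀ hx₀
    have hd0 : HasDerivAt (fun x => ∑ s, c s • y s x) 0 x₀ := by
      refine (hasDerivAt_const x₀ 0).congr_of_eventuallyEq ?_
      filter_upwards [Ioo_mem_nhds hx₀.1 hx₀.2] with x hx using hzero x hx
    exact congrFun (hinj c (hzero x₀ hx₀) (hd.unique hd0)) s
  · set f : (Fin m ⊕ Fin m → ℂ) →ₗ[ℂ] (Fin m → ℂ) × (Fin m → ℂ) :=
      (Fintype.linearCombination ℂ fun s => y s x₀).prod
        (Fintype.linearCombination ℂ fun s => deriv (y s) x₀) with hf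
    have hfapp : ∀ c, f c = (∑ s, c s • y s x₀, ∑ s, c s • deriv (y s) x₀) := fun c => by
      simp [hf, Fintype.linearCombination_apply]
    have hfinj : Function.Injective f := by
      refine (injective_iff_map_eq_zero f).2 fun c hc => ?_
      rw [hfapp, Prod.mk_eq_zero] at hc
      exact hinj c hc.1 hc.2
    have hfsurj : Function.Surjective f :=
      (LinearMap.injective_iff_surjective_of_finrank_eq_finrank (by simp)).1 hfinj
    obtain ⟨c, hc⟩ := hfsurj (z x₀, deriv z x₀)
    rw [hfapp, Prod.mk.injEq] at hc
    refine ⟨c, fun x hx => ?_⟩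
    have hdiff := hz.isCaratheodorySolution.add
      ((IsCaratheodorySolution.sum Finset.univ c hy').const_smul (-1))
    have := hdiff.eq_zero hA hx₀ (by simp [hc.1]) (by simp [hc.2]) x hx
    simp only [neg_smul, one_smul] at this
    exact eq_of_sub_eq_zero (by rw [sub_eq_add_neg]; exact this)

/-! ### A pair of solutions of the Bessel equation in a quadrant -/

/-- The closed quadrant `Re z ≥ 0`, `s Im z ≥ 0` without the origin. -/
def quadrant (s : ℝ) : Set ℂ := {z | 0 ≤ z.re ∧ 0 ≤ s * z.im ∧ z ≠ 0}

lemma mul_mem_quadrant {s : ℝ} {z : ℂ} (hz : z ∈ quadrant s) {r : ℝ} (hr : 0 < r) :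
    z * r ∈ quadrant s := by
  obtain ⟨h1, h2, h3⟩ := hz
  refine ⟨?_, ?_, mul_ne_zero h3 (by exact_mod_cast hr.ne')⟩
  · simp only [Complex.mul_re, Complex.ofReal_re, Complex.ofReal_im, mul_zero, sub_zero]
    positivity
  · simp only [Complex.mul_im, Complex.ofReal_re, Complex.ofReal_im, mul_zero, zero_add]
    nlinarith

lemma one_div_mem_wideCone {s : ℝ} {z : ℂ} (hz : z ∈ quadrant s) : 1 / z ∈ wideCone := by
  have h0 : 0 < ‖z‖ := norm_pos_iff.2 hz.2.2
  have h1 : 0 ≤ (1 / z).re := by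
    rw [one_div, Complex.inv_re]
    exact div_nonneg hz.1 (Complex.normSq_nonneg z)
  have h2 : 0 < ‖1 / z‖ := by simpa using hz.2.2
  simp only [wideCone, mem_ofPred_eq]
  linarith

/-- For z in the quadrant, -1/z ranges over a quadrant bordering on the negative real axis. The
factor 1 - si turns it by π/4 so that it becomes symmetric about the imaginary axis, at angle at
least π/4 from the cut. -/
lemma div_neg_mem_wideCone {s : ℝ} (hs : s = 1 ∨ s = -1) {z : ℂ} (hz : z ∈ quadrant s) :
    (1 - s * Complex.I) / -z ∈ wideCone := by
  have hss : s ^ 2 = 1 := by rcases hs with rfl | rfl <;> norm_num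
  have h0 : 0 < ‖z‖ := norm_pos_iff.2 hz.2.2
  have hre : ((1 - s * Complex.I) / -z).re = -(z.re - s * z.im) / ‖z‖ ^ 2 := by
    rw [Complex.div_re, Complex.normSq_neg, Complex.normSq_eq_norm_sq]
    simp
    ring
  have hc : ‖(1 - s * Complex.I : ℂ)‖ = √2 := by
    rw [Complex.norm_def, Complex.normSq_apply]
    congr 1
    simp
    nlinarith
  -- Equivalently 1/√2 < 4/5: the extreme directions, where Re w = -‖w‖/√2, still lie in the cone.
  have h2 : (5 / 4 : ℝ) < √2 := by
    rw [Real.lt_sqrt (by norm_num)]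
    norm_num
  simp only [wideCone, mem_ofPred_eq]
  rw [hre, norm_div, norm_neg, hc]
  have h3 : z.re ≤ ‖z‖ := Complex.re_le_norm z
  rw [show -(4 / 5) * (√2 / ‖z‖) = -(4 / 5 * √2 * ‖z‖) / ‖z‖ ^ 2 by field_simp]
  gcongr
  nlinarith [hz.2.1]

/-- Solutions `e(z) ~ e^{-z}` and `g(z) ~ e^z` of `u'' = (1 + (ν² - 1/4) / z²) u`. -/
structure IsBesselPair (ν s C : ℝ) (e e' g g' : ℂ → ℂ) : Prop where
  hasDerivAt_e : ∀ z ∈ quadrant s, HasDerivAt e (e' z) z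
  hasDerivAt_e' : ∀ z ∈ quadrant s,
    HasDerivAt e' ((1 + ((ν ^ 2 - 1 / 4 : ℝ) : ℂ) / z ^ 2) * e z) z
  hasDerivAt_g : ∀ z ∈ quadrant s, HasDerivAt g (g' z) z
  hasDerivAt_g' : ∀ z ∈ quadrant s,
    HasDerivAt g' ((1 + ((ν ^ 2 - 1 / 4 : ℝ) : ℂ) / z ^ 2) * g z) z
  norm_e : ∀ z ∈ quadrant s, ‖e z‖ ≤ C * Real.exp (-z.re) * min 1 ‖z‖ ^ (1 / 2 - ν)
  norm_g : ∀ z ∈ quadrant s, ‖g z‖ ≤ C * Real.exp z.re * min 1 ‖z‖ ^ (1 / 2 - ν)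
  asymp_e : ∀ z ∈ quadrant s, 1 ≤ ‖z‖ → ‖Complex.exp z * e z - 1‖ ≤ C / ‖z‖
  asymp_e' : ∀ z ∈ quadrant s, 1 ≤ ‖z‖ → ‖Complex.exp z * e' z + 1‖ ≤ C / ‖z‖
  asymp_g : ∀ z ∈ quadrant s, 1 ≤ ‖z‖ → ‖Complex.exp (-z) * g z - 1‖ ≤ C / ‖z‖
  asymp_g' : ∀ z ∈ quadrant s, 1 ≤ ‖z‖ → ‖Complex.exp (-z) * g' z - 1‖ ≤ C / ‖z‖

lemma IsBesselPair.mono {ν s C C' : ℝ} {e e' g g' : ℂ → ℂ} (h : IsBesselPair ν s C e e' g g')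
    (hC : C ≤ C') : IsBesselPair ν s C' e e' g g' where
  hasDerivAt_e := h.hasDerivAt_e
  hasDerivAt_e' := h.hasDerivAt_e'
  hasDerivAt_g := h.hasDerivAt_g
  hasDerivAt_g' := h.hasDerivAt_g'
  norm_e z hz := (h.norm_e z hz).trans (by gcongr)
  norm_g z hz := (h.norm_g z hz).trans (by gcongr)
  asymp_e z hz h1 := (h.asymp_e z hz h1).trans (by gcongr)
  asymp_e' z hz h1 := (h.asymp_e' z hz h1).trans (by gcongr)
  asymp_g z hz h1 := (h.asymp_g z hz h1).trans (by gcongr)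
  asymp_g' z hz h1 := (h.asymp_g' z hz h1).trans (by gcongr)

/-- The equation is even in z, so the decaying solution evaluated at -z is a growing one. The
contour direction 1 - si makes it available for all z in the quadrant. -/
theorem exists_isBesselPair {ν s : ℝ} (hν : 0 < ν) (hs : s = 1 ∨ s = -1) :
    ∃ C : ℝ, 0 ≤ C ∧ ∃ e e' g g' : ℂ → ℂ, IsBesselPair ν s C e e' g g' := by
  obtain ⟨e, e', C₁, hC₁, he⟩ := exists_bessel_solution hν (c := 1) (by simp)
  obtain ⟨G, G', C₂, hC₂, hG⟩ := exists_bessel_solution hν (c := 1 - s * Complex.I) (by simp)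
  have he' := fun z (hz : z ∈ quadrant s) => he z (one_div_mem_wideCone hz)
  have hG' := fun z (hz : z ∈ quadrant s) => hG (-z) (div_neg_mem_wideCone hs hz)
  have hle1 : C₁ ≤ C₁ + C₂ := by linarith
  have hle2 : C₂ ≤ C₁ + C₂ := by linarith
  have hnorm : ∀ {z u : ℂ} {B : ℝ}, ‖Complex.exp z * u‖ ≤ B → ‖u‖ ≤ Real.exp (-z.re) * B := by
    intro z u B h
    rw [norm_mul, Complex.norm_exp] at h
    calc ‖u‖ = Real.exp (-z.re) * (Real.exp z.re * ‖u‖) := by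
          rw [← mul_assoc, ← Real.exp_add]; simp
      _ ≤ _ := by gcongr
  refine ⟨C₁ + C₂, by positivity, e, e', fun z => G (-z), fun z => -G' (-z), ?_⟩
  constructor
  · exact fun z hz => (he' z hz).1
  · exact fun z hz => (he' z hz).2.1
  · intro z hz
    exact (HasDerivAt.comp (h₂ := G) z (hG' z hz).1 (hasDerivAt_neg z)).congr_deriv (by ring)
  · intro z hz
    refine (HasDerivAt.comp (h₂ := G') z (hG' z hz).2.1 (hasDerivAt_neg z)).neg.congr_deriv ?_
    ring
  · intro z hz
    refine (hnorm (he' z hz).2.2.1).trans ?_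
    rw [mul_left_comm, ← mul_assoc]
    gcongr
  · intro z hz
    have h := hnorm (hG' z hz).2.2.1
    rw [Complex.neg_re, neg_neg, norm_neg] at h
    refine h.trans ?_
    rw [mul_left_comm, ← mul_assoc]
    gcongr
  · intro z hz h1
    refine ((he' z hz).2.2.2 h1).1.trans ?_
    gcongr
  · intro z hz h1
    refine ((he' z hz).2.2.2 h1).2.trans ?_
    gcongr
  · intro z hz h1
    refine ((hG' z hz).2.2.2 (by rwa [norm_neg])).1.trans ?_
    rw [norm_neg]
    gcongr
  · intro z hz h1
    have h := ((hG' z hz).2.2.2 (by rwa [norm_neg])).2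
    rw [norm_neg] at h
    rw [show Complex.exp (-z) * -G' (-z) - 1 = -(Complex.exp (-z) * G' (-z) + 1) by ring, norm_neg]
    refine h.trans ?_
    gcongr

lemma hasDerivAt_comp_mul_ofReal {f : ℂ → ℂ} {f' κ : ℂ} {x : ℝ} (hf : HasDerivAt f f' (κ * x)) :
    HasDerivAt (fun x : ℝ => f (κ * x)) (κ * f') x := by
  have h1 : HasDerivAt (fun z : ℂ => κ * z) κ (x : ℂ) := by
    simpa using! (hasDerivAt_id (x : ℂ)).const_mul κ
  exact ((HasDerivAt.comp (h₂ := f) (x : ℂ) hf h1).comp_ofReal).congr_deriv (mul_comm _ _)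

lemma tendsto_of_norm_sub_le_div {f : ℝ → ℂ} {l : ℂ} {C a : ℝ} (ha : 0 < a)
    (h : ∀ r : ℝ, 0 < r → 1 ≤ a * r → ‖f r - l‖ ≤ C / (a * r)) : Tendsto f atTop (𝓝 l) := by
  rw [tendsto_iff_norm_sub_tendsto_zero]
  have h1 : Tendsto (fun r : ℝ => C / (a * r)) atTop (𝓝 0) :=
    tendsto_const_nhds.div_atTop (tendsto_id.const_mul_atTop ha)
  refine squeeze_zero' (Eventually.of_forall fun _ => norm_nonneg _) ?_ h1
  filter_upwards [eventually_gt_atTop 0, eventually_ge_atTop (1 / a)] with r hr hr1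
  refine h r hr ?_
  rwa [div_le_iff₀' ha] at hr1

/-- The Wronskian is constant along the ray through z, and the asymptotics at infinity give 1·1 -
1·(-1). -/
theorem IsBesselPair.wronskian {ν s C : ℝ} {e e' g g' : ℂ → ℂ} (h : IsBesselPair ν s C e e' g g')
    {z : ℂ} (hz : z ∈ quadrant s) : g' z * e z - g z * e' z = 2 := by
  set W : ℝ → ℂ := fun r => g' (z * r) * e (z * r) - g (z * r) * e' (z * r) with hW
  have hder : ∀ r ∈ Ioi (0 : ℝ), HasDerivAt W 0 r := by
    intro r hr
    have hq := mul_mem_quadrant hz hr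
    have d1 := hasDerivAt_comp_mul_ofReal (h.hasDerivAt_e _ hq)
    have d2 := hasDerivAt_comp_mul_ofReal (h.hasDerivAt_e' _ hq)
    have d3 := hasDerivAt_comp_mul_ofReal (h.hasDerivAt_g _ hq)
    have d4 := hasDerivAt_comp_mul_ofReal (h.hasDerivAt_g' _ hq)
    refine ((d4.mul d1).sub (d3.mul d2)).congr_deriv ?_
    ring
  have hconst : ∀ r ∈ Ioi (0 : ℝ), W r = W 1 := fun r hr =>
    (convex_Ioi (0 : ℝ)).is_const_of_fderivWithin_eq_zero (𝕜 := ℝ)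
      (fun r hr => (hder r hr).differentiableAt.differentiableWithinAt)
      (fun r hr => by
        rw [fderivWithin_of_isOpen isOpen_Ioi hr, (hder r hr).hasFDerivAt.fderiv]
        ext
        simp) hr (by simp)
  have h0 : 0 < ‖z‖ := norm_pos_iff.2 hz.2.2
  have hn : ∀ r : ℝ, 0 < r → ‖z * r‖ = ‖z‖ * r := fun r hr => by
    rw [norm_mul, Complex.norm_real, Real.norm_of_nonneg hr.le]
  have t1 : Tendsto (fun r : ℝ => Complex.exp (z * r) * e (z * r)) atTop (𝓝 1) :=
    tendsto_of_norm_sub_le_div (C := C) h0 fun r hr hr1 => by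
      rw [← hn r hr] at hr1 ⊢
      exact h.asymp_e _ (mul_mem_quadrant hz hr) hr1
  have t2 : Tendsto (fun r : ℝ => Complex.exp (z * r) * e' (z * r)) atTop (𝓝 (-1)) :=
    tendsto_of_norm_sub_le_div (C := C) h0 fun r hr hr1 => by
      rw [← hn r hr] at hr1 ⊢
      rw [sub_neg_eq_add]
      exact h.asymp_e' _ (mul_mem_quadrant hz hr) hr1
  have t3 : Tendsto (fun r : ℝ => Complex.exp (-(z * r)) * g (z * r)) atTop (𝓝 1) :=
    tendsto_of_norm_sub_le_div (C := C) h0 fun r hr hr1 => by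
      rw [← hn r hr] at hr1 ⊢
      exact h.asymp_g _ (mul_mem_quadrant hz hr) hr1
  have t4 : Tendsto (fun r : ℝ => Complex.exp (-(z * r)) * g' (z * r)) atTop (𝓝 1) :=
    tendsto_of_norm_sub_le_div (C := C) h0 fun r hr hr1 => by
      rw [← hn r hr] at hr1 ⊢
      exact h.asymp_g' _ (mul_mem_quadrant hz hr) hr1
  have t5 : Tendsto W atTop (𝓝 2) := by
    have := (t4.mul t1).sub (t3.mul t2)
    norm_num at this
    refine this.congr fun r => ?_
    have hexp : Complex.exp (-(z * r)) * Complex.exp (z * r) = 1 := by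
      rw [← Complex.exp_add]; simp
    simp only [hW]
    linear_combination (g' (z * r) * e (z * r) - g (z * r) * e' (z * r)) * hexp
  have t6 : Tendsto W atTop (𝓝 (W 1)) :=
    tendsto_const_nhds.congr' (by
      filter_upwards [eventually_gt_atTop 0] with r hr using (hconst r hr).symm)
  have := tendsto_nhds_unique t6 t5
  simpa [hW] using this

/-! ### The perturbed equation -/

/-- The part `‖κ‖ ≥ R` of a closed quadrant. -/
def closedRegion (s R : ℝ) : Set ℂ := {κ | 0 ≤ κ.re ∧ 0 ≤ s * κ.im ∧ R ≤ ‖κ‖}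

/-- The part `‖κ‖ > R` of an open quadrant. -/
def openRegion (s R : ℝ) : Set ℂ := {κ | 0 < κ.re ∧ 0 < s * κ.im ∧ R < ‖κ‖}

lemma isOpen_openRegion (s R : ℝ) : IsOpen (openRegion s R) :=
  (isOpen_lt continuous_const Complex.continuous_re).inter
    ((isOpen_lt continuous_const (continuous_const.mul Complex.continuous_im)).inter
      (isOpen_lt continuous_const continuous_norm))

lemma openRegion_subset_closedRegion (s R : ℝ) : openRegion s R ⊆ closedRegion s R :=
  fun _ h => ⟨h.1.le, h.2.1.le, h.2.2.le⟩

lemma mem_quadrant_of_mem_closedRegion {s R : ℝ} (hR : 0 < R) {κ : ℂ} (hκ : κ ∈ closedRegion s R) :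
    κ ∈ quadrant s :=
  ⟨hκ.1, hκ.2.1, norm_pos_iff.1 (hR.trans_le hκ.2.2)⟩

/-- The weight `e^{σ Re κ x} min(1, |κ|x)^{1/2-μ}`. -/
def solutionWeight (σ μ : ℝ) (κ : ℂ) (x : ℝ) : ℝ :=
  Real.exp (σ * (κ.re * x)) * min 1 (‖κ‖ * x) ^ (1 / 2 - μ)

/-- The integrable function `x^{1-2μ} ∑ |Q_{ij}(x)|`. -/
def potentialMajorant {m : ℕ} (μ : ℝ) (Q : ℝ → Matrix (Fin m) (Fin m) ℂ) (t : ℝ) : ℝ :=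
  t ^ (1 - 2 * μ) * ∑ i, ∑ j, ‖Q t i j‖

/-- This is the origin of β. If 2μ ≤ 1, then min(1, kt) ≤ kt costs k^{1-2μ}. If 2μ ≥ 1, the exponent
is nonpositive and min(1, kt) ≥ t / max(1, T) costs no power of k. -/
lemma min_rpow_le {μ T k t : ℝ} (hk : 1 ≤ k) (ht : 0 < t) (htT : t < T) :
    min 1 (k * t) ^ (1 - 2 * μ) ≤
      max 1 T ^ |1 - 2 * μ| * k ^ (1 - min 1 (2 * μ)) * t ^ (1 - 2 * μ) := by
  have hk0 : 0 < k := by linarith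
  have hT1 : (1 : ℝ) ≤ max 1 T := le_max_left _ _
  have hT0 : (0 : ℝ) < max 1 T := by linarith
  have hmin : 0 < min 1 (k * t) := lt_min one_pos (by positivity)
  rcases le_total (2 * μ) 1 with h | h
  · rw [min_eq_right h]
    calc min 1 (k * t) ^ (1 - 2 * μ) ≤ (k * t) ^ (1 - 2 * μ) :=
          Real.rpow_le_rpow hmin.le (min_le_right _ _) (by linarith)
      _ = 1 * (k ^ (1 - 2 * μ) * t ^ (1 - 2 * μ)) := by
          rw [Real.mul_rpow hk0.le ht.le, one_mul]
      _ ≤ max 1 T ^ |1 - 2 * μ| * (k ^ (1 - 2 * μ) * t ^ (1 - 2 * μ)) := by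
          gcongr
          exact Real.one_le_rpow hT1 (abs_nonneg _)
      _ = _ := by ring
  · rw [min_eq_left h, sub_self, Real.rpow_zero, mul_one]
    have hle : t / max 1 T ≤ min 1 (k * t) := by
      refine le_min ?_ ?_
      · rw [div_le_one hT0]
        exact htT.le.trans (le_max_right _ _)
      · calc t / max 1 T ≤ t := div_le_self ht.le hT1
          _ ≤ k * t := le_mul_of_one_le_left ht.le hk
    calc min 1 (k * t) ^ (1 - 2 * μ) ≤ (t / max 1 T) ^ (1 - 2 * μ) :=
          Real.rpow_le_rpow_of_nonpos (by positivity) hle (by linarith)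
      _ = _ := by
          rw [Real.div_rpow ht.le hT0.le, abs_of_nonpos (by linarith), Real.rpow_neg hT0.le]
          field_simp

/-- The data of the integral equation for solutions behaving like `e^{σκx}`. -/
structure IsPerturbation {m : ℕ} (T μ s σ b C R : ℝ) (ν : Fin m → ℝ)
    (Q : ℝ → Matrix (Fin m) (Fin m) ℂ) (e e' g g' : Fin m → ℂ → ℂ) : Prop where
  pair : ∀ q, IsBesselPair (ν q) s C (e q) (e' q) (g q) (g' q)
  const_nonneg : 0 ≤ C
  order_le : ∀ q, ν q ≤ μ
  order_pos : 0 < μ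
  length_pos : 0 < T
  direction : (σ = 1 ∧ b = 0) ∨ (σ = -1 ∧ b = T)
  aestronglyMeasurable : ∀ i j, AEStronglyMeasurable (fun t => Q t i j) (volume.restrict (Ioi 0))
  support : ∀ t, t ∉ Ioo 0 T → Q t = 0
  integrableOn : IntegrableOn (potentialMajorant μ Q) (Ioi 0)
  one_le : 1 ≤ R
  small : C ^ 2 * max 1 T ^ |1 - 2 * μ| * R ^ (-min 1 (2 * μ)) *
    ∫ t in Ioi 0, potentialMajorant μ Q t ≤ 1 / 2

namespace IsPerturbation

variable {m : ℕ} {T μ s σ b C R : ℝ} {ν : Fin m → ℝ} {Q : ℝ → Matrix (Fin m) (Fin m) ℂ}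
  {e e' g g' : Fin m → ℂ → ℂ}

/-- The growing solution of the unperturbed equation. -/
abbrev phi (g : Fin m → ℂ → ℂ) (q : Fin m) (κ : ℂ) (x : ℝ) : ℂ := (2 * κ)⁻¹ * g q (κ * x)

/-- The decaying solution of the unperturbed equation. -/
abbrev psi (e : Fin m → ℂ → ℂ) (q : Fin m) (κ : ℂ) (x : ℝ) : ℂ := e q (κ * x)

lemma mul_mem (h : IsPerturbation T μ s σ b C R ν Q e e' g g') {κ : ℂ} (hκ : κ ∈ closedRegion s R)
    {x : ℝ} (hx : 0 < x) : κ * x ∈ quadrant s :=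
  mul_mem_quadrant (mem_quadrant_of_mem_closedRegion (by linarith [h.one_le]) hκ) hx

lemma one_le_norm (h : IsPerturbation T μ s σ b C R ν Q e e' g g') {κ : ℂ}
    (hκ : κ ∈ closedRegion s R) : 1 ≤ ‖κ‖ := h.one_le.trans hκ.2.2

lemma ne_zero (h : IsPerturbation T μ s σ b C R ν Q e e' g g') {κ : ℂ}
    (hκ : κ ∈ closedRegion s R) : κ ≠ 0 := norm_pos_iff.1 (by linarith [h.one_le_norm hκ])

lemma min_pos (h : IsPerturbation T μ s σ b C R ν Q e e' g g') {κ : ℂ}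
    (hκ : κ ∈ closedRegion s R) {x : ℝ} (hx : 0 < x) : 0 < min 1 (‖κ‖ * x) :=
  lt_min one_pos (mul_pos (by linarith [h.one_le_norm hκ]) hx)

lemma min_rpow_order_le (h : IsPerturbation T μ s σ b C R ν Q e e' g g') {κ : ℂ}
    (hκ : κ ∈ closedRegion s R) {x : ℝ} (hx : 0 < x) (q : Fin m) :
    min 1 ‖κ * x‖ ^ (1 / 2 - ν q) ≤ min 1 (‖κ‖ * x) ^ (1 / 2 - μ) := by
  rw [norm_mul, Complex.norm_real, Real.norm_of_nonneg hx.le]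
  exact Real.rpow_le_rpow_of_exponent_ge (h.min_pos hκ hx) (min_le_left _ _)
    (by linarith [h.order_le q])

/-! ### Bounds for the unperturbed solutions and the kernel -/

lemma norm_e_le (h : IsPerturbation T μ s σ b C R ν Q e e' g g') {κ : ℂ}
    (hκ : κ ∈ closedRegion s R) {x : ℝ} (hx : 0 < x) (q : Fin m) :
    ‖e q (κ * x)‖ ≤ C * Real.exp (-(κ.re * x)) * min 1 (‖κ‖ * x) ^ (1 / 2 - μ) := by
  have h0 := h.const_nonneg
  refine ((h.pair q).norm_e _ (h.mul_mem hκ hx)).trans ?_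
  rw [Complex.re_mul_ofReal]
  gcongr
  exact h.min_rpow_order_le hκ hx q

lemma norm_g_le (h : IsPerturbation T μ s σ b C R ν Q e e' g g') {κ : ℂ}
    (hκ : κ ∈ closedRegion s R) {x : ℝ} (hx : 0 < x) (q : Fin m) :
    ‖g q (κ * x)‖ ≤ C * Real.exp (κ.re * x) * min 1 (‖κ‖ * x) ^ (1 / 2 - μ) := by
  have h0 := h.const_nonneg
  refine ((h.pair q).norm_g _ (h.mul_mem hκ hx)).trans ?_
  rw [Complex.re_mul_ofReal]
  gcongr
  exact h.min_rpow_order_le hκ hx q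

lemma norm_phi_le (h : IsPerturbation T μ s σ b C R ν Q e e' g g') {κ : ℂ}
    (hκ : κ ∈ closedRegion s R) {x : ℝ} (hx : 0 < x) (q : Fin m) :
    ‖phi g q κ x‖ ≤
      C / (2 * ‖κ‖) * Real.exp (κ.re * x) * min 1 (‖κ‖ * x) ^ (1 / 2 - μ) := by
  rw [norm_mul, norm_inv, norm_mul, Complex.norm_ofNat]
  calc _ ≤ (2 * ‖κ‖)⁻¹ * (C * Real.exp (κ.re * x) * min 1 (‖κ‖ * x) ^ (1 / 2 - μ)) := by
        gcongr
        exact h.norm_g_le hκ hx q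
    _ = _ := by ring

/-- The two powers come from the unperturbed solution in the kernel and from the weight of the
unknown, both taken at t. -/
lemma sum_norm_mul_min_rpow_le (h : IsPerturbation T μ s σ b C R ν Q e e' g g') {κ : ℂ}
    (hκ : κ ∈ closedRegion s R) {t : ℝ} (ht : 0 < t) (q : Fin m) :
    (∑ l, ‖Q t q l‖) * (min 1 (‖κ‖ * t) ^ (1 / 2 - μ) * min 1 (‖κ‖ * t) ^ (1 / 2 - μ)) ≤
      max 1 T ^ |1 - 2 * μ| * ‖κ‖ ^ (1 - min 1 (2 * μ)) * potentialMajorant μ Q t := by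
  by_cases htT : t < T
  · rw [← Real.rpow_add (h.min_pos hκ ht)]
    have h1 := min_rpow_le (μ := μ) (h.one_le_norm hκ) ht htT
    rw [show (1 / 2 - μ + (1 / 2 - μ) : ℝ) = 1 - 2 * μ by ring]
    have h2 : ∑ l, ‖Q t q l‖ ≤ ∑ i, ∑ l, ‖Q t i l‖ :=
      Finset.single_le_sum (f := fun i => ∑ l, ‖Q t i l‖)
        (fun i _ => Finset.sum_nonneg fun j _ => norm_nonneg _) (Finset.mem_univ q)
    have h3 := h.min_pos hκ ht
    calc _ ≤ (∑ i, ∑ l, ‖Q t i l‖) *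
          (max 1 T ^ |1 - 2 * μ| * ‖κ‖ ^ (1 - min 1 (2 * μ)) * t ^ (1 - 2 * μ)) := by gcongr
      _ = _ := by rw [potentialMajorant]; ring
  · have hQ : Q t = 0 := h.support t fun ht' => htT ht'.2
    simp [hQ, potentialMajorant]

/-- The bound for the kernel of the integral equation and for its `x`-derivative. -/
lemma kernel_le (h : IsPerturbation T μ s σ b C R ν Q e e' g g') {κ : ℂ}
    (hκ : κ ∈ closedRegion s R) {x : ℝ} {t : ℝ} (ht0 : 0 < t) (ht : t ∈ uIoc b x)
    (q : Fin m) {α₁ α₂ : ℂ} {B : ℝ} (hB : 0 ≤ B) (h₁ : ‖α₁‖ ≤ B * Real.exp (κ.re * x))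
    (h₂ : ‖α₂‖ ≤ 2 * ‖κ‖ * B * Real.exp (-(κ.re * x))) :
    ‖α₁ * psi e q κ t - α₂ * phi g q κ t‖ * (∑ l, ‖Q t q l‖) * solutionWeight σ μ κ t ≤
      2 * B * C * (max 1 T ^ |1 - 2 * μ|) * ‖κ‖ ^ (1 - min 1 (2 * μ)) *
        Real.exp (σ * (κ.re * x)) * potentialMajorant μ Q t := by
  have hC := h.const_nonneg
  have hκ0 : 0 < ‖κ‖ := by linarith [h.one_le_norm hκ]
  by_cases htT : t ∈ Ioo 0 T
  swap
  · simp [h.support t htT, potentialMajorant]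
  set M := min 1 (‖κ‖ * t) ^ (1 / 2 - μ) with hM
  have hM0 : 0 ≤ M := Real.rpow_nonneg (h.min_pos hκ ht0).le _
  have hexp : Real.exp (κ.re * x) * Real.exp (-(κ.re * t)) * Real.exp (σ * (κ.re * t)) ≤
        Real.exp (σ * (κ.re * x)) ∧
      Real.exp (-(κ.re * x)) * Real.exp (κ.re * t) * Real.exp (σ * (κ.re * t)) ≤
        Real.exp (σ * (κ.re * x)) := by
    -- The base point puts t on the side of x where e^{2 Re κ (t - x)} for σ = 1, or e^{2 Re κ (x -
    -- t)} for σ = -1, is at most 1; the other product of exponentials is an equality.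
    simp only [← Real.exp_add, Real.exp_le_exp]
    have hre : 0 ≤ κ.re := hκ.1
    rcases h.direction with ⟨rfl, rfl⟩ | ⟨rfl, rfl⟩
    · have htx : t ≤ x := by
        rcases le_total 0 x with h0 | h0
        · rw [uIoc_of_le h0] at ht
          exact ht.2
        · rw [uIoc_of_ge h0] at ht
          linarith [ht.2]
      constructor <;> nlinarith
    · have htx : x ≤ t := by
        -- For x beyond b = T the integration runs over t > T, which is excluded by `htT`, since Q
        -- vanishes there.
        rcases le_total b x with h0 | h0
        · rw [uIoc_of_le h0] at ht
          linarith [ht.1, htT.2]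
        · rw [uIoc_of_ge h0] at ht
          exact ht.1.le
      constructor <;> nlinarith
  have n1 : ‖α₁ * psi e q κ t‖ ≤
      B * C * M * (Real.exp (κ.re * x) * Real.exp (-(κ.re * t))) := by
    rw [norm_mul]
    calc _ ≤ (B * Real.exp (κ.re * x)) * (C * Real.exp (-(κ.re * t)) * M) := by
          gcongr
          exact h.norm_e_le hκ ht0 q
      _ = _ := by ring
  have n2 : ‖α₂ * phi g q κ t‖ ≤
      B * C * M * (Real.exp (-(κ.re * x)) * Real.exp (κ.re * t)) := by
    rw [norm_mul]
    calc _ ≤ (2 * ‖κ‖ * B * Real.exp (-(κ.re * x))) *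
            (C / (2 * ‖κ‖) * Real.exp (κ.re * t) * M) := by
          gcongr
          exact h.norm_phi_le hκ ht0 q
      _ = _ := by field_simp
  have n3 : ‖α₁ * psi e q κ t - α₂ * phi g q κ t‖ * Real.exp (σ * (κ.re * t)) ≤
      2 * B * C * M * Real.exp (σ * (κ.re * x)) := by
    have hBCM : 0 ≤ B * C * M := by positivity
    calc _ ≤ (B * C * M * (Real.exp (κ.re * x) * Real.exp (-(κ.re * t))) +
            B * C * M * (Real.exp (-(κ.re * x)) * Real.exp (κ.re * t))) *
              Real.exp (σ * (κ.re * t)) := by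
          gcongr
          exact (norm_sub_le _ _).trans (add_le_add n1 n2)
      _ = B * C * M *
            (Real.exp (κ.re * x) * Real.exp (-(κ.re * t)) * Real.exp (σ * (κ.re * t))) +
          B * C * M *
            (Real.exp (-(κ.re * x)) * Real.exp (κ.re * t) * Real.exp (σ * (κ.re * t))) := by ring
      _ ≤ B * C * M * Real.exp (σ * (κ.re * x)) + B * C * M * Real.exp (σ * (κ.re * x)) :=
          add_le_add (mul_le_mul_of_nonneg_left hexp.1 hBCM)
            (mul_le_mul_of_nonneg_left hexp.2 hBCM)
      _ = _ := by ring
  have n4 := h.sum_norm_mul_min_rpow_le hκ ht0 q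
  calc _ = (‖α₁ * psi e q κ t - α₂ * phi g q κ t‖ * Real.exp (σ * (κ.re * t))) *
        ((∑ l, ‖Q t q l‖) * M) := by rw [solutionWeight]; ring
    _ ≤ (2 * B * C * M * Real.exp (σ * (κ.re * x))) * ((∑ l, ‖Q t q l‖) * M) := by
        gcongr
    _ = 2 * B * C * Real.exp (σ * (κ.re * x)) * ((∑ l, ‖Q t q l‖) * (M * M)) := by ring
    _ ≤ 2 * B * C * Real.exp (σ * (κ.re * x)) *
        (max 1 T ^ |1 - 2 * μ| * ‖κ‖ ^ (1 - min 1 (2 * μ)) * potentialMajorant μ Q t) := by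
        gcongr
    _ = _ := by ring

/-- A function of `κ x` is a holomorphic family. -/
lemma isHolomorphicFamily_comp (h : IsPerturbation T μ s σ b C R ν Q e e' g g') {f f' : ℂ → ℂ}
    (hf : ∀ z ∈ quadrant s, HasDerivAt f (f' z) z) :
    IsHolomorphicFamily (closedRegion s R) (openRegion s R) fun κ x => f (κ * x) where
  aestronglyMeasurable κ hκ := by
    refine ContinuousOn.aestronglyMeasurable (fun x hx => ?_) measurableSet_Ioi
    exact (hasDerivAt_comp_mul_ofReal (hf _ (h.mul_mem hκ hx))).continuousAt.continuousWithinAt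
  continuousOn x hx κ hκ := by
    have h1 : ContinuousAt (fun κ : ℂ => κ * x) κ := by fun_prop
    exact (ContinuousAt.comp (f := fun κ : ℂ => κ * x)
      (hf _ (h.mul_mem hκ hx)).continuousAt h1).continuousWithinAt
  differentiableOn x hx κ hκ := by
    have h1 : DifferentiableAt ℂ (fun κ : ℂ => κ * x) κ := by fun_prop
    exact (DifferentiableAt.comp (f := fun κ : ℂ => κ * x) κ
      (hf _ (h.mul_mem (openRegion_subset_closedRegion s R hκ) hx)).differentiableAt
      h1).differentiableWithinAt

lemma isHolomorphicFamily_of_differentiableOn (h : IsPerturbation T μ s σ b C R ν Q e e' g g')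
    {f : ℂ → ℂ} (hf : DifferentiableOn ℂ f {0}ᶜ) :
    IsHolomorphicFamily (closedRegion s R) (openRegion s R) fun κ _ => f κ where
  aestronglyMeasurable _ _ := aestronglyMeasurable_const
  continuousOn _ _ := hf.continuousOn.mono fun _ hκ => h.ne_zero hκ
  differentiableOn _ _ := hf.mono fun _ hκ => h.ne_zero (openRegion_subset_closedRegion s R hκ)

lemma isHolomorphicFamily_phi (h : IsPerturbation T μ s σ b C R ν Q e e' g g') (q : Fin m) :
    IsHolomorphicFamily (closedRegion s R) (openRegion s R) (phi g q) :=
  (h.isHolomorphicFamily_of_differentiableOn (f := fun κ => (2 * κ)⁻¹)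
    (DifferentiableOn.inv (by fun_prop) fun κ hκ => mul_ne_zero two_ne_zero hκ)).mul
    (h.isHolomorphicFamily_comp (h.pair q).hasDerivAt_g)

lemma isHolomorphicFamily_psi (h : IsPerturbation T μ s σ b C R ν Q e e' g g') (q : Fin m) :
    IsHolomorphicFamily (closedRegion s R) (openRegion s R) (psi e q) :=
  h.isHolomorphicFamily_comp (h.pair q).hasDerivAt_e

/-! ### The unperturbed equation in the variable x -/

lemma hasDerivAt_phi (h : IsPerturbation T μ s σ b C R ν Q e e' g g') {κ : ℂ}
    (hκ : κ ∈ closedRegion s R) {x : ℝ} (hx : 0 < x) (q : Fin m) :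
    HasDerivAt (phi g q κ) (2⁻¹ * g' q (κ * x)) x := by
  have h0 := h.ne_zero hκ
  refine ((hasDerivAt_comp_mul_ofReal
    ((h.pair q).hasDerivAt_g _ (h.mul_mem hκ hx))).const_mul (2 * κ)⁻¹).congr_deriv ?_
  field_simp

lemma hasDerivAt_psi (h : IsPerturbation T μ s σ b C R ν Q e e' g g') {κ : ℂ}
    (hκ : κ ∈ closedRegion s R) {x : ℝ} (hx : 0 < x) (q : Fin m) :
    HasDerivAt (psi e q κ) (κ * e' q (κ * x)) x :=
  hasDerivAt_comp_mul_ofReal ((h.pair q).hasDerivAt_e _ (h.mul_mem hκ hx))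

lemma hasDerivAt_phi' (h : IsPerturbation T μ s σ b C R ν Q e e' g g') {κ : ℂ}
    (hκ : κ ∈ closedRegion s R) {x : ℝ} (hx : 0 < x) (q : Fin m) :
    HasDerivAt (fun x : ℝ => 2⁻¹ * g' q (κ * x))
      ((κ ^ 2 + ((ν q ^ 2 - 1 / 4 : ℝ) : ℂ) / x ^ 2) * phi g q κ x) x := by
  have h0 := h.ne_zero hκ
  have hx0 : (x : ℂ) ≠ 0 := by exact_mod_cast hx.ne'
  refine ((hasDerivAt_comp_mul_ofReal
    ((h.pair q).hasDerivAt_g' _ (h.mul_mem hκ hx))).const_mul 2⁻¹).congr_deriv ?_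
  field_simp

lemma hasDerivAt_psi' (h : IsPerturbation T μ s σ b C R ν Q e e' g g') {κ : ℂ}
    (hκ : κ ∈ closedRegion s R) {x : ℝ} (hx : 0 < x) (q : Fin m) :
    HasDerivAt (fun x : ℝ => κ * e' q (κ * x))
      ((κ ^ 2 + ((ν q ^ 2 - 1 / 4 : ℝ) : ℂ) / x ^ 2) * psi e q κ x) x := by
  have h0 := h.ne_zero hκ
  have hx0 : (x : ℂ) ≠ 0 := by exact_mod_cast hx.ne'
  refine ((hasDerivAt_comp_mul_ofReal
    ((h.pair q).hasDerivAt_e' _ (h.mul_mem hκ hx))).const_mul κ).congr_deriv ?_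
  field_simp

/-- The factor (2κ)⁻¹ in `phi` normalises the Wronskian to 1, so variation of constants needs no
further factor. -/
lemma wronskian (h : IsPerturbation T μ s σ b C R ν Q e e' g g') {κ : ℂ}
    (hκ : κ ∈ closedRegion s R) {x : ℝ} (hx : 0 < x) (q : Fin m) :
    2⁻¹ * g' q (κ * x) * psi e q κ x - κ * e' q (κ * x) * phi g q κ x = 1 := by
  have h0 := h.ne_zero hκ
  have := (h.pair q).wronskian (h.mul_mem hκ hx)
  simp only [phi, psi]
  field_simp
  linear_combination this

/-- The decisive quantity is θ = O(‖κ‖^{-β}), which `small` makes a contraction rate for ‖κ‖ ≥ R.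
The bound L is crude, with e^{2‖κ‖T}, because it only has to be continuous in κ. -/
theorem isVolterraContraction (h : IsPerturbation T μ s σ b C R ν Q e e' g g') :
    IsVolterraContraction (closedRegion s R) (openRegion s R) (solutionWeight σ μ) b Q (phi g)
      (psi e) (potentialMajorant μ Q)
      (fun κ => C ^ 2 * max 1 T ^ |1 - 2 * μ| * ‖κ‖ ^ (-min 1 (2 * μ)))
      (fun κ => C * Real.exp (2 * ‖κ‖ * T) *
        (max 1 T ^ |1 - 2 * μ| * ‖κ‖ ^ (1 - min 1 (2 * μ)))) := by
  have hC := h.const_nonneg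
  have hpiece : ∀ κ ∈ closedRegion s R, ∀ t, 0 < t → ∀ q, ∀ a : ℂ,
      ‖a‖ ≤ C * Real.exp (κ.re * t) * min 1 (‖κ‖ * t) ^ (1 / 2 - μ) →
      ‖a‖ * (∑ l, ‖Q t q l‖) * solutionWeight σ μ κ t ≤ C * Real.exp (2 * ‖κ‖ * T) *
        (max 1 T ^ |1 - 2 * μ| * ‖κ‖ ^ (1 - min 1 (2 * μ))) * potentialMajorant μ Q t := by
    intro κ hκ t ht q a ha
    by_cases htT : t ∈ Ioo 0 T
    swap
    · simp [h.support t htT, potentialMajorant]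
    have n := h.sum_norm_mul_min_rpow_le hκ ht q
    have hre : κ.re ≤ ‖κ‖ := Complex.re_le_norm κ
    have hre0 : 0 ≤ κ.re := hκ.1
    have hexp : Real.exp (κ.re * t) * Real.exp (σ * (κ.re * t)) ≤ Real.exp (2 * ‖κ‖ * T) := by
      rw [← Real.exp_add, Real.exp_le_exp]
      have h1 : κ.re * t ≤ ‖κ‖ * T := mul_le_mul hre htT.2.le ht.le (norm_nonneg κ)
      have h2 : 0 ≤ κ.re * t := by positivity
      rcases h.direction with ⟨rfl, _⟩ | ⟨rfl, _⟩ <;> nlinarith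
    have hm := Real.rpow_nonneg (h.min_pos hκ ht).le (1 / 2 - μ)
    rw [solutionWeight]
    calc _ ≤ (C * Real.exp (κ.re * t) * min 1 (‖κ‖ * t) ^ (1 / 2 - μ)) * (∑ l, ‖Q t q l‖) *
          (Real.exp (σ * (κ.re * t)) * min 1 (‖κ‖ * t) ^ (1 / 2 - μ)) := by gcongr
      _ = C * (Real.exp (κ.re * t) * Real.exp (σ * (κ.re * t))) * ((∑ l, ‖Q t q l‖) *
          (min 1 (‖κ‖ * t) ^ (1 / 2 - μ) * min 1 (‖κ‖ * t) ^ (1 / 2 - μ))) := by ring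
      _ ≤ C * Real.exp (2 * ‖κ‖ * T) * (max 1 T ^ |1 - 2 * μ| * ‖κ‖ ^ (1 - min 1 (2 * μ)) *
          potentialMajorant μ Q t) := by gcongr
      _ = _ := by ring
  constructor
  · exact isOpen_openRegion s R
  · exact openRegion_subset_closedRegion s R
  · rcases h.direction with ⟨_, rfl⟩ | ⟨_, rfl⟩
    · exact le_rfl
    · exact h.length_pos.le
  · intro κ hκ x hx
    exact mul_nonneg (Real.exp_nonneg _) (Real.rpow_nonneg (h.min_pos hκ hx).le _)
  · intro x hx
    refine ContinuousOn.mul (by fun_prop) (ContinuousOn.rpow_const (by fun_prop) fun κ hκ => ?_)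
    exact Or.inl (h.min_pos hκ hx).ne'
  · exact h.aestronglyMeasurable
  · exact h.isHolomorphicFamily_phi
  · exact h.isHolomorphicFamily_psi
  · exact fun q κ hκ x hx => (h.hasDerivAt_phi hκ hx q).continuousAt.continuousWithinAt
  · exact fun q κ hκ x hx => (h.hasDerivAt_psi hκ hx q).continuousAt.continuousWithinAt
  · intro t ht
    exact mul_nonneg (Real.rpow_nonneg ht.le _)
      (Finset.sum_nonneg fun i _ => Finset.sum_nonneg fun j _ => norm_nonneg _)
  · exact h.integrableOn
  · refine ContinuousOn.mul (by fun_prop) (ContinuousOn.mul continuousOn_const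
      (ContinuousOn.rpow_const (by fun_prop) fun κ hκ => Or.inl ?_))
    exact norm_ne_zero_iff.2 (h.ne_zero hκ)
  · intro κ hκ t ht q
    refine hpiece κ hκ t ht q _ ((h.norm_phi_le hκ ht q).trans ?_)
    have hm := Real.rpow_nonneg (h.min_pos hκ ht).le (1 / 2 - μ)
    gcongr
    exact div_le_self hC (by linarith [h.one_le_norm hκ])
  · intro κ hκ t ht q
    refine hpiece κ hκ t ht q _ ((h.norm_e_le hκ ht q).trans ?_)
    have hm := Real.rpow_nonneg (h.min_pos hκ ht).le (1 / 2 - μ)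
    have : 0 ≤ κ.re * t := mul_nonneg hκ.1 ht.le
    gcongr
    linarith
  · intro κ hκ x hx t ht q
    have hκ1 := h.one_le_norm hκ
    have hκ0 : 0 < ‖κ‖ := by linarith
    have hm := Real.rpow_nonneg (h.min_pos hκ hx).le (1 / 2 - μ)
    have ht0 : 0 < t := by
      have hb : 0 ≤ b := by
        rcases h.direction with ⟨_, rfl⟩ | ⟨_, rfl⟩
        · exact le_rfl
        · exact h.length_pos.le
      exact uIoc_subset_Ioi hb hx ht
    -- This B carries the factor ‖κ‖⁻¹ that turns ‖κ‖^{1-β} into ‖κ‖^{-β}, and the power of the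
    -- weight at x.
    refine (h.kernel_le hκ ht0 ht q (B := C / (2 * ‖κ‖) * min 1 (‖κ‖ * x) ^ (1 / 2 - μ))
      (by positivity) ((h.norm_phi_le hκ hx q).trans (le_of_eq (by ring)))
      ((h.norm_e_le hκ hx q).trans (le_of_eq (by field_simp)))).trans (le_of_eq ?_)
    rw [sub_eq_add_neg 1 (min 1 (2 * μ)), Real.rpow_add hκ0, Real.rpow_one, solutionWeight]
    field_simp
  · intro κ hκ
    positivity
  · intro κ hκ
    have hR : 0 < R := by linarith [h.one_le]
    have hP : 0 ≤ ∫ t in Ioi 0, potentialMajorant μ Q t := by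
      refine setIntegral_nonneg measurableSet_Ioi fun t ht => ?_
      exact mul_nonneg (Real.rpow_nonneg (le_of_lt ht) _)
        (Finset.sum_nonneg fun i _ => Finset.sum_nonneg fun j _ => norm_nonneg _)
    refine le_trans ?_ h.small
    have hμ := h.order_pos
    have h1 : ‖κ‖ ^ (-min 1 (2 * μ)) ≤ R ^ (-min 1 (2 * μ)) :=
      Real.rpow_le_rpow_of_nonpos hR hκ.2.2 (by
        have : 0 < min 1 (2 * μ) := lt_min one_pos (by positivity)
        linarith)
    gcongr

end IsPerturbation

/-- A family of solutions `y(κ, ·)` with derivatives `y'(κ, ·)`, holomorphic in `κ`, such that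
`y(κ, x)` behaves like `e^{σκx}` times the `j`-th unit vector. -/
structure IsExponentialColumn {m : ℕ} (T : ℝ) (ν : Fin m → ℝ) (Q : ℝ → Matrix (Fin m) (Fin m) ℂ)
    (s σ β R C : ℝ) (j : Fin m) (y y' : ℂ → ℝ → Fin m → ℂ) : Prop where
  hasDerivAt : ∀ κ ∈ closedRegion s R, ∀ x, 0 < x → ∀ q,
    HasDerivAt (fun x => y κ x q) (y' κ x q) x
  continuousOn_deriv : ∀ κ ∈ closedRegion s R, ∀ q, ContinuousOn (fun x => y' κ x q) (Ioi 0)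
  isSolution : ∀ κ ∈ closedRegion s R, IsSolution T ν Q (-κ ^ 2) (y κ)
  family : ∀ q, IsHolomorphicFamily (closedRegion s R) (openRegion s R) fun κ x => y κ x q
  family_deriv : ∀ q, IsHolomorphicFamily (closedRegion s R) (openRegion s R) fun κ x => y' κ x q
  asymp : ∀ κ ∈ closedRegion s R, ∀ x, 0 < x → 1 ≤ ‖κ‖ * x → ∀ q,
    ‖Complex.exp (-(σ * κ * x)) * y κ x q - (1 : Matrix (Fin m) (Fin m) ℂ) q j‖ ≤
      C * (‖κ‖ ^ (-β) + (‖κ‖ * x)⁻¹)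
  asymp_deriv : ∀ κ ∈ closedRegion s R, ∀ x, 0 < x → 1 ≤ ‖κ‖ * x → ∀ q,
    ‖(σ * κ)⁻¹ * Complex.exp (-(σ * κ * x)) * y' κ x q - (1 : Matrix (Fin m) (Fin m) ℂ) q j‖ ≤
      C * (‖κ‖ ^ (-β) + (‖κ‖ * x)⁻¹)

namespace IsPerturbation

variable {m : ℕ} {T μ s σ b C R : ℝ} {ν : Fin m → ℝ} {Q : ℝ → Matrix (Fin m) (Fin m) ℂ}
  {e e' g g' : Fin m → ℂ → ℂ}

lemma base_nonneg (h : IsPerturbation T μ s σ b C R ν Q e e' g g') : 0 ≤ b :=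
  h.isVolterraContraction.base_nonneg

/-- With B of order ‖κ‖⁻¹ this bounds the integral term, and with B of order 1 its x-derivative,
whose extra factor ‖κ‖ the normalisation by (σκ)⁻¹ removes. -/
lemma norm_combination_le (h : IsPerturbation T μ s σ b C R ν Q e e' g g')
    {u : ℂ → ℝ → Fin m → ℂ} {M : ℝ} (hM : 0 ≤ M)
    (hu : IsAdmissible (closedRegion s R) (openRegion s R) (solutionWeight σ μ) M u)
    {κ : ℂ} (hκ : κ ∈ closedRegion s R) {x : ℝ} (hx : 0 < x) (q : Fin m) {α₁ α₂ : ℂ} {B : ℝ}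
    (hB : 0 ≤ B) (h₁ : ‖α₁‖ ≤ B * Real.exp (κ.re * x))
    (h₂ : ‖α₂‖ ≤ 2 * ‖κ‖ * B * Real.exp (-(κ.re * x))) :
    ‖α₁ * kernelIntegral b Q (psi e) u κ x q - α₂ * kernelIntegral b Q (phi g) u κ x q‖ ≤
      (2 * M * B * C * max 1 T ^ |1 - 2 * μ| * ∫ t in Ioi 0, potentialMajorant μ Q t) *
        ‖κ‖ ^ (1 - min 1 (2 * μ)) * Real.exp (σ * (κ.re * x)) := by
  have hC := h.const_nonneg
  refine (h.isVolterraContraction.norm_combination_le hM hu hκ hx q (W := 2 * B * C *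
    (max 1 T ^ |1 - 2 * μ|) * ‖κ‖ ^ (1 - min 1 (2 * μ)) * Real.exp (σ * (κ.re * x)))
    (by positivity) fun t ht =>
      h.kernel_le hκ (uIoc_subset_Ioi h.base_nonneg hx ht) ht q hB h₁ h₂).trans (le_of_eq ?_)
  ring

/-- The integral equation with leading term `f(κx)` times the `j`-th unit vector has a solution
that is an exponential column for the perturbed equation. -/
theorem exists_column (h : IsPerturbation T μ s σ b C R ν Q e e' g g') (j : Fin m)
    {f f' : ℂ → ℂ} (hf : ∀ z ∈ quadrant s, HasDerivAt f (f' z) z)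
    (hf' : ∀ z ∈ quadrant s, HasDerivAt f' ((1 + ((ν j ^ 2 - 1 / 4 : ℝ) : ℂ) / z ^ 2) * f z) z)
    (hbound : ∀ κ ∈ closedRegion s R, ∀ x : ℝ, 0 < x → ‖f (κ * x)‖ ≤ C * solutionWeight σ μ κ x)
    (hasymp : ∀ z ∈ quadrant s, 1 ≤ ‖z‖ → ‖Complex.exp (-(σ * z)) * f z - 1‖ ≤ C / ‖z‖)
    (hasymp' : ∀ z ∈ quadrant s, 1 ≤ ‖z‖ → ‖Complex.exp (-(σ * z)) * f' z - σ‖ ≤ C / ‖z‖) :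
    ∃ K : ℝ, 0 ≤ K ∧ ∃ y y' : ℂ → ℝ → Fin m → ℂ,
      IsExponentialColumn T ν Q s σ (min 1 (2 * μ)) R K j y y' := by
  have hC := h.const_nonneg
  have hV := h.isVolterraContraction
  have hσ2 : (σ : ℂ) * σ = 1 := by
    rcases h.direction with ⟨rfl, _⟩ | ⟨rfl, _⟩ <;> norm_num
  have hσ0 : (σ : ℂ) ≠ 0 := left_ne_zero_of_mul_eq_one hσ2
  have hσn : ‖(σ : ℂ)‖ = 1 := by
    rcases h.direction with ⟨rfl, _⟩ | ⟨rfl, _⟩ <;> simp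
  set δ : Fin m → ℂ := fun q => (1 : Matrix (Fin m) (Fin m) ℂ) q j with hδ
  have hδ1 : ∀ q, ‖δ q‖ ≤ 1 := by
    intro q
    simp only [hδ, Matrix.one_apply]
    split_ifs <;> simp
  set y₀ : ℂ → ℝ → Fin m → ℂ := fun κ x q => δ q * f (κ * x) with hy₀
  have hfam0 : IsHolomorphicFamily (closedRegion s R) (openRegion s R) fun κ x => f (κ * x) :=
    h.isHolomorphicFamily_comp hf
  have hconst : ∀ a : ℂ, IsHolomorphicFamily (closedRegion s R) (openRegion s R) fun _ _ => a :=
    fun a => h.isHolomorphicFamily_of_differentiableOn (differentiableOn_const a)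
  have hid : IsHolomorphicFamily (closedRegion s R) (openRegion s R) fun κ _ => κ :=
    h.isHolomorphicFamily_of_differentiableOn differentiableOn_id
  have hadm₀ : IsAdmissible (closedRegion s R) (openRegion s R) (solutionWeight σ μ) C y₀ := by
    refine ⟨fun l => (hconst (δ l)).mul hfam0, fun κ hκ x hx l => ?_⟩
    simp only [hy₀, norm_mul]
    have := hbound κ hκ x hx
    nlinarith [hδ1 l, norm_nonneg (f (κ * x)), norm_nonneg (δ l)]
  obtain ⟨y, hy, hyeq⟩ := hV.exists_solution hC hadm₀
  have h2C : 0 ≤ 2 * C := by positivity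
  set A := kernelIntegral b Q (psi e) y with hA
  set B := kernelIntegral b Q (phi g) y with hB
  -- The derivative read off from variation of constants: only φ and ψ outside the integrals are
  -- differentiated.
  set y' : ℂ → ℝ → Fin m → ℂ := fun κ x q => δ q * (κ * f' (κ * x)) +
    (2⁻¹ * g' q (κ * x) * A κ x q - κ * e' q (κ * x) * B κ x q) with hy'
  have iψ : ∀ κ ∈ closedRegion s R, ∀ q,
      IntegrableOn (fun t => psi e q κ t * (Q t).mulVec (y κ t) q) (Ioi 0) := fun κ hκ q =>
    hV.integrableOn_kernel (Or.inr rfl) h2C hy hκ q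
  have iφ : ∀ κ ∈ closedRegion s R, ∀ q,
      IntegrableOn (fun t => phi g q κ t * (Q t).mulVec (y κ t) q) (Ioi 0) := fun κ hκ q =>
    hV.integrableOn_kernel (Or.inl rfl) h2C hy hκ q
  have hfx : ∀ κ ∈ closedRegion s R, ∀ x : ℝ, 0 < x →
      HasDerivAt (fun x : ℝ => f (κ * x)) (κ * f' (κ * x)) x := fun κ hκ x hx =>
    hasDerivAt_comp_mul_ofReal (hf _ (h.mul_mem hκ hx))
  have hf'x : ∀ κ ∈ closedRegion s R, ∀ x : ℝ, 0 < x → HasDerivAt (fun x : ℝ => κ * f' (κ * x))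
      ((κ ^ 2 + ((ν j ^ 2 - 1 / 4 : ℝ) : ℂ) / x ^ 2) * f (κ * x)) x := by
    intro κ hκ x hx
    have h0 := h.ne_zero hκ
    have hx0 : (x : ℂ) ≠ 0 := by exact_mod_cast hx.ne'
    refine ((hasDerivAt_comp_mul_ofReal (hf' _ (h.mul_mem hκ hx))).const_mul κ).congr_deriv ?_
    field_simp
  have hder : ∀ κ ∈ closedRegion s R, ∀ x, 0 < x → ∀ q,
      HasDerivAt (fun x => y κ x q) (y' κ x q) x := by
    intro κ hκ x hx q
    have hvar := hasDerivAt_variation h.base_nonneg hx (fun t ht => h.hasDerivAt_phi hκ ht q)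
      (fun t ht => h.hasDerivAt_psi hκ ht q) (h.hasDerivAt_phi' hκ hx q).continuousAt
      (h.hasDerivAt_psi' hκ hx q).continuousAt (iφ κ hκ q) (iψ κ hκ q)
    refine (((hfx κ hκ x hx).const_mul (δ q)).add hvar).congr_of_eventuallyEq ?_
    filter_upwards [Ioi_mem_nhds hx] with t ht
    exact hyeq κ hκ t ht q
  have hac : ∀ κ ∈ closedRegion s R, ∀ c d, 0 < c → 0 < d → ∀ q,
      AbsolutelyContinuousOnInterval (fun x => y' κ x q) c d := by
    intro κ hκ c d hc hd q
    have hsub : uIcc c d ⊆ Ioi 0 := fun t ht => lt_of_lt_of_le (lt_min hc hd) ht.1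
    have hcoef : ∀ n : Fin m, ContinuousOn
        (fun x : ℝ => κ ^ 2 + ((ν n ^ 2 - 1 / 4 : ℝ) : ℂ) / (x : ℂ) ^ 2) (Ioi 0) := by
      intro n
      refine continuousOn_const.add (ContinuousOn.div continuousOn_const (by fun_prop) ?_)
      intro x hx
      have : x ≠ 0 := ne_of_gt hx
      simpa using this
    have h1 := absolutelyContinuousOnInterval_variation_deriv h.base_nonneg
      (fun t ht => h.hasDerivAt_phi' hκ ht q) (fun t ht => h.hasDerivAt_psi' hκ ht q)
      ((hcoef q).mul (hV.left_cont q κ hκ)) ((hcoef q).mul (hV.right_cont q κ hκ))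
      (iφ κ hκ q) (iψ κ hκ q) hc hd
    have h2 := absolutelyContinuousOnInterval_of_hasDerivAt
      (fun x hx => (hf'x κ hκ x (hsub hx)).const_mul (δ q))
      ((continuousOn_const.mul ((hcoef j).mul fun x hx =>
        (hfx κ hκ x hx).continuousAt.continuousWithinAt)).mono hsub)
    exact h2.add h1
  have hcont' : ∀ κ ∈ closedRegion s R, ∀ q, ContinuousOn (fun x => y' κ x q) (Ioi 0) := by
    intro κ hκ q x hx
    have hx' : (0 : ℝ) < x := hx
    have h1 := (hac κ hκ (x / 2) (2 * x) (by linarith) (by linarith) q).continuousOn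
    rw [uIcc_of_le (by linarith)] at h1
    exact (h1.continuousAt (Icc_mem_nhds (by linarith) (by linarith))).continuousWithinAt
  have hsol : ∀ κ ∈ closedRegion s R, IsSolution T ν Q (-κ ^ 2) (y κ) := by
    intro κ hκ
    refine isSolution_of_components (hder κ hκ) (hac κ hκ) fun q => ?_
    filter_upwards [ae_hasDerivAt_variation_deriv h.base_nonneg
      (fun t ht => h.hasDerivAt_phi' hκ ht q) (fun t ht => h.hasDerivAt_psi' hκ ht q)
      (iφ κ hκ q) (iψ κ hκ q)] with x hx hxT
    refine (((hf'x κ hκ x hxT.1).const_mul (δ q)).add (hx hxT.1)).congr_deriv ?_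
    rw [h.wronskian hκ hxT.1 q, hyeq κ hκ x hxT.1 q]
    -- The leading term solves the j-th scalar equation and lives in the j-th component only, so it
    -- solves the diagonal system.
    have hδν : δ q * ((ν j ^ 2 - 1 / 4 : ℝ) : ℂ) = δ q * ((ν q ^ 2 - 1 / 4 : ℝ) : ℂ) := by
      by_cases hqj : q = j
      · rw [hqj]
      · simp [hδ, Matrix.one_apply, hqj]
    simp only [hy₀, volterraOp]
    simp only [kernelIntegral]
    linear_combination (f (κ * x) / (x : ℂ) ^ 2) * hδν
  have hfamy' : ∀ q,
      IsHolomorphicFamily (closedRegion s R) (openRegion s R) fun κ x => y' κ x q := by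
    intro q
    have hAq := hV.isHolomorphicFamily_kernelIntegral (Or.inr rfl) h2C hy q
    have hBq := hV.isHolomorphicFamily_kernelIntegral (Or.inl rfl) h2C hy q
    have f1 := (hconst (δ q)).mul (hid.mul (h.isHolomorphicFamily_comp hf'))
    have f2 := (((hconst 2⁻¹).mul (h.isHolomorphicFamily_comp (h.pair q).hasDerivAt_g')).mul hAq).sub
      ((hid.mul (h.isHolomorphicFamily_comp (h.pair q).hasDerivAt_e')).mul hBq)
    exact f1.add f2
  set I := ∫ t in Ioi 0, potentialMajorant μ Q t with hI
  have hI0 : 0 ≤ I := by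
    refine setIntegral_nonneg measurableSet_Ioi fun t ht => ?_
    exact mul_nonneg (Real.rpow_nonneg (le_of_lt ht) _)
      (Finset.sum_nonneg fun i _ => Finset.sum_nonneg fun j _ => norm_nonneg _)
  -- Here 2C is the weighted bound of y. The factor 1 + C comes from the asymptotics of e' and g'
  -- and is also used, generously, for e and g. The bounds below leave a spare factor 2.
  set K₀ := 2 * (2 * C) * (1 + C) * C * max 1 T ^ |1 - 2 * μ| * I with hK₀
  have hK₀0 : 0 ≤ K₀ := by positivity
  have hnexp : ∀ (κ : ℂ) (x : ℝ), ‖Complex.exp (-(σ * κ * x))‖ * Real.exp (σ * (κ.re * x)) = 1 := by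
    intro κ x
    rw [Complex.norm_exp, ← Real.exp_add]
    simp
    ring
  have hlead : ∀ {κ : ℂ} {x : ℝ} {P S : ℂ} {c d : ℝ}, 0 ≤ c → ‖Complex.exp (-(σ * κ * x)) * S‖ ≤ c →
      ‖P‖ ≤ d → ‖P + Complex.exp (-(σ * κ * x)) * S‖ ≤ d + c := fun _ h1 h2 =>
    (norm_add_le _ _).trans (add_le_add h2 h1)
  refine ⟨K₀ + C, by positivity, y, y', hder, hcont', hsol, hy.family, hfamy', ?_, ?_⟩
  · intro κ hκ x hx hκx q
    have hκ0 : 0 < ‖κ‖ := by linarith [h.one_le_norm hκ]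
    have hnz : ‖κ * x‖ = ‖κ‖ * x := by rw [norm_mul, Complex.norm_real, Real.norm_of_nonneg hx.le]
    have hm1 : min 1 (‖κ‖ * x) ^ (1 / 2 - μ) = 1 := by rw [min_eq_left hκx, Real.one_rpow]
    have n1 : ‖phi g q κ x‖ ≤ (1 + C) / (2 * ‖κ‖) * Real.exp (κ.re * x) := by
      refine (h.norm_phi_le hκ hx q).trans ?_
      rw [hm1, mul_one]
      gcongr
      linarith
    have n2 : ‖psi e q κ x‖ ≤
        2 * ‖κ‖ * ((1 + C) / (2 * ‖κ‖)) * Real.exp (-(κ.re * x)) := by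
      refine (h.norm_e_le hκ hx q).trans ?_
      rw [hm1, mul_one, mul_div_cancel₀ _ (by positivity)]
      gcongr
      linarith
    have n3 := h.norm_combination_le h2C hy hκ hx q (by positivity) n1 n2
    rw [← hI] at n3
    have n4 : ‖Complex.exp (-(σ * κ * x)) * volterraOp b Q (phi g) (psi e) y κ x q‖ ≤
        K₀ * ‖κ‖ ^ (-min 1 (2 * μ)) := by
      rw [norm_mul]
      refine (mul_le_mul_of_nonneg_left n3 (norm_nonneg _)).trans ?_
      rw [sub_eq_add_neg 1 (min 1 (2 * μ)), Real.rpow_add hκ0, Real.rpow_one]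
      calc _ = (‖Complex.exp (-(σ * κ * x))‖ * Real.exp (σ * (κ.re * x))) *
            (K₀ / 2 * ‖κ‖ ^ (-min 1 (2 * μ))) := by
            rw [hK₀]
            field_simp
        _ ≤ _ := by
            rw [hnexp, one_mul]
            gcongr
            linarith
    have n5 : ‖δ q * (Complex.exp (-(σ * (κ * x))) * f (κ * x) - 1)‖ ≤ C * (‖κ‖ * x)⁻¹ := by
      rw [norm_mul]
      have h1 := hasymp _ (h.mul_mem hκ hx) (by rwa [hnz])
      rw [hnz, div_eq_mul_inv] at h1
      exact (mul_le_of_le_one_left (norm_nonneg _) (hδ1 q)).trans h1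
    have e1 : Complex.exp (-(σ * κ * x)) * y κ x q - δ q =
        δ q * (Complex.exp (-(σ * (κ * x))) * f (κ * x) - 1) +
          Complex.exp (-(σ * κ * x)) * volterraOp b Q (phi g) (psi e) y κ x q := by
      rw [hyeq κ hκ x hx q, mul_assoc (σ : ℂ)]
      simp only [hy₀]
      ring
    rw [e1]
    refine (hlead (by positivity) n4 n5).trans ?_
    have p1 : 0 ≤ ‖κ‖ ^ (-min 1 (2 * μ)) := by positivity
    have p2 : 0 ≤ (‖κ‖ * x)⁻¹ := by positivity
    nlinarith
  · intro κ hκ x hx hκx q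
    have hκ0 : 0 < ‖κ‖ := by linarith [h.one_le_norm hκ]
    have hκne := h.ne_zero hκ
    have hnz : ‖κ * x‖ = ‖κ‖ * x := by rw [norm_mul, Complex.norm_real, Real.norm_of_nonneg hx.le]
    have hz := h.mul_mem hκ hx
    have hC1 : C / ‖κ * x‖ ≤ C := div_le_self hC (by rwa [hnz])
    have aux : ∀ {z w : ℂ} {a : ℂ}, ‖a‖ = 1 → ‖Complex.exp z * w - a‖ ≤ C →
        ‖w‖ ≤ (1 + C) * Real.exp (-z.re) := by
      intro z w a ha hw
      have h1 : ‖Complex.exp z * w‖ ≤ 1 + C := by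
        have := norm_le_norm_add_norm_sub' (Complex.exp z * w) a
        linarith
      rw [norm_mul, Complex.norm_exp] at h1
      calc ‖w‖ = (Real.exp z.re * ‖w‖) * Real.exp (-z.re) := by
            rw [mul_right_comm, ← Real.exp_add]; simp
        _ ≤ _ := by gcongr
    have n1 : ‖2⁻¹ * g' q (κ * x)‖ ≤ (1 + C) / 2 * Real.exp (κ.re * x) := by
      have h1 := aux norm_one (((h.pair q).asymp_g' _ hz (by rwa [hnz])).trans hC1)
      rw [Complex.neg_re, neg_neg, Complex.re_mul_ofReal] at h1
      rw [norm_mul, norm_inv, Complex.norm_ofNat]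
      linarith
    have n2 : ‖κ * e' q (κ * x)‖ ≤ 2 * ‖κ‖ * ((1 + C) / 2) * Real.exp (-(κ.re * x)) := by
      have h1 := aux (a := -1) (by simp) ((sub_neg_eq_add (Complex.exp (κ * x) * e' q (κ * x)) 1 ▸
        (h.pair q).asymp_e' _ hz (by rwa [hnz])).trans hC1)
      rw [Complex.re_mul_ofReal] at h1
      rw [norm_mul]
      nlinarith
    have n3 := h.norm_combination_le h2C hy hκ hx q (by positivity) n1 n2
    rw [← hI] at n3
    set V := 2⁻¹ * g' q (κ * x) * A κ x q - κ * e' q (κ * x) * B κ x q with hV'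
    have n4 : ‖Complex.exp (-(σ * κ * x)) * ((σ * κ)⁻¹ * V)‖ ≤ K₀ * ‖κ‖ ^ (-min 1 (2 * μ)) := by
      rw [norm_mul, norm_mul, norm_inv, norm_mul, hσn, one_mul]
      refine (mul_le_mul_of_nonneg_left (mul_le_mul_of_nonneg_left n3 (by positivity))
        (norm_nonneg _)).trans ?_
      calc _ = (‖Complex.exp (-(σ * κ * x))‖ * Real.exp (σ * (κ.re * x))) *
            (K₀ / 2 * ‖κ‖ ^ (-min 1 (2 * μ))) := by
            rw [sub_eq_add_neg 1 (min 1 (2 * μ)), Real.rpow_add hκ0, Real.rpow_one, hK₀]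
            field_simp
        _ ≤ _ := by
            rw [hnexp, one_mul]
            gcongr
            linarith
    have n5 : ‖δ q * (σ * (Complex.exp (-(σ * (κ * x))) * f' (κ * x) - σ))‖ ≤
        C * (‖κ‖ * x)⁻¹ := by
      rw [norm_mul, norm_mul, hσn, one_mul]
      have h1 := hasymp' _ hz (by rwa [hnz])
      rw [hnz, div_eq_mul_inv] at h1
      exact (mul_le_of_le_one_left (norm_nonneg _) (hδ1 q)).trans h1
    have e1 : (σ * κ)⁻¹ * Complex.exp (-(σ * κ * x)) * y' κ x q - δ q =
        δ q * (σ * (Complex.exp (-(σ * (κ * x))) * f' (κ * x) - σ)) +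
          Complex.exp (-(σ * κ * x)) * ((σ * κ)⁻¹ * V) := by
      have hinv : (σ * κ : ℂ)⁻¹ * κ = σ := by
        field_simp
        linear_combination -hσ2
      have e2 : y' κ x q = δ q * (κ * f' (κ * x)) + V := rfl
      rw [e2, ← mul_assoc (σ : ℂ) κ]
      linear_combination (δ q * Complex.exp (-(σ * κ * x)) * f' (κ * x)) * hinv + δ q * hσ2
    rw [e1]
    refine (hlead (by positivity) n4 n5).trans ?_
    have p1 : 0 ≤ ‖κ‖ ^ (-min 1 (2 * μ)) := by positivity
    have p2 : 0 ≤ (‖κ‖ * x)⁻¹ := by positivity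
    nlinarith

end IsPerturbation

/-! ### Exponential columns for the given potential -/

lemma IsSolution.congr_potential {m : ℕ} {T : ℝ} {ν : Fin m → ℝ}
    {Q Q' : ℝ → Matrix (Fin m) (Fin m) ℂ} {lam : ℂ} {y : ℝ → Fin m → ℂ}
    (hy : IsSolution T ν Q lam y) (hQ : ∀ x ∈ Ioo 0 T, Q x = Q' x) : IsSolution T ν Q' lam y where
  differentiableAt := hy.differentiableAt
  absolutelyContinuous := hy.absolutelyContinuous
  equation := by
    filter_upwards [hy.equation] with x hx hxT
    rw [← hQ x hxT]
    exact hx hxT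

lemma aestronglyMeasurable_of_rpow_mul {T p : ℝ} {f : ℝ → ℂ}
    (hf : IntegrableOn (fun x : ℝ => ((x ^ p : ℝ) : ℂ) * f x) (Ioo 0 T)) :
    AEStronglyMeasurable f (volume.restrict (Ioo 0 T)) := by
  have h1 : AEStronglyMeasurable (fun x : ℝ => ((x ^ (-p) : ℝ) : ℂ))
      (volume.restrict (Ioo 0 T)) := by
    refine ContinuousOn.aestronglyMeasurable ?_ measurableSet_Ioo
    refine Complex.continuous_ofReal.comp_continuousOn fun x hx => ?_
    exact (Real.continuousAt_rpow_const _ _ (Or.inl hx.1.ne')).continuousWithinAt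
  refine (h1.mul hf.aestronglyMeasurable).congr ?_
  refine (ae_restrict_iff' measurableSet_Ioo).2 (Eventually.of_forall fun x hx => ?_)
  have : x ^ (-p) * x ^ p = 1 := by rw [← Real.rpow_add hx.1]; simp
  simp only [Pi.mul_apply]
  rw [← mul_assoc, ← Complex.ofReal_mul, this, Complex.ofReal_one, one_mul]

lemma intervalIntegrable_of_rpow_mul {T p : ℝ} {f : ℝ → ℂ}
    (hf : IntegrableOn (fun x : ℝ => ((x ^ p : ℝ) : ℂ) * f x) (Ioo 0 T)) {a b : ℝ}
    (ha : a ∈ Ioo 0 T) (hb : b ∈ Ioo 0 T) : IntervalIntegrable f volume a b := by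
  have hsub := IsCaratheodorySolution.uIcc_subset_Ioo ha hb
  have h1 : IntervalIntegrable (fun x : ℝ => ((x ^ p : ℝ) : ℂ) * f x) volume a b :=
    intervalIntegrable_iff.2 (hf.mono_set (uIoc_subset_uIcc.trans hsub))
  have hc : ContinuousOn (fun x : ℝ => ((x ^ (-p) : ℝ) : ℂ)) (uIcc a b) := by
    refine Complex.continuous_ofReal.comp_continuousOn fun x hx => ?_
    exact (Real.continuousAt_rpow_const _ _ (Or.inl (hsub hx).1.ne')).continuousWithinAt
  refine (h1.continuousOn_mul hc).congr fun x hx => ?_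
  have hx0 := (hsub (uIoc_subset_uIcc hx)).1
  have : x ^ (-p) * x ^ p = 1 := by rw [← Real.rpow_add hx0]; simp
  rw [← mul_assoc, ← Complex.ofReal_mul, this, Complex.ofReal_one, one_mul]

/-- The leading term is g_j with base point 0 for σ = 1, and e_j with base point T for σ = -1. As ν₁
is the largest order, the weight with μ = ν₁ dominates all components. -/
theorem exists_isExponentialColumn {m : ℕ} (hm : 0 < m) {T : ℝ} (hT : 0 < T) {ν : Fin m → ℝ}
    (hν_anti : Antitone ν) (hν_pos : ∀ q, 0 < ν q) {Q : ℝ → Matrix (Fin m) (Fin m) ℂ}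
    (hQ : ∀ i j, IntegrableOn
      (fun x : ℝ => ((x ^ (1 - 2 * ν ⟨0, hm⟩) : ℝ) : ℂ) * Q x i j) (Ioo 0 T))
    {s σ : ℝ} (hs : s = 1 ∨ s = -1) (hσ : σ = 1 ∨ σ = -1) :
    ∃ R : ℝ, 1 ≤ R ∧ ∃ C : ℝ, 0 ≤ C ∧ ∃ y y' : Fin m → ℂ → ℝ → Fin m → ℂ,
      ∀ j, IsExponentialColumn T ν Q s σ (min 1 (2 * ν ⟨0, hm⟩)) R C j (y j) (y' j) := by
  classical
  set μ := ν ⟨0, hm⟩ with hμ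
  have hμ0 : 0 < μ := hν_pos _
  choose C₀ hC₀ e e' g g' hpair₀ using fun q => exists_isBesselPair (hν_pos q) hs
  set C := ∑ q, C₀ q with hC
  have hCnn : 0 ≤ C := Finset.sum_nonneg fun q _ => hC₀ q
  have hpair : ∀ q, IsBesselPair (ν q) s C (e q) (e' q) (g q) (g' q) := fun q =>
    (hpair₀ q).mono (Finset.single_le_sum (fun q _ => hC₀ q) (Finset.mem_univ q))
  -- Extension by zero lets the integral equation be solved for all x > 0, so the endpoint T becomes
  -- an interior point.
  set Q' : ℝ → Matrix (Fin m) (Fin m) ℂ := (Ioo 0 T).indicator Q with hQ'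
  have hQ'in : ∀ t ∈ Ioo 0 T, Q' t = Q t := fun t ht => indicator_of_mem ht Q
  have hQ'out : ∀ t, t ∉ Ioo 0 T → Q' t = 0 := fun t ht => indicator_of_notMem ht Q
  have hentry : ∀ i j, (fun t => Q' t i j) = (Ioo 0 T).indicator fun t => Q t i j := by
    intro i j
    ext t
    by_cases ht : t ∈ Ioo 0 T
    · rw [hQ'in t ht, indicator_of_mem ht]
    · rw [hQ'out t ht, indicator_of_notMem ht]
      rfl
  have hmeas : ∀ i j, AEStronglyMeasurable (fun t => Q' t i j) (volume.restrict (Ioi 0)) := by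
    intro i j
    rw [hentry]
    exact ((aestronglyMeasurable_indicator_iff measurableSet_Ioo).2
      (aestronglyMeasurable_of_rpow_mul (hQ i j))).restrict
  have hInt : IntegrableOn (potentialMajorant μ Q') (Ioi 0) := by
    have h1 : Integrable (fun t => ∑ i, ∑ j, (Ioo 0 T).indicator
        (fun x : ℝ => ‖((x ^ (1 - 2 * μ) : ℝ) : ℂ) * Q x i j‖) t) :=
      integrable_finsetSum _ fun i _ => integrable_finsetSum _ fun j _ =>
        (integrable_indicator_iff measurableSet_Ioo).2 (hQ i j).norm
    refine h1.integrableOn.congr_fun (fun t ht => ?_) measurableSet_Ioi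
    have ht0 : (0 : ℝ) < t := ht
    simp only [potentialMajorant]
    by_cases htT : t ∈ Ioo 0 T
    · simp only [indicator_of_mem htT, hQ'in t htT, norm_mul, Complex.norm_real, Finset.mul_sum,
        Real.norm_of_nonneg (Real.rpow_nonneg ht0.le (1 - 2 * μ))]
    · simp [indicator_of_notMem htT, hQ'out t htT]
  have hβ : 0 < min 1 (2 * μ) := lt_min one_pos (by positivity)
  -- Possible because R^{-β} → 0, as β > 0.
  obtain ⟨R, hR1, hRsmall⟩ : ∃ R : ℝ, 1 ≤ R ∧ C ^ 2 * max 1 T ^ |1 - 2 * μ| *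
      R ^ (-min 1 (2 * μ)) * ∫ t in Ioi 0, potentialMajorant μ Q' t ≤ 1 / 2 := by
    have h1 : Tendsto (fun R : ℝ => C ^ 2 * max 1 T ^ |1 - 2 * μ| * R ^ (-min 1 (2 * μ)) *
        ∫ t in Ioi 0, potentialMajorant μ Q' t) atTop (𝓝 0) := by
      simpa using ((tendsto_rpow_neg_atTop hβ).const_mul (C ^ 2 * max 1 T ^ |1 - 2 * μ|)).mul_const
        (∫ t in Ioi 0, potentialMajorant μ Q' t)
    obtain ⟨R, h2, h3⟩ := ((eventually_ge_atTop 1).and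
      (h1.eventually_le_const (by norm_num : (0 : ℝ) < 1 / 2))).exists
    exact ⟨R, h2, h3⟩
  have hle : ∀ q, ν q ≤ μ := fun q => hν_anti (Fin.mk_le_of_le_val (Nat.zero_le _))
  have hcols : ∀ j : Fin m, ∃ K : ℝ, 0 ≤ K ∧ ∃ y y' : ℂ → ℝ → Fin m → ℂ,
      IsExponentialColumn T ν Q' s σ (min 1 (2 * μ)) R K j y y' := by
    intro j
    rcases hσ with rfl | rfl
    · have hp : IsPerturbation T μ s 1 0 C R ν Q' e e' g g' :=
        ⟨hpair, hCnn, hle, hμ0, hT, Or.inl ⟨rfl, rfl⟩, hmeas, hQ'out, hInt, hR1, hRsmall⟩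
      refine hp.exists_column j (hpair j).hasDerivAt_g (hpair j).hasDerivAt_g' ?_ ?_ ?_
      · intro κ hκ x hx
        refine (hp.norm_g_le hκ hx j).trans (le_of_eq ?_)
        rw [solutionWeight, one_mul, mul_assoc]
      · simpa using (hpair j).asymp_g
      · simpa using (hpair j).asymp_g'
    · have hp : IsPerturbation T μ s (-1) T C R ν Q' e e' g g' :=
        ⟨hpair, hCnn, hle, hμ0, hT, Or.inr ⟨rfl, rfl⟩, hmeas, hQ'out, hInt, hR1, hRsmall⟩
      refine hp.exists_column j (hpair j).hasDerivAt_e (hpair j).hasDerivAt_e' ?_ ?_ ?_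
      · intro κ hκ x hx
        refine (hp.norm_e_le hκ hx j).trans (le_of_eq ?_)
        rw [solutionWeight, neg_one_mul, mul_assoc]
      · simpa using (hpair j).asymp_e
      · simpa using (hpair j).asymp_e'
  choose K hK y y' hy using hcols
  have hKle : ∀ j, K j ≤ ∑ j, K j := fun j =>
    Finset.single_le_sum (fun j _ => hK j) (Finset.mem_univ j)
  refine ⟨R, hR1, ∑ j, K j, Finset.sum_nonneg fun j _ => hK j, y, y', fun j =>
    { hy j with
      isSolution := fun κ hκ => ((hy j).isSolution κ hκ).congr_potential hQ'in
      asymp := fun κ hκ x hx hκx q => ((hy j).asymp κ hκ x hx hκx q).trans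
        (mul_le_mul_of_nonneg_right (hKle j) (by positivity))
      asymp_deriv := fun κ hκ x hx hκx q => ((hy j).asymp_deriv κ hκ x hx hκx q).trans
        (mul_le_mul_of_nonneg_right (hKle j) (by positivity)) }⟩

/-! ### Passage to the spectral parameter `ρ` -/

lemma norm_sum_mul_le_of_le {ι : Type*} [Fintype ι] {a d : ι → ℂ} {ε : ℝ}
    (hd : ∀ j, ‖d j‖ ≤ ε) : ‖∑ j, a j * d j‖ ≤ ε * ∑ j, ‖a j‖ := by
  refine (norm_sum_le _ _).trans ?_
  rw [Finset.mul_sum]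
  refine Finset.sum_le_sum fun j _ => ?_
  rw [norm_mul, mul_comm ε]
  exact mul_le_mul_of_nonneg_left (hd j) (norm_nonneg _)

/-- Vectors close to those of the exponential system `(E, μE)`, `(E⁻¹, -μE⁻¹)` are linearly
independent. -/
lemma eq_zero_of_near_exponential {m : ℕ} {ε : ℝ} (hε : 4 * m * ε ≤ 1) {E μ : ℂ} (hE : E ≠ 0)
    (hμ : μ ≠ 0) {u₁ u₁' u₂ u₂' : Fin m → Fin m → ℂ}
    (h₁ : ∀ j q, ‖E⁻¹ * u₁ j q - (1 : Matrix (Fin m) (Fin m) ℂ) q j‖ ≤ ε)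
    (h₁' : ∀ j q, ‖μ⁻¹ * E⁻¹ * u₁' j q - (1 : Matrix (Fin m) (Fin m) ℂ) q j‖ ≤ ε)
    (h₂ : ∀ j q, ‖E * u₂ j q - (1 : Matrix (Fin m) (Fin m) ℂ) q j‖ ≤ ε)
    (h₂' : ∀ j q, ‖(-μ)⁻¹ * E * u₂' j q - (1 : Matrix (Fin m) (Fin m) ℂ) q j‖ ≤ ε)
    {c₁ c₂ : Fin m → ℂ} (h0 : ∀ q, ∑ j, c₁ j * u₁ j q + ∑ j, c₂ j * u₂ j q = 0)
    (h0' : ∀ q, ∑ j, c₁ j * u₁' j q + ∑ j, c₂ j * u₂' j q = 0) :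
    ∀ j, c₁ j = 0 ∧ c₂ j = 0 := by
  -- Rescaling the coefficients removes the exponentials, so the system is within ε of the constant
  -- one with rows (I, I) and (I, -I).
  set a : Fin m → ℂ := fun j => c₁ j * E with ha
  set b : Fin m → ℂ := fun j => c₂ j * E⁻¹ with hb
  have split : ∀ (c w : Fin m → ℂ) (q : Fin m), ∑ j, c j * w j =
      c q + ∑ j, c j * (w j - (1 : Matrix (Fin m) (Fin m) ℂ) q j) := by
    intro c w q
    simp only [mul_sub, Finset.sum_sub_distrib, Matrix.one_apply, mul_ite, mul_one, mul_zero,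
      Finset.sum_ite_eq, Finset.mem_univ, if_true]
    ring
  have e0 : ∀ q, ∑ j, a j * (E⁻¹ * u₁ j q) + ∑ j, b j * (E * u₂ j q) = 0 := by
    intro q
    rw [← h0 q]
    congr 1 <;> refine Finset.sum_congr rfl fun j _ => ?_ <;> simp only [ha, hb] <;> field_simp
  have e0' : ∀ q, ∑ j, a j * (μ⁻¹ * E⁻¹ * u₁' j q) - ∑ j, b j * ((-μ)⁻¹ * E * u₂' j q) = 0 := by
    intro q
    have h := congrArg (μ⁻¹ * ·) (h0' q)
    simp only [mul_zero, mul_add, Finset.mul_sum] at h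
    rw [← h, sub_eq_add_neg, ← Finset.sum_neg_distrib]
    congr 1 <;> refine Finset.sum_congr rfl fun j _ => ?_ <;> simp only [ha, hb] <;> field_simp
  set S := ∑ j, ‖a j‖ + ∑ j, ‖b j‖ with hS
  -- Sum and difference of the two relations isolate 2a_q and 2b_q up to the errors, which total at
  -- most 2εS.
  have bound : ∀ q, ‖a q‖ ≤ ε * S ∧ ‖b q‖ ≤ ε * S := by
    intro q
    have k1 := e0 q
    have k2 := e0' q
    rw [split a _ q, split b _ q] at k1 k2
    have n1 := norm_sum_mul_le_of_le (a := a) fun j => h₁ j q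
    have n2 := norm_sum_mul_le_of_le (a := a) fun j => h₁' j q
    have n3 := norm_sum_mul_le_of_le (a := b) fun j => h₂ j q
    have n4 := norm_sum_mul_le_of_le (a := b) fun j => h₂' j q
    set A := ∑ j, a j * (E⁻¹ * u₁ j q - (1 : Matrix (Fin m) (Fin m) ℂ) q j)
    set A' := ∑ j, a j * (μ⁻¹ * E⁻¹ * u₁' j q - (1 : Matrix (Fin m) (Fin m) ℂ) q j)
    set B := ∑ j, b j * (E * u₂ j q - (1 : Matrix (Fin m) (Fin m) ℂ) q j)
    set B' := ∑ j, b j * ((-μ)⁻¹ * E * u₂' j q - (1 : Matrix (Fin m) (Fin m) ℂ) q j)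
    have t1 : 2 * ‖a q‖ ≤ ‖A‖ + ‖A'‖ + ‖B‖ + ‖B'‖ := by
      have : 2 * a q = -(A + A' + B - B') := by linear_combination k1 + k2
      rw [← Complex.norm_ofNat 2, ← norm_mul, this, norm_neg]
      exact (norm_sub_le _ _).trans (by gcongr; exact norm_add₃_le)
    have t2 : 2 * ‖b q‖ ≤ ‖A‖ + ‖A'‖ + ‖B‖ + ‖B'‖ := by
      have : 2 * b q = -(A - A' + B + B') := by linear_combination k1 - k2
      rw [← Complex.norm_ofNat 2, ← norm_mul, this, norm_neg]
      exact norm_add₃_le.trans (by gcongr; exact norm_sub_le _ _)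
    rw [hS]
    constructor <;> linarith
  have hS0 : 0 ≤ S := by positivity
  have hSle : S ≤ m * (ε * S) + m * (ε * S) := by
    refine add_le_add ?_ ?_
    · simpa using Finset.sum_le_card_nsmul Finset.univ _ _ fun q _ => (bound q).1
    · simpa using Finset.sum_le_card_nsmul Finset.univ _ _ fun q _ => (bound q).2
  -- Summation over q gives S ≤ 2mεS ≤ S/2.
  have hSz : S = 0 := by nlinarith
  intro j
  have hj := bound j
  rw [hSz, mul_zero, norm_le_zero_iff, norm_le_zero_iff] at hj
  simpa [ha, hb, hE] using hj

lemma norm_sign_mul_I_mul {s : ℝ} (hs : s = 1 ∨ s = -1) (ρ : ℂ) : ‖s * Complex.I * ρ‖ = ‖ρ‖ := by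
  rcases hs with rfl | rfl <;> simp

lemma neg_sq_sign_mul_I_mul {s : ℝ} (hs : s = 1 ∨ s = -1) (ρ : ℂ) :
    -(s * Complex.I * ρ) ^ 2 = ρ ^ 2 := by
  rcases hs with rfl | rfl <;> simp [mul_pow]

/-- Multiplication by `s i` maps the sector to a quadrant of the right half-plane, where `s = -1`
for the sector in the first quadrant and `s = 1` for the one in the fourth. -/
lemma mul_mem_openRegion_of_mem_sector {k : ℤ} {s : ℝ} (hk : k = 0 ∧ s = -1 ∨ k = -1 ∧ s = 1)
    {R ρs : ℝ} (hR : R ≤ ρs) (hρs : 0 < ρs) {ρ : ℂ} (hρ : ρ ∈ sector k ρs) :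
    s * Complex.I * ρ ∈ openRegion s R := by
  obtain ⟨⟨h1, h2⟩, h3⟩ := hρ
  have hn : 0 < ‖ρ‖ := hρs.trans h3
  have hnorm := norm_sign_mul_I_mul (s := s) (by tauto) ρ
  have hpi := Real.pi_pos
  refine ⟨?_, ?_, by rw [hnorm]; linarith⟩
  · rcases hk with ⟨rfl, rfl⟩ | ⟨rfl, rfl⟩
    · have : 0 < ρ.im := by
        rw [← Complex.norm_mul_sin_arg]
        refine mul_pos hn (Real.sin_pos_of_pos_of_lt_pi ?_ ?_) <;> push_cast at h1 h2 <;> linarith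
      simpa using this
    · have : ρ.im < 0 := by
        rw [← Complex.norm_mul_sin_arg]
        refine mul_neg_of_pos_of_neg hn (Real.sin_neg_of_neg_of_neg_pi_lt ?_ ?_) <;>
          push_cast at h1 h2 <;> linarith
      simpa using this
  · have : 0 < ρ.re := by
      rw [← Complex.norm_mul_cos_arg]
      refine mul_pos hn (Real.cos_pos_of_mem_Ioo ⟨?_, ?_⟩) <;>
        rcases hk with ⟨rfl, rfl⟩ | ⟨rfl, rfl⟩ <;> push_cast at h1 h2 <;> linarith
    rcases hk with ⟨rfl, rfl⟩ | ⟨rfl, rfl⟩ <;> simpa using this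

lemma isClosed_closedRegion (s R : ℝ) : IsClosed (closedRegion s R) :=
  (isClosed_le continuous_const Complex.continuous_re).inter
    ((isClosed_le continuous_const (continuous_const.mul Complex.continuous_im)).inter
      (isClosed_le continuous_const continuous_norm))

/-- The preimage of the closed region is closed, so no explicit description of the closure of the
sector is needed. -/
lemma mul_mem_closedRegion_of_mem_closure {Ω : Set ℂ} {s R : ℝ}
    (hΩ : ∀ ρ ∈ Ω, s * Complex.I * ρ ∈ openRegion s R) {ρ : ℂ} (hρ : ρ ∈ closure Ω) :
    s * Complex.I * ρ ∈ closedRegion s R := by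
  have hc : IsClosed ((fun ρ : ℂ => s * Complex.I * ρ) ⁻¹' closedRegion s R) :=
    (isClosed_closedRegion s R).preimage (by fun_prop)
  exact closure_minimal (fun ρ h => openRegion_subset_closedRegion s R (hΩ ρ h) :
    Ω ⊆ (fun ρ : ℂ => s * Complex.I * ρ) ⁻¹' closedRegion s R) hc hρ

/-- The matrix with columns `y_j(s i ρ, x)`. -/
def columnMatrix {m : ℕ} (s : ℝ) (y : Fin m → ℂ → ℝ → Fin m → ℂ) (x : ℝ) (ρ : ℂ) :
    Matrix (Fin m) (Fin m) ℂ :=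
  Matrix.of fun i j => y j (s * Complex.I * ρ) x i

section ExponentialColumns

variable {m : ℕ} {T : ℝ} {ν : Fin m → ℝ} {Q : ℝ → Matrix (Fin m) (Fin m) ℂ} {s σ β R C : ℝ}
  {y y' : Fin m → ℂ → ℝ → Fin m → ℂ}

lemma xDeriv_zero (Y : ℝ → ℂ → Matrix (Fin m) (Fin m) ℂ) (x : ℝ) (ρ : ℂ) :
    xDeriv T 0 Y x ρ = Y x ρ := by
  ext i j
  simp [xDeriv]

/-- The columns are differentiable on all of (0, ∞), so at x = T the one-sided derivative is the
ordinary one. -/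
lemma xDeriv_one_columnMatrix
    (h : ∀ j, IsExponentialColumn T ν Q s σ β R C j (y j) (y' j)) {ρ : ℂ}
    (hρ : s * Complex.I * ρ ∈ closedRegion s R) {x : ℝ} (hx : x ∈ Ioc 0 T) :
    xDeriv T 1 (columnMatrix s y) x ρ = columnMatrix s y' x ρ := by
  ext i j
  simp only [xDeriv, columnMatrix, Matrix.of_apply, iteratedDerivWithin_one]
  exact ((h j).hasDerivAt _ hρ x hx.1 i).hasDerivWithinAt.derivWithin (uniqueDiffOn_Ioc 0 T x hx)

lemma isBirkhoffRegular_columnMatrix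
    (h : ∀ j, IsExponentialColumn T ν Q s σ β R C j (y j) (y' j)) {Ω : Set ℂ}
    (hΩ : ∀ ρ ∈ Ω, s * Complex.I * ρ ∈ openRegion s R) :
    IsBirkhoffRegular T Ω (columnMatrix s y) := by
  have hcl := fun ρ hρ => mul_mem_closedRegion_of_mem_closure hΩ (ρ := ρ) hρ
  -- Analyticity is proved on this open set containing Ω, since Ω itself is not assumed to be open.
  set P := (fun ρ : ℂ => s * Complex.I * ρ) ⁻¹' openRegion s R with hP
  have hPo : IsOpen P := (isOpen_openRegion s R).preimage (by fun_prop)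
  have han : ∀ {χ : ℂ → ℝ → ℂ}, IsHolomorphicFamily (closedRegion s R) (openRegion s R) χ →
      ∀ x, 0 < x → AnalyticOnNhd ℂ (fun ρ => χ (s * Complex.I * ρ) x) P := by
    intro χ hχ x hx
    refine DifferentiableOn.analyticOnNhd ?_ hPo
    exact (hχ.differentiableOn x hx).comp (f := fun ρ : ℂ => s * Complex.I * ρ) (by fun_prop)
      fun ρ hρ => hρ
  have hcont : ∀ {χ : ℂ → ℝ → ℂ}, IsHolomorphicFamily (closedRegion s R) (openRegion s R) χ →
      ∀ x, 0 < x → ContinuousOn (fun ρ => χ (s * Complex.I * ρ) x) (closure Ω) := fun hχ x hx =>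
    (hχ.continuousOn x hx).comp (f := fun ρ : ℂ => s * Complex.I * ρ) (by fun_prop) hcl
  refine ⟨fun ρ hρ i j => ?_, fun x hx n hn i j => ?_, fun x hx n hn i j => ?_⟩
  · have hd := fun x hx => (h j).hasDerivAt _ (hcl ρ hρ) x hx i
    rw [show (1 : WithTop ℕ∞) = 0 + 1 from rfl]
    refine ContDiffOn.mono (t := Ioc 0 T) (s := Ioi 0) ?_ Ioc_subset_Ioi_self
    refine (contDiffOn_succ_iff_deriv_of_isOpen isOpen_Ioi).2
      ⟨fun x hx => (hd x hx).differentiableAt.differentiableWithinAt, by simp, ?_⟩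
    rw [contDiffOn_zero]
    exact ((h j).continuousOn_deriv _ (hcl ρ hρ) i).congr fun x hx => (hd x hx).deriv
  · interval_cases n
    · simp only [xDeriv_zero]
      exact (han ((h j).family i) x hx.1).mono hΩ
    · refine ((han ((h j).family_deriv i) x hx.1).congr hPo fun ρ hρ => ?_).mono hΩ
      rw [xDeriv_one_columnMatrix h (openRegion_subset_closedRegion s R hρ) ⟨hx.1, hx.2.le⟩]
      rfl
  · interval_cases n
    · simp only [xDeriv_zero]
      exact hcont ((h j).family i) x hx.1
    · refine (hcont ((h j).family_deriv i) x hx.1).congr fun ρ hρ => ?_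
      rw [xDeriv_one_columnMatrix h (hcl ρ hρ) ⟨hx.1, hx.2.le⟩]
      rfl

lemma hasBirkhoffAsymptotics_columnMatrix
    (h : ∀ j, IsExponentialColumn T ν Q s σ β R C j (y j) (y' j)) (hs : s = 1 ∨ s = -1)
    (hR : 1 ≤ R) (hC : 0 ≤ C) (hβ : β ≤ 1) {Ω : Set ℂ}
    (hΩ : ∀ ρ ∈ Ω, s * Complex.I * ρ ∈ openRegion s R) {τ : ℂ} (hτ : τ = σ * s) :
    HasBirkhoffAsymptotics T β Ω τ (columnMatrix s y) := by
  have hcl := fun ρ hρ => mul_mem_closedRegion_of_mem_closure hΩ (ρ := ρ) hρ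
  have hnorm : ∀ (ρ : ℂ) (x : ℝ), 0 < x → ‖ρ * x‖ = ‖ρ‖ * x := fun ρ x hx => by
    rw [norm_mul, Complex.norm_real, Real.norm_of_nonneg hx.le]
  have key : ∀ x ∈ Ioc 0 T, ∀ ρ ∈ closure Ω, 1 ≤ ‖ρ * x‖ → ∀ n ≤ 1, ∀ i j,
      ‖remainder T τ n (columnMatrix s y) x ρ i j‖ ≤ C * (‖ρ‖ ^ (-β) + ‖ρ * x‖⁻¹) := by
    intro x hx ρ hρ hρx n hn i j
    have hκ := hcl ρ hρ
    have hne := norm_sign_mul_I_mul hs ρ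
    rw [hnorm ρ x hx.1] at hρx ⊢
    rw [← hne] at hρx ⊢
    have hrem : τ * Complex.I * ρ = σ * (s * Complex.I * ρ) := by rw [hτ]; ring
    simp only [remainder, Matrix.sub_apply, Matrix.smul_apply, smul_eq_mul, hrem]
    interval_cases n
    · rw [xDeriv_zero, pow_zero, one_mul, ← Complex.exp_neg]
      exact (h j).asymp _ hκ x hx.1 hρx i
    · rw [xDeriv_one_columnMatrix h hκ hx, pow_one, mul_inv, ← Complex.exp_neg]
      exact (h j).asymp_deriv _ hκ x hx.1 hρx i
  refine ⟨fun δ hδ => ⟨C * (1 + δ⁻¹), fun x hx ρ hρ hρx n hn i j => ?_⟩, C, key⟩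
  have hx0 : 0 < x := hδ.trans_le hx.1
  refine (key x ⟨hx0, hx.2⟩ ρ hρ hρx n hn i j).trans ?_
  -- For x ≥ δ the term ‖ρx‖⁻¹ is at most δ⁻¹‖ρ‖⁻¹, hence at most δ⁻¹‖ρ‖^{-β}, because ‖ρ‖ ≥ 1 and β
  -- ≤ 1.
  have hρ1 : 1 ≤ ‖ρ‖ := by
    rw [← norm_sign_mul_I_mul hs ρ]
    exact hR.trans (hcl ρ hρ).2.2
  have h1 : ‖ρ‖⁻¹ ≤ ‖ρ‖ ^ (-β) := by
    rw [← Real.rpow_neg_one]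
    exact Real.rpow_le_rpow_of_exponent_le hρ1 (by linarith)
  have h2 : ‖ρ * x‖⁻¹ ≤ δ⁻¹ * ‖ρ‖ ^ (-β) := by
    rw [hnorm ρ x hx0, mul_inv, mul_comm]
    gcongr
    exact hx.1
  rw [mul_assoc, add_mul, one_mul]
  gcongr

/-- The initial data are compared with exponentials at the interior point T/2. The smallness
conditions supply the closeness required by `eq_zero_of_near_exponential`. -/
lemma isFundamentalSystem_columnMatrix {C₂ : ℝ} {y₂ y₂' : Fin m → ℂ → ℝ → Fin m → ℂ}
    (hT : 0 < T) (hs : s = 1 ∨ s = -1)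
    (hQ : ∀ i j a b, a ∈ Ioo 0 T → b ∈ Ioo 0 T →
      IntervalIntegrable (fun t => Q t i j) volume a b)
    (h₁ : ∀ j, IsExponentialColumn T ν Q s s β R C j (y j) (y' j)) {R₂ : ℝ}
    (h₂ : ∀ j, IsExponentialColumn T ν Q s (-s) β R₂ C₂ j (y₂ j) (y₂' j)) {ρ : ℂ} (hρ0 : ρ ≠ 0)
    (hρ₁ : s * Complex.I * ρ ∈ closedRegion s R) (hρ₂ : s * Complex.I * ρ ∈ closedRegion s R₂)
    (hρT : 1 ≤ ‖ρ‖ * (T / 2))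
    (hsmall₁ : 4 * m * (C * (‖ρ‖ ^ (-β) + (‖ρ‖ * (T / 2))⁻¹)) ≤ 1)
    (hsmall₂ : 4 * m * (C₂ * (‖ρ‖ ^ (-β) + (‖ρ‖ * (T / 2))⁻¹)) ≤ 1) :
    IsFundamentalSystem T ν Q (ρ ^ 2)
      (columns (fun x => columnMatrix s y x ρ) (fun x => columnMatrix s y₂ x ρ)) := by
  have hx : T / 2 ∈ Ioo 0 T := ⟨by linarith, by linarith⟩
  have hκ0 : s * Complex.I * ρ ≠ 0 := by
    rw [← norm_pos_iff, norm_sign_mul_I_mul hs]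
    exact norm_pos_iff.2 hρ0
  have hnorm := norm_sign_mul_I_mul hs ρ
  have hsq := neg_sq_sign_mul_I_mul hs ρ
  have hss : (s : ℂ) * s = 1 := by rcases hs with rfl | rfl <;> norm_num
  have hs0 : (s : ℂ) ≠ 0 := left_ne_zero_of_mul_eq_one hss
  refine isFundamentalSystem_of_injective hQ ?_ hx ?_
  · rintro (j | j)
    · rw [← hsq]
      exact (h₁ j).isSolution _ hρ₁
    · rw [← hsq]
      exact (h₂ j).isSolution _ hρ₂
  · intro c hc hc'
    set κ := s * Complex.I * ρ with hκ
    have hd₁ : ∀ j, deriv (y j κ) (T / 2) = y' j κ (T / 2) := fun j =>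
      (hasDerivAt_pi.2 fun q => (h₁ j).hasDerivAt κ hρ₁ _ hx.1 q).deriv
    have hd₂ : ∀ j, deriv (y₂ j κ) (T / 2) = y₂' j κ (T / 2) := fun j =>
      (hasDerivAt_pi.2 fun q => (h₂ j).hasDerivAt κ hρ₂ _ hx.1 q).deriv
    have e0 : ∀ q, ∑ j, c (Sum.inl j) * y j κ (T / 2) q +
        ∑ j, c (Sum.inr j) * y₂ j κ (T / 2) q = 0 := by
      intro q
      have := congrFun hc q
      rw [Fintype.sum_sum_type] at this
      simpa [columns, columnMatrix, Finset.sum_apply] using this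
    have e0' : ∀ q, ∑ j, c (Sum.inl j) * y' j κ (T / 2) q +
        ∑ j, c (Sum.inr j) * y₂' j κ (T / 2) q = 0 := by
      intro q
      have := congrFun hc' q
      rw [Fintype.sum_sum_type] at this
      have g₁ : ∀ j, columns (fun x => columnMatrix s y x ρ) (fun x => columnMatrix s y₂ x ρ)
        (Sum.inl j) = y j κ := fun j => rfl
      have g₂ : ∀ j, columns (fun x => columnMatrix s y x ρ) (fun x => columnMatrix s y₂ x ρ)
        (Sum.inr j) = y₂ j κ := fun j => rfl
      simp only [g₁, g₂, hd₁, hd₂] at this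
      simpa [Finset.sum_apply] using this
    have hε : 4 * m * (max C C₂ * (‖κ‖ ^ (-β) + (‖κ‖ * (T / 2))⁻¹)) ≤ 1 := by
      rw [hnorm]
      rcases le_total C C₂ with hle | hle
      · rwa [max_eq_right hle]
      · rwa [max_eq_left hle]
    have hT2 := hx.1
    have hb₁ : C * (‖κ‖ ^ (-β) + (‖κ‖ * (T / 2))⁻¹) ≤
        max C C₂ * (‖κ‖ ^ (-β) + (‖κ‖ * (T / 2))⁻¹) :=
      mul_le_mul_of_nonneg_right (le_max_left _ _) (by positivity)
    have hb₂ : C₂ * (‖κ‖ ^ (-β) + (‖κ‖ * (T / 2))⁻¹) ≤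
        max C C₂ * (‖κ‖ ^ (-β) + (‖κ‖ * (T / 2))⁻¹) :=
      mul_le_mul_of_nonneg_right (le_max_right _ _) (by positivity)
    rw [← hnorm] at hρT
    -- Here E = e^{sκT/2}, and its logarithmic derivative sκ plays the role of μ.
    have hall := eq_zero_of_near_exponential hε
      (E := Complex.exp (s * κ * (T / 2 : ℝ))) (Complex.exp_ne_zero _) (mul_ne_zero hs0 hκ0)
      (fun j q => ?_) (fun j q => ?_) (fun j q => ?_) (fun j q => ?_) e0 e0'
    · funext i
      rcases i with j | j
      · exact (hall j).1
      · exact (hall j).2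
    · rw [← Complex.exp_neg]
      exact ((h₁ j).asymp κ hρ₁ _ hx.1 hρT q).trans hb₁
    · rw [← Complex.exp_neg]
      exact ((h₁ j).asymp_deriv κ hρ₁ _ hx.1 hρT q).trans hb₁
    · have := ((h₂ j).asymp κ hρ₂ _ hx.1 hρT q).trans hb₂
      simpa only [Complex.ofReal_neg, neg_mul, neg_neg] using this
    · have := ((h₂ j).asymp_deriv κ hρ₂ _ hx.1 hρT q).trans hb₂
      simpa only [Complex.ofReal_neg, neg_mul, neg_neg] using this

end ExponentialColumns

/-- The Birkhoff systems for one of the two sectors. -/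
theorem exists_birkhoff_system {m : ℕ} (hm : 0 < m) {T : ℝ} (hT : 0 < T) {ν : Fin m → ℝ}
    (hν_anti : Antitone ν) (hν_pos : ∀ q, 0 < ν q) {Q : ℝ → Matrix (Fin m) (Fin m) ℂ}
    (hQ : ∀ i j, IntegrableOn
      (fun x : ℝ => ((x ^ (1 - 2 * ν ⟨0, hm⟩) : ℝ) : ℂ) * Q x i j) (Ioo 0 T))
    {k : ℤ} {s : ℝ} (hk : k = 0 ∧ s = -1 ∨ k = -1 ∧ s = 1) :
    ∃ ρ₀ : ℝ, 0 < ρ₀ ∧ ∀ ρs ≥ ρ₀, ∃ Y₁ Y₂ : ℝ → ℂ → Matrix (Fin m) (Fin m) ℂ,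
      (∀ ρ ∈ closure (sector k ρs),
        IsFundamentalSystem T ν Q (ρ ^ 2) (columns (fun x => Y₁ x ρ) (fun x => Y₂ x ρ))) ∧
      IsBirkhoffRegular T (sector k ρs) Y₁ ∧ IsBirkhoffRegular T (sector k ρs) Y₂ ∧
      HasBirkhoffAsymptotics T (min 1 (2 * ν ⟨0, hm⟩)) (sector k ρs) 1 Y₁ ∧
      HasBirkhoffAsymptotics T (min 1 (2 * ν ⟨0, hm⟩)) (sector k ρs) (-1) Y₂ := by
  have hs : s = 1 ∨ s = -1 := by tauto
  have hss : (s : ℂ) * s = 1 := by rcases hs with rfl | rfl <;> norm_num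
  -- Since iρ = sκ, the columns of Y₁ behave like e^{sκx}, so σ = s; those of Y₂ have σ = -s. Which
  -- of the two grows depends on the sector.
  obtain ⟨R₁, hR₁, C₁, hC₁, y₁, y₁', h₁⟩ :=
    exists_isExponentialColumn hm hT hν_anti hν_pos hQ hs hs
  obtain ⟨R₂, hR₂, C₂, hC₂, y₂, y₂', h₂⟩ :=
    exists_isExponentialColumn hm hT hν_anti hν_pos hQ hs (σ := -s)
      (by rcases hs with rfl | rfl <;> simp)
  set β := min 1 (2 * ν ⟨0, hm⟩) with hβ
  have hβ0 : 0 < β := lt_min one_pos (by linarith [hν_pos ⟨0, hm⟩])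
  have hlim : ∀ C : ℝ, ∀ᶠ r : ℝ in atTop, 4 * m * (C * (r ^ (-β) + (r * (T / 2))⁻¹)) ≤ 1 := by
    intro C
    have t1 : Tendsto (fun r : ℝ => (r * (T / 2))⁻¹) atTop (𝓝 0) :=
      tendsto_inv_atTop_zero.comp (tendsto_id.atTop_mul_const (by linarith))
    have t2 := (((tendsto_rpow_neg_atTop hβ0).add t1).const_mul C).const_mul (4 * m : ℝ)
    simp only [add_zero, mul_zero] at t2
    exact t2.eventually_le_const one_pos
  obtain ⟨ρ₀, hρ₀⟩ := eventually_atTop.1 ((hlim C₁).and (hlim C₂))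
  -- R₁ and R₂ ensure existence of the columns, ρ₀ their independence, and 2/T that ‖ρ‖T/2 ≥ 1, so
  -- that the asymptotics apply at T/2.
  refine ⟨max (max R₁ R₂) (max ρ₀ (2 / T)), by positivity, fun ρs hρs => ?_⟩
  simp only [ge_iff_le, max_le_iff] at hρs
  obtain ⟨⟨hr₁, hr₂⟩, hr₀, hrT⟩ := hρs
  have hρs0 : 0 < ρs := by linarith
  have hΩ₁ : ∀ ρ ∈ sector k ρs, s * Complex.I * ρ ∈ openRegion s R₁ := fun ρ hρ =>
    mul_mem_openRegion_of_mem_sector hk hr₁ hρs0 hρ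
  have hΩ₂ : ∀ ρ ∈ sector k ρs, s * Complex.I * ρ ∈ openRegion s R₂ := fun ρ hρ =>
    mul_mem_openRegion_of_mem_sector hk hr₂ hρs0 hρ
  have hle : ∀ ρ ∈ closure (sector k ρs), ρs ≤ ‖ρ‖ := fun ρ hρ => by
    rw [← norm_sign_mul_I_mul hs ρ]
    exact (mul_mem_closedRegion_of_mem_closure
      (fun ρ hρ => mul_mem_openRegion_of_mem_sector hk le_rfl hρs0 hρ) hρ).2.2
  refine ⟨columnMatrix s y₁, columnMatrix s y₂, fun ρ hρ => ?_,
    isBirkhoffRegular_columnMatrix h₁ hΩ₁, isBirkhoffRegular_columnMatrix h₂ hΩ₂,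
    hasBirkhoffAsymptotics_columnMatrix h₁ hs hR₁ hC₁ (min_le_left _ _) hΩ₁ hss.symm,
    hasBirkhoffAsymptotics_columnMatrix h₂ hs hR₂ hC₂ (min_le_left _ _) hΩ₂ ?_⟩
  · have hρn := hle ρ hρ
    obtain ⟨hs₁, hs₂⟩ := hρ₀ ‖ρ‖ (hr₀.trans hρn)
    refine isFundamentalSystem_columnMatrix hT hs
      (fun i j a b ha hb => intervalIntegrable_of_rpow_mul (hQ i j) ha hb) h₁ h₂
      (norm_pos_iff.1 (hρs0.trans_le hρn)) (mul_mem_closedRegion_of_mem_closure hΩ₁ hρ)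
      (mul_mem_closedRegion_of_mem_closure hΩ₂ hρ) ?_ hs₁ hs₂
    have h2 := hrT.trans hρn
    rw [div_le_iff₀ hT] at h2
    linarith
  · rw [Complex.ofReal_neg, neg_mul, hss]

end

end

theorem theorem1 (m : ℕ) (hm : 0 < m) (T : ℝ) (hT : 0 < T)
    (ν : Fin m → ℝ) (hν_anti : Antitone ν) (hν_pos : ∀ q, 0 < ν q)
    (hν_nat : ∀ q, ∀ n : ℕ, ν q ≠ n)
    (Q : ℝ → Matrix (Fin m) (Fin m) ℂ)
    (hQ : ∀ i j, MeasureTheory.IntegrableOn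
      (fun x : ℝ => ((x ^ (1 - 2 * ν ⟨0, hm⟩) : ℝ) : ℂ) * Q x i j) (Set.Ioo 0 T)) :
    ∃ ρ₀ : ℝ, 0 < ρ₀ ∧ ∀ ρs ≥ ρ₀, ∀ k : ℤ, k = 0 ∨ k = -1 →
      ∃ Y₁ Y₂ : ℝ → ℂ → Matrix (Fin m) (Fin m) ℂ,
        (∀ ρ ∈ closure (sector k ρs),
          IsFundamentalSystem T ν Q (ρ ^ 2) (columns (fun x => Y₁ x ρ) (fun x => Y₂ x ρ))) ∧
        IsBirkhoffRegular T (sector k ρs) Y₁ ∧ IsBirkhoffRegular T (sector k ρs) Y₂ ∧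
        HasBirkhoffAsymptotics T (min 1 (2 * ν ⟨0, hm⟩)) (sector k ρs) 1 Y₁ ∧
        HasBirkhoffAsymptotics T (min 1 (2 * ν ⟨0, hm⟩)) (sector k ρs) (-1) Y₂ := by
  obtain ⟨r₁, hr₁, h₁⟩ := exists_birkhoff_system hm hT hν_anti hν_pos hQ (Or.inl ⟨rfl, rfl⟩)
  obtain ⟨r₂, -, h₂⟩ := exists_birkhoff_system hm hT hν_anti hν_pos hQ (Or.inr ⟨rfl, rfl⟩)
  refine ⟨max r₁ r₂, lt_max_of_lt_left hr₁, ?_⟩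
  rintro ρs hρs k (rfl | rfl)
  · exact h₁ ρs ((le_max_left _ _).trans hρs)
  · exact h₂ ρs ((le_max_right _ _).trans hρs)
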